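/- **Corollary (multiplicative PTAS for discrete unit-demand pricing).** In the unit-demand pricing problem a seller offers $n$ items to one buyer. The buyer's value $v_i\ge 0$ for item $i$ is drawn from a distribution $F_i$, independently over the items. Each $F_i$ has finite support and is given explicitly, as a list of mass points (nonnegative rational values) with positive rational probabilities that sum to $1$, all numerators and denominators being written in binary. The seller posts a price $p_i\ge 0$ for every item, without any restriction on the prices. The buyer buys an item $i^*$ that maximizes $v_i-p_i$ and pays $p_{i^*}$, provided that $v_{i^*}-p_{i^*}\ge 0$, and otherwise buys nothing and pays $0$; ties are broken in favour of the seller. Let $\mathcal R_I(p)$ be the expected payment at the prices $p$ in the instance $I$. There is a multiplicative PTAS for this problem, that is, there is an algorithm $A$ with the following property. For every rational $\varepsilon\in(0,1)$ there is a polynomial $q_\varepsilon$ such that for every instance $I$ (with any number $n$ of items), $A$ on input $(\varepsilon,I)$ halts in time at most $q_\varepsilon(|I|)$, where $|I|$ is the bit size of $I$, and outputs a vector $\hat p$ of nonnegative rational prices with $$\mathcal R_I(\hat p)\;\ge\;(1-\varepsilon)\,\mathcal R_I(p)\qquad\text{for all } p\in[0,\infty)^n .$$ Time is measured on a machine whose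 elementary operations (copying and forming pairs, projections, and addition, truncated subtraction, multiplication and integer division of natural numbers) each cost the bit size of the data that they read and write (logarithmic cost). -/

import Mathlib

open scoped BigOperators

/-! ### A model of computation with logarithmic (bit) cost

Programs manipulate finite binary trees whose leaves are natural numbers.  Every operation is charged
the total bit size of the data that it reads and writes, as in the logarithmic-cost random access
machine, so that running times are polynomially related to those of Turing machines.  The language
has an unbounded loop and is Turing complete. -/

namespace BitCost

/-- The data of the model: binary trees with natural numbers at the leaves. -/
inductive Val : Type
  | nat (n : ℕ) : Val
  | pair (a b : Val) : Val

namespace Val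

/-- The bit size of a datum: a leaf `n` counts its binary digits plus one, an inner node counts
one. -/
def size : Val → ℕ
  | nat n => Nat.size n + 1
  | pair a b => a.size + b.size + 1

/-- Lists as data: the empty list is the leaf `0`. -/
def list : List Val → Val
  | [] => nat 0
  | a :: l => pair a (list l)

/-- The fraction `a / b` as a datum. -/
def frac (a b : ℕ) : Val := pair (nat a) (nat b)

/-- A nonnegative rational number as a datum: numerator and denominator in lowest terms. -/
def rat (x : NNRat) : Val := frac x.num x.den

end Val

/-- The elementary operations. -/
inductive Op : Type
  | id
  | const (n : ℕ)
  | fst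
  | snd
  | add
  | sub
  | mul
  | div

/-- The result of an elementary operation; `none` means that the operation is not applicable.
Subtraction is truncated at `0` and `div` is the integer quotient, with `n / 0 = 0`. -/
def Op.apply : Op → Val → Option Val
  | .id, x => some x
  | .const n, _ => some (.nat n)
  | .fst, .pair a _ => some a
  | .snd, .pair _ b => some b
  | .add, .pair (.nat a) (.nat b) => some (.nat (a + b))
  | .sub, .pair (.nat a) (.nat b) => some (.nat (a - b))
  | .mul, .pair (.nat a) (.nat b) => some (.nat (a * b))
  | .div, .pair (.nat a) (.nat b) => some (.nat (a / b))
  | _, _ => none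

/-- Programs: elementary operations, sequential composition `seq f g` (first `f`, then `g`), pairing
`both f g` (run `f` and `g` on copies of the input and pair the results), branching and loops. -/
inductive Prog : Type
  | op (o : Op)
  | seq (f g : Prog)
  | both (f g : Prog)
  | ite (c f g : Prog)
  | loop (c f : Prog)

/-- `Runs P x y t`: the program `P` started on `x` halts with the result `y` after time `t`.  A
condition counts as false exactly when it evaluates to the leaf `0`; `loop c f` repeats `f` as long
as `c` is true.  Elementary operations cost the size of their input plus the size of their output,
so that in every run the time is at least the size of the input and of the output. -/
inductive Runs : Prog → Val → Val → ℕ → Prop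
  | op {o : Op} {x y : Val} (h : o.apply x = some y) :
      Runs (.op o) x y (x.size + y.size)
  | seq {f g : Prog} {x y z : Val} {s t : ℕ} (hf : Runs f x y s) (hg : Runs g y z t) :
      Runs (.seq f g) x z (s + t + 1)
  | both {f g : Prog} {x y z : Val} {s t : ℕ} (hf : Runs f x y s) (hg : Runs g x z t) :
      Runs (.both f g) x (.pair y z) (s + t + 1)
  | ite_true {c f g : Prog} {x b y : Val} {s t : ℕ} (hc : Runs c x b s) (hb : b ≠ .nat 0)
      (hf : Runs f x y t) : Runs (.ite c f g) x y (s + t + 1)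
  | ite_false {c f g : Prog} {x y : Val} {s t : ℕ} (hc : Runs c x (.nat 0) s)
      (hg : Runs g x y t) : Runs (.ite c f g) x y (s + t + 1)
  | loop_done {c f : Prog} {x : Val} {s : ℕ} (hc : Runs c x (.nat 0) s) :
      Runs (.loop c f) x x (s + 1)
  | loop_step {c f : Prog} {x b y z : Val} {r s t : ℕ} (hc : Runs c x b r) (hb : b ≠ .nat 0)
      (hf : Runs f x y s) (hl : Runs (.loop c f) y z t) :
      Runs (.loop c f) x z (r + s + t + 1)

/-- Programs are deterministic: the result and the running time are functions of the input. -/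
theorem Runs.deterministic {P : Prog} {x y y' : Val} {t t' : ℕ} (h : Runs P x y t)
    (h' : Runs P x y' t') : y = y' ∧ t = t' := by
  induction h generalizing y' t' with
  | op h =>
    cases h' with
    | op h2 =>
      rw [h] at h2
      cases h2
      exact ⟨rfl, rfl⟩
  | seq _ _ ih1 ih2 =>
    cases h' with
    | seq a b =>
      obtain ⟨rfl, rfl⟩ := ih1 a
      obtain ⟨rfl, rfl⟩ := ih2 b
      exact ⟨rfl, rfl⟩
  | both _ _ ih1 ih2 =>
    cases h' with
    | both a b =>
      obtain ⟨rfl, rfl⟩ := ih1 a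
      obtain ⟨rfl, rfl⟩ := ih2 b
      exact ⟨rfl, rfl⟩
  | ite_true _ hb _ ih1 ih2 =>
    cases h' with
    | ite_true a _ b =>
      obtain ⟨rfl, rfl⟩ := ih1 a
      obtain ⟨rfl, rfl⟩ := ih2 b
      exact ⟨rfl, rfl⟩
    | ite_false a _ => exact absurd (ih1 a).1 hb
  | ite_false _ _ ih1 ih2 =>
    cases h' with
    | ite_true a hb _ => exact absurd (ih1 a).1.symm hb
    | ite_false a b =>
      obtain ⟨_, rfl⟩ := ih1 a
      obtain ⟨rfl, rfl⟩ := ih2 b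
      exact ⟨rfl, rfl⟩
  | loop_done _ ih =>
    cases h' with
    | loop_done a =>
      obtain ⟨_, rfl⟩ := ih a
      exact ⟨rfl, rfl⟩
    | loop_step a hb _ _ => exact absurd (ih a).1.symm hb
  | loop_step _ hb _ _ ih1 ih2 ih3 =>
    cases h' with
    | loop_done a => exact absurd (ih1 a).1 hb
    | loop_step a _ b c =>
      obtain ⟨rfl, rfl⟩ := ih1 a
      obtain ⟨rfl, rfl⟩ := ih2 b
      obtain ⟨rfl, rfl⟩ := ih3 c
      exact ⟨rfl, rfl⟩

end BitCost

/-! ### Unit-demand pricing with independent, finitely supported values -/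

namespace UnitDemand

/-- An instance: `n` items, where the value of item `i` equals `value i k` with probability
`prob i k`, for `k` ranging over the `K i` mass points of item `i`. -/
structure Instance where
  n : ℕ
  K : Fin n → ℕ
  value : (i : Fin n) → Fin (K i) → NNRat
  prob : (i : Fin n) → Fin (K i) → NNRat
  prob_pos : ∀ i k, 0 < prob i k
  prob_sum : ∀ i, ∑ k, prob i k = 1

open Classical in
/-- The items among which a buyer with values `v` chooses at prices `p`: those that maximize the
utility `v i - p i`, provided that this utility is nonnegative. -/
noncomputable def favourites {n : ℕ} (v p : Fin n → ℝ) : Finset (Fin n) :=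
  Finset.univ.filter fun i => 0 ≤ v i - p i ∧ ∀ j, v j - p j ≤ v i - p i

open Classical in
/-- The seller's revenue from a buyer with values `v` at prices `p`: the price of the favourite item,
ties being broken in favour of the seller, and `0` if every item has negative utility. -/
noncomputable def payment {n : ℕ} (v p : Fin n → ℝ) : ℝ :=
  if h : (favourites v p).Nonempty then (favourites v p).sup' h p else 0

namespace Instance

/-- The expected revenue of the prices `p`.  The values of the items are independent, so a profile
`s` of mass points, one for each item, has probability `∏ i, prob i (s i)`. -/
noncomputable def revenue (I : Instance) (p : Fin I.n → ℝ) : ℝ :=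
  ∑ s : (i : Fin I.n) → Fin (I.K i),
    (∏ i, (I.prob i (s i) : ℝ)) * payment (fun i => (I.value i (s i) : ℝ)) p

/-- The instance as an input: the list, over the items, of the lists of the mass points, each given
by its value and its probability, with numerators and denominators in binary. -/
def encode (I : Instance) : BitCost.Val :=
  .list (List.ofFn fun i => .list (List.ofFn fun k =>
    .pair (.rat (I.value i k)) (.rat (I.prob i k))))

end Instance

/-- The output that lists the prices `a i / b i` of the items. -/
def encodePrices {n : ℕ} (a b : Fin n → ℕ) : BitCost.Val :=
  .list (List.ofFn fun i => .frac (a i) (b i))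

end UnitDemand

/-! ### Polynomial-time functions between encodable types -/

namespace BitCost

/-! Fix an integer `r` of order `1/ε`. Let `τ_i(H)` be the best revenue from item `i` alone at a
price above `H`, and let `E` be the minimum of `H + Σ_i τ_i(H)` over `H = 0` and the mass points.
Then `OPT ≤ E ≤ 4 OPT` (`isScale`): every such sum bounds the revenue, and for `H` a median of the
largest value, the uniform price `H` and separate prices above `H` each recover half of their term.
Moreover some value exceeds `x E` with probability at most `1/x`, for `x > 1`.

Hence items priced at `r² E` or more hardly interact with the others and contribute about `p_j
Pr[v_j ≥ p_j]` each. For the other items, values and prices are rounded to multiples of `E/r²`.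
Rounding can change the buyer's choice, but a prior discount of all prices by `1 - 1/r` favours
expensive items, so a changed choice loses only `O(E/r)`. In the rounded market the buyer takes the
item of largest rank (rounded utility, then price level), and the number `m` of ranks depends on `r`
only. So the revenue is nearly a sum of separate terms plus a functional of the distribution of a
maximum of independent ranks (`revenue_le_estimate`, `estimate_le_revenue`).

The distribution function of a maximum is a product over the items. A dynamic program therefore
records only the `m` partial products, rounded down to multiples of `1/M` with `M` linear in `n`
(`roundedProd_bounds`), and for each such vector the largest separate revenue. This is lossless
apart from the rounding (`exists_mem_states`, `prices_spec`), and there are at most `(M+1)^m`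
vectors.

For the running time, functions computed by programs in polynomial time are closed under
composition, branching and folds with controlled accumulators. One program serves all `ε`: its time
is polynomial in `cost` (`timeIn_solve`), which for fixed `ε` is polynomial in the size of the
instance. -/

theorem Val.size_pos : ∀ x : Val, 0 < x.size
  | .nat _ => Nat.succ_pos _
  | .pair _ _ => Nat.succ_pos _

/-- Every operation is charged for its output, so a time bound is also a size bound. This is what
makes polynomial time closed under composition. -/
theorem Runs.size_le {P : Prog} {x y : Val} {t : ℕ} (h : Runs P x y t) :
    x.size ≤ t ∧ y.size ≤ t := by
  induction h <;> (try simp only [Val.size]) <;> omega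

theorem Polynomial.monotone_eval_nat (q : Polynomial ℕ) : Monotone fun n => q.eval n := by
  intro a b h
  simp only [Polynomial.eval_eq_sum]
  exact Finset.sum_le_sum fun i _ => Nat.mul_le_mul le_rfl (Nat.pow_le_pow_left h i)

/-- Types whose elements are represented by data of the machine. -/
class Enc (α : Type) where
  enc : α → Val

instance : Enc ℕ := ⟨.nat⟩

instance {α β : Type} [Enc α] [Enc β] : Enc (α × β) := ⟨fun x => .pair (Enc.enc x.1) (Enc.enc x.2)⟩

instance {α : Type} [Enc α] : Enc (List α) := ⟨fun l => .list (l.map Enc.enc)⟩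

open Enc

/-- The bit size of the representation. -/
def sz {α : Type} [Enc α] (a : α) : ℕ := (enc a).size

section Size

variable {α β : Type} [Enc α] [Enc β]

theorem sz_pos (a : α) : 0 < sz a := Val.size_pos _

@[simp] theorem enc_pair (a : α) (b : β) : enc (a, b) = .pair (enc a) (enc b) := rfl
@[simp] theorem enc_nat (n : ℕ) : enc n = .nat n := rfl
@[simp] theorem enc_nil : enc ([] : List α) = .nat 0 := rfl
@[simp] theorem enc_cons (a : α) (l : List α) : enc (a :: l) = .pair (enc a) (enc l) := rfl
@[simp] theorem sz_pair (a : α) (b : β) : sz (a, b) = sz a + sz b + 1 := rfl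
theorem sz_prod (p : α × β) : sz p = sz p.1 + sz p.2 + 1 := rfl
theorem sz_nat (n : ℕ) : sz n = Nat.size n + 1 := rfl
@[simp] theorem sz_nil : sz ([] : List α) = 1 := rfl
@[simp] theorem sz_cons (a : α) (l : List α) : sz (a :: l) = sz a + sz l + 1 := rfl

/-- The two lists share one terminal leaf in the concatenation. -/
theorem sz_append (l l' : List α) : sz (l ++ l') + 1 = sz l + sz l' := by
  induction l with
  | nil => simp; omega
  | cons a l ih => simp; omega

theorem sz_mem {a : α} {l : List α} (h : a ∈ l) : sz a ≤ sz l := by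
  induction h with
  | head => simp; omega
  | tail _ _ ih => simp; omega

theorem length_lt_sz (l : List α) : l.length < sz l := by
  induction l with
  | nil => simp
  | cons a l ih => simp; omega

theorem sz_list_le {l : List α} {B : ℕ} (h : ∀ a ∈ l, sz a ≤ B) :
    sz l ≤ l.length * (B + 1) + 1 := by
  induction l with
  | nil => simp
  | cons a l ih =>
    have h1 := ih fun a ha => h a (List.mem_cons_of_mem _ ha)
    have h2 := h a List.mem_cons_self
    simp only [sz_cons, List.length_cons, Nat.add_mul]
    omega

theorem size_add_le (a b : ℕ) : Nat.size (a + b) ≤ Nat.size a + Nat.size b := by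
  rcases Nat.eq_zero_or_pos a with rfl | ha
  · simp
  rcases Nat.eq_zero_or_pos b with rfl | hb
  · simp
  rw [Nat.size_le]
  have h1 := Nat.lt_size_self a
  have h2 := Nat.lt_size_self b
  have h3 := Nat.size_pos.2 ha
  have h4 := Nat.size_pos.2 hb
  rw [pow_add]
  have h5 : 2 ≤ 2 ^ a.size := by
    calc 2 = 2 ^ 1 := rfl
      _ ≤ _ := Nat.pow_le_pow_right (by norm_num) h3
  have h6 : 2 ≤ 2 ^ b.size := by
    calc 2 = 2 ^ 1 := rfl
      _ ≤ _ := Nat.pow_le_pow_right (by norm_num) h4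
  nlinarith

theorem size_mul_le (a b : ℕ) : Nat.size (a * b) ≤ Nat.size a + Nat.size b := by
  rw [Nat.size_le, pow_add]
  exact Nat.mul_lt_mul'' (Nat.lt_size_self a) (Nat.lt_size_self b)

theorem sz_le_self (n : ℕ) : sz n ≤ n + 1 := by
  rw [sz_nat]
  have : n.size ≤ n := Nat.size_le.2 Nat.lt_two_pow_self
  omega

theorem sz_add_le (a b : ℕ) : sz (a + b) ≤ sz a + sz b := by
  have := size_add_le a b
  simp only [sz_nat]; omega

theorem sz_mul_le (a b : ℕ) : sz (a * b) ≤ sz a + sz b := by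
  have := size_mul_le a b
  simp only [sz_nat]; omega

theorem sz_mono {a b : ℕ} (h : a ≤ b) : sz a ≤ sz b := by
  have := Nat.size_le_size h
  simp only [sz_nat]; omega

end Size

variable {α β γ δ σ : Type} [Enc α] [Enc β] [Enc γ] [Enc δ] [Enc σ]

/-- `f` is computed by a program whose running time is polynomial in the measure `κ` of the input. -/
def TimeIn (κ : α → ℕ) (f : α → β) : Prop :=
  ∃ (P : Prog) (q : Polynomial ℕ), ∀ a, ∃ t, Runs P (enc a) (enc (f a)) t ∧ t ≤ q.eval (κ a)

/-- `f` is computable in polynomial time. -/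
@[fun_prop]
def PolyTime (f : α → β) : Prop := TimeIn sz f

theorem TimeIn.sz_le {κ : α → ℕ} {f : α → β} (h : TimeIn κ f) :
    ∃ q : Polynomial ℕ, ∀ a, sz (f a) ≤ q.eval (κ a) := by
  obtain ⟨P, q, h⟩ := h
  refine ⟨q, fun a => ?_⟩
  obtain ⟨t, h1, h2⟩ := h a
  exact h1.size_le.2.trans h2

theorem TimeIn.comp {κ : α → ℕ} {f : α → β} {g : β → γ} (hg : PolyTime g) (hf : TimeIn κ f) :
    TimeIn κ fun a => g (f a) := by
  obtain ⟨P, q, h⟩ := hf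
  obtain ⟨P', q', h'⟩ := hg
  refine ⟨.seq P P', q + q'.comp q + 1, fun a => ?_⟩
  obtain ⟨t, h1, h2⟩ := h a
  obtain ⟨t', h1', h2'⟩ := h' (f a)
  refine ⟨_, .seq h1 h1', ?_⟩
  -- The intermediate result is no larger than the time of the first run, so the second polynomial
  -- may be evaluated at the first.
  have h3 := Polynomial.monotone_eval_nat q' (h1.size_le.2.trans h2)
  simp only [Polynomial.eval_add, Polynomial.eval_comp, Polynomial.eval_one]
  simp only [sz] at *
  omega

theorem TimeIn.prodMk {κ : α → ℕ} {f : α → β} {g : α → γ} (hf : TimeIn κ f) (hg : TimeIn κ g) :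
    TimeIn κ fun a => (f a, g a) := by
  obtain ⟨P, q, h⟩ := hf
  obtain ⟨P', q', h'⟩ := hg
  refine ⟨.both P P', q + q' + 1, fun a => ?_⟩
  obtain ⟨t, h1, h2⟩ := h a
  obtain ⟨t', h1', h2'⟩ := h' a
  refine ⟨_, .both h1 h1', ?_⟩
  simp only [Polynomial.eval_add, Polynomial.eval_one]
  omega

theorem TimeIn.mono {κ κ' : α → ℕ} {f : α → β} (hf : TimeIn κ f) (h : ∀ a, κ a ≤ κ' a) :
    TimeIn κ' f := by
  obtain ⟨P, q, hf⟩ := hf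
  refine ⟨P, q, fun a => ?_⟩
  obtain ⟨t, h1, h2⟩ := hf a
  exact ⟨t, h1, h2.trans (Polynomial.monotone_eval_nat q (h a))⟩

namespace PolyTime

@[fun_prop]
theorem id : PolyTime fun a : α => a :=
  ⟨.op .id, 2 * Polynomial.X, fun a => ⟨_, .op rfl, by simp [sz]; omega⟩⟩

@[fun_prop]
theorem comp {f : α → β} {g : β → γ} (hg : PolyTime g) (hf : PolyTime f) :
    PolyTime fun a => g (f a) := TimeIn.comp hg hf

@[fun_prop]
theorem prodMk {f : α → β} {g : α → γ} (hf : PolyTime f) (hg : PolyTime g) :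
    PolyTime fun a => (f a, g a) := TimeIn.prodMk hf hg

/-- The program copies the shape of the tree with one constant operation per leaf; each reads the
input once, so the time is linear. -/
theorem exists_runs_const (x : Val) :
    ∃ (P : Prog) (k : ℕ), ∀ y : Val, ∃ t, Runs P y x t ∧ t ≤ k * y.size + k := by
  induction x with
  | nat n =>
    refine ⟨.op (.const n), (Val.nat n).size + 1, fun y => ⟨_, .op rfl, ?_⟩⟩
    nlinarith [y.size_pos, (Val.nat n).size_pos]
  | pair a b iha ihb =>
    obtain ⟨P, k, h⟩ := iha
    obtain ⟨P', k', h'⟩ := ihb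
    refine ⟨.both P P', k + k' + 1, fun y => ?_⟩
    obtain ⟨t, h1, h2⟩ := h y
    obtain ⟨t', h1', h2'⟩ := h' y
    exact ⟨_, .both h1 h1', by nlinarith⟩

@[fun_prop]
theorem const (b : β) : PolyTime fun _ : α => b := by
  obtain ⟨P, k, h⟩ := exists_runs_const (enc b)
  refine ⟨P, (k : Polynomial ℕ) * Polynomial.X + (k : Polynomial ℕ), fun a => ?_⟩
  obtain ⟨t, h1, h2⟩ := h (enc a)
  exact ⟨t, h1, by simpa [sz] using h2⟩

/-- An elementary operation that never fails on the inputs under consideration. -/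
theorem of_op {f : α → β} (o : Op) (h : ∀ a, o.apply (enc a) = some (enc (f a))) (k : ℕ)
    (hs : ∀ a, sz (f a) ≤ k * sz a) : PolyTime f :=
  ⟨.op o, (k + 1 : Polynomial ℕ) * Polynomial.X, fun a => ⟨_, .op (h a), by
    have := hs a
    simp [sz] at *; nlinarith⟩⟩

theorem fst' : PolyTime fun p : α × β => p.1 :=
  of_op .fst (fun _ => rfl) 1 fun p => by rw [sz_prod]; omega

theorem snd' : PolyTime fun p : α × β => p.2 :=
  of_op .snd (fun _ => rfl) 1 fun p => by rw [sz_prod]; omega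

@[fun_prop]
theorem fst {f : α → β × γ} (h : PolyTime f) : PolyTime fun a => (f a).1 := fst'.comp h

@[fun_prop]
theorem snd {f : α → β × γ} (h : PolyTime f) : PolyTime fun a => (f a).2 := snd'.comp h

@[fun_prop]
theorem add {f g : α → ℕ} (hf : PolyTime f) (hg : PolyTime g) : PolyTime fun a => f a + g a :=
  (of_op (f := fun p : ℕ × ℕ => p.1 + p.2) .add (fun _ => rfl) 1 fun p => by
    have := sz_add_le p.1 p.2
    rw [sz_prod]; omega).comp (hf.prodMk hg)

@[fun_prop]
theorem mul {f g : α → ℕ} (hf : PolyTime f) (hg : PolyTime g) : PolyTime fun a => f a * g a :=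
  (of_op (f := fun p : ℕ × ℕ => p.1 * p.2) .mul (fun _ => rfl) 1 fun p => by
    have := sz_mul_le p.1 p.2
    rw [sz_prod]; omega).comp (hf.prodMk hg)

@[fun_prop]
theorem sub {f g : α → ℕ} (hf : PolyTime f) (hg : PolyTime g) : PolyTime fun a => f a - g a :=
  (of_op (f := fun p : ℕ × ℕ => p.1 - p.2) .sub (fun _ => rfl) 1 fun p => by
    have := sz_mono (Nat.sub_le p.1 p.2)
    rw [sz_prod]; omega).comp (hf.prodMk hg)

@[fun_prop]
theorem div {f g : α → ℕ} (hf : PolyTime f) (hg : PolyTime g) : PolyTime fun a => f a / g a :=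
  (of_op (f := fun p : ℕ × ℕ => p.1 / p.2) .div (fun _ => rfl) 1 fun p => by
    have := sz_mono (Nat.div_le_self p.1 p.2)
    rw [sz_prod]; omega).comp (hf.prodMk hg)

@[fun_prop]
theorem cons {f : α → β} {g : α → List β} (hf : PolyTime f) (hg : PolyTime g) :
    PolyTime fun a => f a :: g a :=
  (of_op (f := fun p : β × List β => p.1 :: p.2) .id (fun _ => rfl) 1 fun p => by
    simp [sz_prod]).comp (hf.prodMk hg)

end PolyTime

/-- Case distinction on the order of two numbers. -/
def selLE {β : Type} (a b : ℕ) (x y : β) : β := if a ≤ b then x else y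

/-- Case distinction on a list. -/
def listCases {β δ : Type} (l : List β) (x : δ) (f : β → List β → δ) : δ :=
  match l with
  | [] => x
  | a :: l => f a l

namespace PolyTime

/-- Branching on whether a computable datum is the leaf `0`. -/
theorem branch {c : α → β} {f : α → γ} (hc : PolyTime c) {P Q : Prog} {p q : Polynomial ℕ}
    (hP : ∀ a, enc (c a) ≠ .nat 0 → ∃ t, Runs P (enc a) (enc (f a)) t ∧ t ≤ p.eval (sz a))
    (hQ : ∀ a, enc (c a) = .nat 0 → ∃ t, Runs Q (enc a) (enc (f a)) t ∧ t ≤ q.eval (sz a)) :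
    PolyTime f := by
  obtain ⟨C, r, h⟩ := hc
  refine ⟨.ite C P Q, r + p + q + 1, fun a => ?_⟩
  obtain ⟨s, hs, hs'⟩ := h a
  simp only [Polynomial.eval_add, Polynomial.eval_one]
  by_cases h0 : enc (c a) = .nat 0
  · obtain ⟨t, h1, h2⟩ := hQ a h0
    exact ⟨_, .ite_false (h0 ▸ hs) h1, by omega⟩
  · obtain ⟨t, h1, h2⟩ := hP a h0
    exact ⟨_, .ite_true hs h0 h1, by omega⟩

@[fun_prop]
theorem selLE {a b : α → ℕ} {f g : α → β} (ha : PolyTime a) (hb : PolyTime b) (hf : PolyTime f)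
    (hg : PolyTime g) : PolyTime fun x => selLE (a x) (b x) (f x) (g x) := by
  obtain ⟨P, p, hP⟩ := hf
  obtain ⟨Q, q, hQ⟩ := hg
  -- The truncated difference is `0` exactly when `a x ≤ b x`, so the zero branch is the one that
  -- runs `f`.
  refine branch (c := fun x => a x - b x) (by fun_prop) (P := Q) (Q := P) (p := q) (q := p) ?_ ?_
  · intro x hx
    have : ¬ a x ≤ b x := by
      intro h; exact hx (by simp [Nat.sub_eq_zero_of_le h])
    simpa [BitCost.selLE, this] using hQ x
  · intro x hx
    have : a x ≤ b x := by simpa [Nat.sub_eq_zero_iff_le] using hx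
    simpa [BitCost.selLE, this] using hP x

/-- The empty list is the leaf `0` and a nonempty list is a pair, so the encoding of `(a, l a)` is
already the input that the second branch expects. -/
theorem listCases {l : α → List β} {x : α → γ} {f : α → β → List β → γ} (hl : PolyTime l)
    (hx : PolyTime x) (hf : PolyTime fun p : α × (β × List β) => f p.1 p.2.1 p.2.2) :
    PolyTime fun a => listCases (l a) (x a) (f a) := by
  obtain ⟨P, p, hP⟩ := hx
  obtain ⟨Q, q, hQ⟩ := hf
  obtain ⟨S, s, hS⟩ := (PolyTime.id (α := α)).prodMk hl
  refine branch (c := l) hl (P := .seq S Q) (Q := P) (p := s + q.comp s + 1) (q := p) ?_ ?_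
  · intro a ha
    obtain ⟨t, h1, h2⟩ := hS a
    rcases hla : l a with _ | ⟨b, m⟩
    · simp [hla] at ha
    · obtain ⟨t', h1', h2'⟩ := hQ (a, (b, m))
      beta_reduce at h1
      rw [hla] at h1
      refine ⟨_, .seq h1 h1', ?_⟩
      have h3 := Polynomial.monotone_eval_nat q (h1.size_le.2.trans h2)
      change q.eval (sz (a, (b, m))) ≤ q.eval _ at h3
      simp only [Polynomial.eval_add, Polynomial.eval_comp, Polynomial.eval_one]
      omega
  · intro a ha
    cases hla : l a with
    | nil => simpa [BitCost.listCases] using hP a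
    | cons b m => simp [hla] at ha

end PolyTime

/-- A fold runs in time polynomial in a bound on the sizes of the accumulators. -/
theorem exists_prog_foldl {step : γ × (σ × α) → σ} (hstep : PolyTime step) :
    ∃ (P : Prog) (q : Polynomial ℕ), ∀ (c : γ) (B : ℕ) (l : List α) (s : σ),
      sz c + sz l ≤ B → (∀ l₁, l₁ <+: l → sz (l₁.foldl (fun s a => step (c, (s, a))) s) ≤ B) →
      ∃ t, Runs P (enc (c, (l, s))) (enc (l.foldl (fun s a => step (c, (s, a))) s)) t ∧
        t ≤ q.eval B := by
  obtain ⟨P, q, hP⟩ := hstep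
  -- The loop state is `(c, (rest, s))`, and the guard `rest` is the leaf `0` exactly when the list
  -- is used up. One pass drops the head of `rest` and feeds it to the step.
  let body : Prog := .both (.op .fst) (.both (.seq (.op .snd) (.seq (.op .fst) (.op .snd)))
    (.seq (.both (.op .fst) (.both (.seq (.op .snd) (.op .snd))
      (.seq (.op .snd) (.seq (.op .fst) (.op .fst))))) P))
  -- Cost of one pass: the input of the step has size at most `2B + 2`, everything else is copying.
  let W : Polynomial ℕ := q.comp (2 * Polynomial.X + 2) + 100 * Polynomial.X + 100
  have key : ∀ (c : γ) (B : ℕ) (l : List α) (s : σ),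
      sz c + sz l ≤ B → (∀ l₁, l₁ <+: l → sz (l₁.foldl (fun s a => step (c, (s, a))) s) ≤ B) →
      ∃ t, Runs (.loop (.seq (.op .snd) (.op .fst)) body) (enc (c, (l, s)))
        (enc (c, (([] : List α), l.foldl (fun s a => step (c, (s, a))) s))) t ∧
        t ≤ (l.length + 1) * W.eval B := by
    intro c B l
    induction l with
    | nil =>
      intro s h1 h2
      refine ⟨_, .loop_done (.seq (.op rfl) (.op rfl)), ?_⟩
      have h3 := h2 [] List.prefix_rfl
      simp [sz, W, Val.size, -Nat.size_zero] at *
      omega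
    | cons a l ih =>
      intro s h1 h2
      obtain ⟨t, ht, ht'⟩ := ih (step (c, (s, a))) (by simp at h1; omega) fun l₁ hl₁ =>
        h2 (a :: l₁) (by simpa using hl₁)
      obtain ⟨u, hu, hu'⟩ := hP (c, (s, a))
      refine ⟨_, .loop_step (.seq (.op rfl) (.op rfl)) (by simp)
        (.both (.op rfl) (.both (.seq (.op rfl) (.seq (.op rfl) (.op rfl)))
          (.seq (.both (.op rfl) (.both (.seq (.op rfl) (.op rfl))
            (.seq (.op rfl) (.seq (.op rfl) (.op rfl))))) hu))) ht, ?_⟩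
      have h3 := h2 [] List.nil_prefix
      have h4 := h2 [a] (by simp)
      have h5 : u ≤ q.eval (2 * B + 2) := hu'.trans (Polynomial.monotone_eval_nat q (by
        simp at h1 h3 ⊢; omega))
      rw [List.length_cons, Nat.add_mul, one_mul]
      have h6 : W.eval B = q.eval (2 * B + 2) + 100 * B + 100 := by simp [W]
      have h7 : (Val.list (l.map enc)).size = (enc l).size := rfl
      simp only [sz, enc_pair, enc_cons, Val.size, List.foldl_cons, List.foldl_nil] at *
      omega
  refine ⟨.seq (.loop (.seq (.op .snd) (.op .fst)) body) (.seq (.op .snd) (.op .snd)),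
    (Polynomial.X + 1) * W + 100 * Polynomial.X + 100, fun c B l s h1 h2 => ?_⟩
  obtain ⟨t, ht, ht'⟩ := key c B l s h1 h2
  refine ⟨_, .seq ht (.seq (.op rfl) (.op rfl)), ?_⟩
  have h3 := h2 l List.prefix_rfl
  have h4 := length_lt_sz l
  have h5 : (l.length + 1) * W.eval B ≤ (B + 1) * W.eval B := Nat.mul_le_mul (by omega) le_rfl
  simp only [Polynomial.eval_add, Polynomial.eval_mul, Polynomial.eval_X, Polynomial.eval_one,
    Polynomial.eval_ofNat]
  have h6 : (Val.nat 0).size = 1 := rfl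
  simp only [sz, enc_pair, enc_nil, Val.size] at *
  omega

/-- A bound on all intermediate accumulators has to be supplied: a step that doubles the size is
polynomial, but its iteration is not. -/
theorem TimeIn.foldl {κ : δ → ℕ} {c : δ → γ} {l : δ → List α} {s : δ → σ}
    {step : γ → σ → α → σ} (hstep : PolyTime fun p : γ × (σ × α) => step p.1 p.2.1 p.2.2)
    (hc : TimeIn κ c) (hl : TimeIn κ l) (hs : TimeIn κ s) (B : Polynomial ℕ)
    (hB : ∀ x l₁, l₁ <+: l x → sz (l₁.foldl (step (c x)) (s x)) ≤ B.eval (κ x)) :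
    TimeIn κ fun x => (l x).foldl (step (c x)) (s x) := by
  obtain ⟨P, q, h⟩ := exists_prog_foldl hstep
  obtain ⟨q₁, h₁⟩ := hc.sz_le
  obtain ⟨q₂, h₂⟩ := hl.sz_le
  obtain ⟨Q, r, hQ⟩ := hc.prodMk (hl.prodMk hs)
  refine ⟨.seq Q P, r + q.comp (q₁ + q₂ + B) + 1, fun x => ?_⟩
  obtain ⟨t, h3, h4⟩ := hQ x
  obtain ⟨t', h5, h6⟩ := h (c x) ((q₁ + q₂ + B).eval (κ x)) (l x) (s x)
    (by
      have := h₁ x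
      have := h₂ x
      simp only [Polynomial.eval_add]; omega)
    (fun l₁ hl₁ => (hB x l₁ hl₁).trans (by simp only [Polynomial.eval_add]; omega))
  refine ⟨_, .seq h3 h5, ?_⟩
  simp only [Polynomial.eval_add, Polynomial.eval_comp, Polynomial.eval_one] at *
  omega

end BitCost

namespace BitCost

open Enc

variable {α β γ δ σ : Type} [Enc α] [Enc β] [Enc γ] [Enc δ] [Enc σ]

/-! ### Polynomial-time list functions -/

theorem sz_foldl_le {ι : Type} {step : σ → ι → σ} {b : ℕ} {l : List ι}
    (h : ∀ s, ∀ a ∈ l, sz (step s a) ≤ sz s + b) (s : σ) :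
    sz (l.foldl step s) ≤ sz s + l.length * b := by
  induction l generalizing s with
  | nil => simp
  | cons a l ih =>
    have h1 := ih (fun s a ha => h s a (List.mem_cons_of_mem _ ha)) (step s a)
    have h2 := h s a List.mem_cons_self
    simp only [List.foldl_cons, List.length_cons, Nat.add_mul, one_mul]
    omega

namespace PolyTime

/-- If each step adds an amount that does not depend on the accumulator, the accumulators stay
polynomial, as the number of steps is at most the input size. -/
theorem foldl_of_add {step : γ → σ → α → σ} {c : δ → γ} {l : δ → List α} {s : δ → σ}
    (hstep : PolyTime fun p : γ × (σ × α) => step p.1 p.2.1 p.2.2) (p : Polynomial ℕ)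
    (hp : ∀ c s a, sz (step c s a) ≤ sz s + p.eval (sz c + sz a))
    (hc : PolyTime c) (hl : PolyTime l) (hs : PolyTime s) :
    PolyTime fun x => (l x).foldl (step (c x)) (s x) := by
  obtain ⟨q₁, h₁⟩ := hc.sz_le
  obtain ⟨q₂, h₂⟩ := hl.sz_le
  obtain ⟨q₃, h₃⟩ := hs.sz_le
  refine TimeIn.foldl hstep hc hl hs (q₃ + q₂ * p.comp (q₁ + q₂)) fun x l₁ hl₁ => ?_
  have hlen := hl₁.length_le
  have := length_lt_sz (l x)
  have h2 := h₂ x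
  refine (sz_foldl_le (b := p.eval ((q₁ + q₂).eval (sz x))) (fun s a ha => ?_) _).trans ?_
  · refine (hp _ _ _).trans (Nat.add_le_add_left (Polynomial.monotone_eval_nat p ?_) _)
    have := sz_mem (hl₁.subset ha)
    have := h₁ x
    simp only [Polynomial.eval_add]; omega
  · simp only [Polynomial.eval_add, Polynomial.eval_mul, Polynomial.eval_comp]
    exact Nat.add_le_add (h₃ x) (Nat.mul_le_mul (by omega) le_rfl)

theorem foldl_cons {l s : δ → List α} (hl : PolyTime l) (hs : PolyTime s) :
    PolyTime fun x => (l x).foldl (fun s a => a :: s) (s x) :=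
  foldl_of_add (c := fun _ => 0) (step := fun _ s a => a :: s) (by fun_prop) (Polynomial.X + 1)
    (fun c s a => by simp; omega) (by fun_prop) hl hs

@[fun_prop]
theorem reverse {l : δ → List α} (hl : PolyTime l) : PolyTime fun x => (l x).reverse := by
  have h := foldl_cons hl (const (α := δ) ([] : List α))
  simpa [List.foldl_flip_cons_eq_append'] using h

@[fun_prop]
theorem append {l l' : δ → List α} (hl : PolyTime l) (hl' : PolyTime l') :
    PolyTime fun x => l x ++ l' x := by
  have h := foldl_cons (reverse hl) hl'
  simpa [List.foldl_flip_cons_eq_append'] using h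

theorem map {f : δ → α → β} {l : δ → List α} (hf : PolyTime fun p : δ × α => f p.1 p.2)
    (hl : PolyTime l) : PolyTime fun x => (l x).map (f x) := by
  obtain ⟨q, hq⟩ := hf.sz_le
  have h := foldl_of_add (c := fun x : δ => x) (step := fun x s a => f x a :: s)
    (s := fun _ => []) (cons (hf.comp (f := fun p : δ × (List β × α) => (p.1, p.2.2))
      (by fun_prop)) (by fun_prop)) (q.comp (Polynomial.X + 1) + 1) (fun c s a => by
        have := hq (c, a)
        simp at this ⊢; omega) (by fun_prop) hl (by fun_prop)
  have h2 : ∀ (x : δ) (l : List α) s, l.foldl (fun s a => f x a :: s) s = (l.map (f x)).reverse ++ s := by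
    intro x l
    induction l with
    | nil => simp
    | cons a l ih => intro s; simp [ih]
  simpa [h2] using reverse h

@[fun_prop]
theorem flatten {l : δ → List (List α)} (hl : PolyTime l) : PolyTime fun x => (l x).flatten := by
  have h := foldl_of_add (c := fun _ : δ => 0) (step := fun _ (s : List α) a => s ++ a)
    (s := fun _ => []) (by fun_prop) Polynomial.X (fun c s a => by
        have := sz_append s a
        simp; omega) (by fun_prop) hl (by fun_prop)
  have h2 : ∀ (l : List (List α)) s, l.foldl (fun s a => s ++ a) s = s ++ l.flatten := by
    intro l
    induction l with
    | nil => simp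
    | cons a l ih => intro s; simp [ih]
  simpa [h2] using h

theorem flatMap {f : δ → α → List β} {l : δ → List α} (hf : PolyTime fun p : δ × α => f p.1 p.2)
    (hl : PolyTime l) : PolyTime fun x => (l x).flatMap (f x) := by
  simpa [List.flatMap] using flatten (map hf hl)

@[fun_prop]
theorem sum {l : δ → List ℕ} (hl : PolyTime l) : PolyTime fun x => (l x).sum := by
  have h := foldl_of_add (c := fun _ : δ => 0) (step := fun _ (s : ℕ) a => s + a)
    (s := fun _ => 0) (by fun_prop) Polynomial.X (fun c s a => by
        have := sz_add_le s a
        simp; omega) (by fun_prop) hl (by fun_prop)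
  simpa [← List.sum_eq_foldl] using h

@[fun_prop]
theorem prod {l : δ → List ℕ} (hl : PolyTime l) : PolyTime fun x => (l x).prod := by
  have h := foldl_of_add (c := fun _ : δ => 0) (step := fun _ (s : ℕ) a => s * a)
    (s := fun _ => 1) (by fun_prop) Polynomial.X (fun c s a => by
        have := sz_mul_le s a
        simp; omega) (by fun_prop) hl (by fun_prop)
  simpa [← List.prod_eq_foldl] using h

end PolyTime

/-! ### Extremal entries of lists, zipping and counting. -/

/-- The least of a number and the entries of a list. -/
def minimum (a : ℕ) (l : List ℕ) : ℕ := l.foldl (fun s b => selLE s b s b) a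

/-- The greatest entry of a list, `0` for the empty list. -/
def maximum (l : List ℕ) : ℕ := l.foldl (fun s b => selLE s b b s) 0

theorem minimum_eq_min (a : ℕ) (l : List ℕ) : minimum a l = l.foldl min a := rfl

theorem maximum_eq_max (l : List ℕ) : maximum l = l.foldl max 0 := by
  have : (fun s b : ℕ => selLE s b b s) = max := by
    funext s b; simp [selLE, max_def]
  rw [maximum, this]

theorem minimum_le_left (a : ℕ) (l : List ℕ) : minimum a l ≤ a := by
  rw [minimum_eq_min]
  induction l generalizing a with
  | nil => simp
  | cons b l ih => exact (ih _).trans (min_le_left _ _)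

theorem minimum_le {a b : ℕ} {l : List ℕ} (h : b ∈ l) : minimum a l ≤ b := by
  induction l generalizing a with
  | nil => simp at h
  | cons c l ih =>
    rcases List.mem_cons.1 h with rfl | h
    · exact (minimum_le_left (min a b) l).trans (min_le_right _ _)
    · exact ih h

theorem minimum_mem (a : ℕ) (l : List ℕ) : minimum a l = a ∨ minimum a l ∈ l := by
  induction l generalizing a with
  | nil => exact .inl rfl
  | cons c l ih =>
    rcases ih (min a c) with h | h
    · change minimum (min a c) l = a ∨ minimum (min a c) l ∈ c :: l
      rw [h]
      rcases min_choice a c with h | h <;> simp [h]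
    · exact .inr (List.mem_cons_of_mem _ h)

theorem le_maximum {b : ℕ} {l : List ℕ} (h : b ∈ l) : b ≤ maximum l := by
  rw [maximum_eq_max]
  have h1 : ∀ (l : List ℕ) (a : ℕ), a ≤ l.foldl max a := by
    intro l
    induction l with
    | nil => simp
    | cons c l ih => intro a; exact (le_max_left _ _).trans (ih _)
  generalize 0 = a
  induction l generalizing a with
  | nil => simp at h
  | cons c l ih =>
    rcases List.mem_cons.1 h with rfl | h
    · exact (le_max_right _ _).trans (h1 _ _)
    · exact ih h _

theorem maximum_mem (l : List ℕ) : maximum l = 0 ∨ maximum l ∈ l := by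
  rw [maximum_eq_max]
  generalize 0 = a
  induction l generalizing a with
  | nil => exact .inl rfl
  | cons c l ih =>
    rcases ih (max a c) with h | h
    · rw [List.foldl_cons, h]
      rcases max_choice a c with h | h <;> simp [h]
    · exact .inr (List.mem_cons_of_mem _ h)

/-- An element with the largest key, if the list has one. -/
def best {α : Type} (key : α → ℕ) (l : List α) : List α :=
  l.foldl (fun s a => listCases s [a] fun b _ => selLE (key b) (key a) [a] [b]) []

theorem best_spec {ι : Type} (key : ι → ℕ) {l : List ι} {a : ι} (h : a ∈ l) :
    ∃ b ∈ l, best key l = [b] ∧ key a ≤ key b := by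
  -- After the first entry the accumulator is always a singleton, namely the current champion.
  have gen : ∀ (l : List ι) (c : ι), ∃ b ∈ c :: l,
      l.foldl (fun s a => listCases s [a] fun b _ => selLE (key b) (key a) [a] [b]) [c] = [b] ∧
        ∀ a ∈ c :: l, key a ≤ key b := by
    intro l
    induction l with
    | nil => intro c; exact ⟨c, by simp⟩
    | cons d l ih =>
      intro c
      simp only [List.foldl_cons, listCases, selLE]
      split_ifs with hcd
      · obtain ⟨b, hb, h1, h2⟩ := ih d
        refine ⟨b, by simp at hb ⊢; tauto, h1, ?_⟩
        intro a ha
        rcases List.mem_cons.1 ha with rfl | ha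
        · exact hcd.trans (h2 d (by simp))
        · exact h2 a ha
      · obtain ⟨b, hb, h1, h2⟩ := ih c
        refine ⟨b, by simp at hb ⊢; tauto, h1, ?_⟩
        intro a ha
        have := h2 c (by simp)
        simp only [List.mem_cons] at ha h2
        rcases ha with rfl | rfl | ha
        · exact this
        · omega
        · exact h2 a (.inr ha)
  cases l with
  | nil => simp at h
  | cons c l =>
    obtain ⟨b, hb, h1, h2⟩ := gen l c
    exact ⟨b, hb, h1, h2 a h⟩

theorem mem_of_mem_best {ι : Type} {key : ι → ℕ} {l : List ι} {a : ι} (h : a ∈ best key l) : a ∈ l := by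
  cases l with
  | nil => simp [best] at h
  | cons c l =>
    obtain ⟨b, hb, h1, -⟩ := best_spec key (List.mem_cons_self (a := c) (l := l))
    rw [h1, List.mem_singleton] at h
    exact h ▸ hb

theorem length_best_le {ι : Type} (key : ι → ℕ) (l : List ι) : (best key l).length ≤ 1 := by
  cases l with
  | nil => simp [best]
  | cons c l =>
    obtain ⟨b, hb, h1, -⟩ := best_spec key (List.mem_cons_self (a := c) (l := l))
    simp [h1]

namespace PolyTime

@[fun_prop]
theorem minimum {a : δ → ℕ} {l : δ → List ℕ} (ha : PolyTime a) (hl : PolyTime l) :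
    PolyTime fun x => minimum (a x) (l x) :=
  foldl_of_add (c := fun _ : δ => 0) (step := fun _ (s : ℕ) b => BitCost.selLE s b s b)
    (by fun_prop) Polynomial.X (fun c s a => by
      simp only [BitCost.selLE, Polynomial.eval_X]; split_ifs <;> omega) (by fun_prop) hl ha

@[fun_prop]
theorem maximum {l : δ → List ℕ} (hl : PolyTime l) : PolyTime fun x => maximum (l x) :=
  foldl_of_add (c := fun _ : δ => 0) (step := fun _ (s : ℕ) b => BitCost.selLE s b b s)
    (by fun_prop) Polynomial.X (fun c s a => by
      simp only [BitCost.selLE, Polynomial.eval_X]; split_ifs <;> omega) (by fun_prop) hl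
      (by fun_prop)

theorem best {key : δ → α → ℕ} {l : δ → List α} (hk : PolyTime fun p : δ × α => key p.1 p.2)
    (hl : PolyTime l) : PolyTime fun x => best (key x) (l x) := by
  refine foldl_of_add (c := fun x : δ => x)
    (step := fun x (s : List α) a => BitCost.listCases s [a] fun b _ =>
      BitCost.selLE (key x b) (key x a) [a] [b])
    (listCases (by fun_prop) (by fun_prop) (selLE ?_ ?_ ?_ ?_)) (Polynomial.X + 2)
    (fun c s a => ?_) (by fun_prop) hl (by fun_prop)
  · exact hk.comp (f := fun p : (δ × List α × α) × α × List α => (p.1.1, p.2.1)) (by fun_prop)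
  · exact hk.comp (f := fun p : (δ × List α × α) × α × List α => (p.1.1, p.1.2.2)) (by fun_prop)
  · fun_prop
  · fun_prop
  · rcases s with _ | ⟨b, s⟩
    · simp [BitCost.listCases]; omega
    · simp only [BitCost.listCases, BitCost.selLE]
      split_ifs <;> simp <;> omega

@[fun_prop]
theorem zip {l : δ → List α} {l' : δ → List β} (hl : PolyTime l) (hl' : PolyTime l') :
    PolyTime fun x => (l x).zip (l' x) := by
  -- The accumulator holds the unread part of the second list and the output in reverse order.
  let step : ℕ → List β × List (α × β) → α → List β × List (α × β) := fun _ s a =>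
    BitCost.listCases s.1 s fun b m => (m, (a, b) :: s.2)
  have h := foldl_of_add (c := fun _ : δ => 0) (step := step) (s := fun x => (l' x, []))
    (listCases (by fun_prop) (by fun_prop) (by fun_prop)) (Polynomial.X + 10)
    (fun c s a => by
      rcases s with ⟨_ | ⟨b, m⟩, s⟩
      · simp [step, BitCost.listCases]
      · simp [step, BitCost.listCases]; omega) (by fun_prop) hl (by fun_prop)
  have h2 : ∀ (l : List α) (l' : List β) s,
      (l.foldl (step 0) (l', s)).2 = (l.zip l').reverse ++ s := by
    intro l
    induction l with
    | nil => simp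
    | cons a l ih =>
      intro l' s
      rcases l' with _ | ⟨b, m⟩
      · have := ih [] s
        simpa [step, BitCost.listCases] using this
      · simpa [step, BitCost.listCases] using ih m ((a, b) :: s)
  simpa [h2] using reverse (snd h)

end PolyTime

/-- Counting down from `n` builds the list of the numbers below `n`. -/
theorem TimeIn.range {κ : δ → ℕ} {n : δ → ℕ} (hn : TimeIn κ n) (q : Polynomial ℕ)
    (hq : ∀ x, n x ≤ q.eval (κ x)) : TimeIn κ fun x => List.range (n x) := by
  -- One pass turns `(k + 1, s)` into `(k, k :: s)`.
  let body : Prog := .seq (.both (.seq (.both (.op .fst) (.op (.const 1))) (.op .sub)) (.op .snd))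
    (.both (.op .fst) (.both (.op .fst) (.op .snd)))
  have key : ∀ (n B : ℕ) (s : List ℕ), sz s + n * (n + 2) + 3 ≤ B →
      ∃ t, Runs (.loop (.op .fst) body) (enc (n, s)) (enc (0, List.range n ++ s)) t ∧
        t ≤ (n + 1) * (100 * B + 100) := by
    intro n
    induction n with
    | zero =>
      intro B s h
      refine ⟨_, .loop_done (.op rfl), ?_⟩
      have : (Val.nat 0).size = 1 := rfl
      simp only [sz, enc_pair, enc_nat, Val.size] at *
      omega
    | succ n ih =>
      intro B s h
      have h0 := sz_le_self (n + 1)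
      have h0' := sz_le_self n
      have h00 : sz 1 = 2 := by simp [sz_nat]
      have hexp : (n + 1) * (n + 1 + 2) = n * (n + 2) + 2 * n + 3 := by ring
      obtain ⟨t, ht, ht'⟩ := ih B (n :: s) (by simp; omega)
      rw [List.range_succ, List.append_assoc]
      refine ⟨_, .loop_step (.op rfl) (by simp) (.seq (.both (.seq (.both (.op rfl) (.op rfl))
        (.op rfl)) (.op rfl)) (.both (.op rfl) (.both (.op rfl) (.op rfl)))) ht, ?_⟩
      rw [Nat.add_mul (n + 1), one_mul]
      simp only [sz, enc_pair, enc_nat, enc_cons, Val.size, Nat.add_sub_cancel] at *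
      omega
  obtain ⟨P, p, hP⟩ := hn.prodMk (TimeIn.comp (PolyTime.const ([] : List ℕ)) hn)
  refine ⟨.seq P (.seq (.loop (.op .fst) body) (.op .snd)),
    p + (q + 1) * (100 * (q * (q + 2) + 10) + 100) + 100 * (q * (q + 2) + 10), fun x => ?_⟩
  obtain ⟨t, h1, h2⟩ := hP x
  obtain ⟨u, h3, h4⟩ := key (n x) (n x * (n x + 2) + 4) [] (by simp; omega)
  rw [List.append_nil] at h3
  refine ⟨_, .seq h1 (.seq h3 (.op rfl)), ?_⟩
  have h5 : sz (List.range (n x)) ≤ n x * (n x + 2) + 1 := by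
    refine (sz_list_le (B := n x + 1) fun a ha => ?_).trans (by simp)
    have := sz_le_self a
    have := List.mem_range.1 ha
    omega
  have h6 := hq x
  have h7 : n x * (n x + 2) ≤ q.eval (κ x) * (q.eval (κ x) + 2) := by gcongr
  have h8 : (n x + 1) * (100 * (n x * (n x + 2) + 4) + 100) ≤
    (q.eval (κ x) + 1) * (100 * (q.eval (κ x) * (q.eval (κ x) + 2) + 10) + 100) := by
    gcongr; norm_num
  have h9 : (Val.nat 0).size = 1 := rfl
  simp only [Polynomial.eval_add, Polynomial.eval_mul, Polynomial.eval_ofNat, Polynomial.eval_one]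
  simp only [sz, enc_pair, enc_nat, Val.size] at *
  omega

end BitCost

namespace BitCost

open Enc

variable {α β γ δ σ : Type} [Enc α] [Enc β] [Enc γ] [Enc δ] [Enc σ]

namespace PolyTime

@[fun_prop]
theorem min {f g : δ → ℕ} (hf : PolyTime f) (hg : PolyTime g) :
    PolyTime fun x => min (f x) (g x) := by
  have h := selLE hf hg hf hg
  simpa only [BitCost.selLE, ← min_def] using h

@[fun_prop]
theorem max {f g : δ → ℕ} (hf : PolyTime f) (hg : PolyTime g) :
    PolyTime fun x => max (f x) (g x) := by
  have h := selLE hf hg hg hf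
  simpa only [BitCost.selLE, ← max_def] using h

@[fun_prop]
theorem mod {f g : δ → ℕ} (hf : PolyTime f) (hg : PolyTime g) :
    PolyTime fun x => f x % g x := by
  simp only [Nat.mod_eq_sub]
  fun_prop

@[fun_prop]
theorem pow {f : δ → ℕ} (hf : PolyTime f) (k : ℕ) : PolyTime fun x => f x ^ k := by
  induction k with
  | zero => simp only [pow_zero]; fun_prop
  | succ k ih => simp only [pow_succ]; fun_prop

@[fun_prop]
theorem length {l : δ → List α} (hl : PolyTime l) : PolyTime fun x => (l x).length := by
  have h := sum (map (f := fun _ _ => 1) (by fun_prop) hl)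
  simpa using h

attribute [fun_prop] map flatMap best listCases

end PolyTime

end BitCost

namespace UnitDemand

open BitCost

/-! ### The algorithm -/

namespace Scheme

/-- The weight of the mass points of an item that are at least `y`. -/
def tailWeight (item : List (ℕ × ℕ)) (y : ℕ) : ℕ := (item.map fun x => selLE y x.1 x.2 0).sum

/-- The best revenue from selling an item alone at a price above `H`. -/
def tailRevenue (D H : ℕ) (item : List (ℕ × ℕ)) : ℕ :=
  maximum (item.map fun x => selLE x.1 H 0 (x.1 * tailWeight item x.1 / D))

/-- An upper bound on the optimal revenue, tight up to a factor of four. -/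
def scale (D : ℕ) (inst : List (List (ℕ × ℕ))) : ℕ :=
  minimum (0 + (inst.map (tailRevenue D 0)).sum)
    (inst.flatten.map fun x => x.1 + (inst.map (tailRevenue D x.1)).sum)

/-- The number of the value level of `x`. -/
def level (r E x : ℕ) : ℕ := min (x * r ^ 2 / E) (r ^ 5)

/-- The rank, in the order of the buyer's preferences, of an item with value `x` and price level
`c`. -/
def rank (r E x c : ℕ) : ℕ := selLE c (level r E x) ((level r E x - c) * (r ^ 4 + 1) + c) 0

/-- The weight of the mass points of rank at most `k`. -/
def rankWeight (r E : ℕ) (item : List (ℕ × ℕ)) (c k : ℕ) : ℕ :=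
  (item.map fun x => selLE (rank r E x.1 c) k x.2 0).sum

/-- A way to price an item: the weights of the rank distribution, the separate revenue and the
price. -/
abbrev Choice := List ℕ × (ℕ × (ℕ × ℕ))

/-- Pricing an item at a price level. -/
def lowChoice (r E D : ℕ) (ranks : List ℕ) (item : List (ℕ × ℕ)) (c : ℕ) : Choice :=
  (ranks.map (rankWeight r E item c), (0, ((r - 1) * E * c, r * r ^ 2 * D ^ 2)))

/-- Pricing an item so high that only exceptional values matter. -/
def highChoice (r E D : ℕ) (ranks : List ℕ) (item : List (ℕ × ℕ)) (x : ℕ) : Choice :=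
  (ranks.map fun _ => D, (max x (r ^ 2 * E) * tailWeight item (max x (r ^ 2 * E)),
    ((r - 1) * max x (r ^ 2 * E), r * D ^ 2)))

def choices (r E D : ℕ) (levels ranks : List ℕ) (item : List (ℕ × ℕ)) : List Choice :=
  (levels.map fun c => lowChoice r E D ranks item c) ++
    item.map fun x => highChoice r E D ranks item x.1

/-- A state of the dynamic program: the rounded distribution of the largest rank, the separate
revenue and the prices. -/
abbrev State := List ℕ × (ℕ × List (ℕ × ℕ))

/-- Entrywise multiplication, because the distribution function of a maximum of independent ranks is
the product of the individual ones. Dividing by `D` normalizes the weights and rounds down. -/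
def extend (D : ℕ) (e : State) (o : Choice) : State :=
  ((e.1.zip o.1).map fun y => y.1 * y.2 / D, (e.2.1 + o.2.1, o.2.2 :: e.2.2))

/-- An arithmetic equality test for vectors of equal length. -/
def distance (v w : List ℕ) : ℕ := ((v.zip w).map fun y => y.1 - y.2 + (y.2 - y.1)).sum

/-- One round of the dynamic program: all extensions of the states, of which only the best one for
each vector of `Z` is kept. -/
def round (D : ℕ) (Z : List (List ℕ)) (opts : List Choice) (states : List State) : List State :=
  Z.flatMap fun z => best (fun e : State => e.2.1)
    ((states.flatMap fun e => opts.map fun o => extend D e o).flatMap fun e =>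
      selLE (distance e.1 z) 0 [(z, e.2)] [])

def start (M : ℕ) (ranks : List ℕ) : State := (ranks.map fun _ => M, (0, []))

/-- The items are processed from last to first because `extend` prepends; the prices then come out
in the order of the items. -/
def states (D M : ℕ) (ranks : List ℕ) (Z : List (List ℕ)) (opts : List (List Choice)) :
    List State :=
  opts.reverse.foldl (fun s o => round D Z o s) [start M ranks]

/-- The expected price level of the item of largest rank, for a rounded distribution of the largest
rank. -/
def meanLevel (r : ℕ) (ranks v : List ℕ) : ℕ :=
  ((ranks.zip (v.zip (0 :: v))).map fun y => y.1 % (r ^ 4 + 1) * (y.2.1 - y.2.2)).sum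

/-- The estimated revenue multiplied by `D³ r² M`: separate revenues carry a factor `D²` from the
values and `D` from the weights, and the distribution a factor `M`. -/
def merit (r E D M : ℕ) (ranks : List ℕ) (e : State) : ℕ :=
  e.2.1 * r ^ 2 * M + E * D * meanLevel r ranks e.1

def prices (r E D M : ℕ) (levels ranks : List ℕ) (Z : List (List ℕ))
    (inst : List (List (ℕ × ℕ))) : List (ℕ × ℕ) :=
  listCases (best (merit r E D M ranks)
    (states D M ranks Z (inst.map fun item => choices r E D levels ranks item))) []
    fun e _ => e.2.2

/-- The raw form of an instance. -/
abbrev Raw := List (List ((ℕ × ℕ) × (ℕ × ℕ)))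

def denom (I : Raw) : ℕ := (I.flatten.map fun x => x.1.2 * x.2.2).prod

/-- The instance in integers: the values are multiplied by the square of the common denominator, the
probabilities by the common denominator. -/
def integral (I : Raw) : List (List (ℕ × ℕ)) :=
  I.map fun item => item.map fun x => (denom I ^ 2 * x.1.1 / x.1.2, denom I * x.2.1 / x.2.2)

/-- The total relative loss will be `35 / r`, so `r > 100 / ε` is more than enough. -/
def accuracy (e : ℕ × ℕ) : ℕ := 100 * (e.2 / e.1 + 1)

/-- Value levels run up to `r ^ 5` (values up to `r³ E`) and price levels up to `r ^ 4` (prices up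
to `r² E`). -/
def numRanks (r : ℕ) : ℕ := (r ^ 5 + 1) * (r ^ 4 + 1)

/-- Rounding loses at most `n` units per entry. With this many units the resulting loss of revenue
is at most `E / r`. -/
def resolution (r n : ℕ) : ℕ := 2 * numRanks r * r ^ 3 * (n + 1)

/-- All vectors of a given length with entries from `R`. -/
def vectors (R : List ℕ) (l : List ℕ) : List (List ℕ) :=
  l.foldl (fun Z _ => Z.flatMap fun v => R.map fun s => s :: v) [[]]

section Time

variable {δ : Type} [Enc δ]

@[fun_prop]
theorem polyTime_tailWeight {item : δ → List (ℕ × ℕ)} {y : δ → ℕ} (h₁ : PolyTime item)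
    (h₂ : PolyTime y) : PolyTime fun x => tailWeight (item x) (y x) := by
  unfold tailWeight; fun_prop

@[fun_prop]
theorem polyTime_tailRevenue {D H : δ → ℕ} {item : δ → List (ℕ × ℕ)} (h₁ : PolyTime D)
    (h₂ : PolyTime H) (h₃ : PolyTime item) :
    PolyTime fun x => tailRevenue (D x) (H x) (item x) := by
  unfold tailRevenue; fun_prop

@[fun_prop]
theorem polyTime_scale {D : δ → ℕ} {inst : δ → List (List (ℕ × ℕ))} (h₁ : PolyTime D)
    (h₂ : PolyTime inst) : PolyTime fun x => scale (D x) (inst x) := by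
  unfold scale; fun_prop

@[fun_prop]
theorem polyTime_rankWeight {r E c k : δ → ℕ} {item : δ → List (ℕ × ℕ)} (h₁ : PolyTime r)
    (h₂ : PolyTime E) (h₃ : PolyTime item) (h₄ : PolyTime c) (h₅ : PolyTime k) :
    PolyTime fun x => rankWeight (r x) (E x) (item x) (c x) (k x) := by
  unfold rankWeight rank level; fun_prop

@[fun_prop]
theorem polyTime_choices {r E D : δ → ℕ} {levels ranks : δ → List ℕ} {item : δ → List (ℕ × ℕ)}
    (h₁ : PolyTime r) (h₂ : PolyTime E) (h₃ : PolyTime D) (h₄ : PolyTime levels)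
    (h₅ : PolyTime ranks) (h₆ : PolyTime item) :
    PolyTime fun x => choices (r x) (E x) (D x) (levels x) (ranks x) (item x) := by
  unfold choices lowChoice highChoice; fun_prop

@[fun_prop]
theorem polyTime_round {D : δ → ℕ} {Z : δ → List (List ℕ)} {opts : δ → List Choice}
    {s : δ → List State} (h₁ : PolyTime D) (h₂ : PolyTime Z) (h₃ : PolyTime opts)
    (h₄ : PolyTime s) : PolyTime fun x => round (D x) (Z x) (opts x) (s x) := by
  unfold round extend distance; fun_prop

@[fun_prop]
theorem polyTime_merit {r E D M : δ → ℕ} {ranks : δ → List ℕ} {e : δ → State}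
    (h₁ : PolyTime r) (h₂ : PolyTime E) (h₃ : PolyTime D) (h₄ : PolyTime M)
    (h₅ : PolyTime ranks) (h₆ : PolyTime e) :
    PolyTime fun x => merit (r x) (E x) (D x) (M x) (ranks x) (e x) := by
  unfold merit meanLevel; fun_prop

@[fun_prop]
theorem polyTime_integral {I : δ → Raw} (h : PolyTime I) : PolyTime fun x => integral (I x) := by
  unfold integral denom; fun_prop

end Time

end Scheme

end UnitDemand

namespace UnitDemand

open BitCost

namespace Scheme

/-! ### Size of the states and running time of the dynamic program. -/

theorem sz_extend_le (D : ℕ) (e : State) (o : Choice) :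
    sz (extend D e o).2 ≤ sz e.2 + sz o := by
  obtain ⟨v, b, l⟩ := e
  obtain ⟨w, c, p⟩ := o
  have := sz_add_le b c
  simp only [extend, sz_pair, sz_cons]
  omega

theorem mem_round {D : ℕ} {Z : List (List ℕ)} {opts : List Choice} {s : List State} {e : State}
    (h : e ∈ round D Z opts s) : e.1 ∈ Z ∧
      ∃ e' ∈ s, ∃ o ∈ opts, (extend D e' o).2 = e.2 ∧ distance (extend D e' o).1 e.1 = 0 := by
  simp only [round, List.mem_flatMap] at h
  obtain ⟨z, hz, h⟩ := h
  have h := mem_of_mem_best h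
  simp only [List.mem_flatMap, List.mem_map] at h
  obtain ⟨_, ⟨e', he', o, ho, rfl⟩, h⟩ := h
  simp only [selLE] at h
  split_ifs at h with h0
  · rw [List.mem_singleton] at h
    subst h
    exact ⟨hz, e', he', o, ho, rfl, Nat.le_zero.1 h0⟩
  · simp at h

theorem length_round_le (D : ℕ) (Z : List (List ℕ)) (opts : List Choice) (s : List State) :
    (round D Z opts s).length ≤ Z.length := by
  rw [round, List.length_flatMap]
  calc _ ≤ (Z.map fun _ => 1).sum := List.sum_le_sum fun z _ => length_best_le _ _
    _ = _ := by simp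

/-- Pruning keeps at most one state per vector of `Z`. The vector part of a state stays in `Z`, and
the rest grows by at most one choice per round. -/
theorem sz_foldl_round_le {D : ℕ} {Z : List (List ℕ)} {l : List (List Choice)} {S A N : ℕ}
    (hl : ∀ opts ∈ l, ∀ o ∈ opts, sz o ≤ S) (hA : ∀ z ∈ Z, sz z ≤ A) (hN : Z.length ≤ N)
    {s : List State} {b : ℕ} (h1 : s.length ≤ N) (h2 : ∀ e ∈ s, sz e.1 ≤ A ∧ sz e.2 ≤ b) :
    sz (l.foldl (fun s o => round D Z o s) s) ≤ N * (A + b + l.length * S + 2) + 1 := by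
  induction l generalizing s b with
  | nil =>
    refine (sz_list_le (B := A + b + 1) fun e he => ?_).trans ?_
    · have := h2 e he
      rw [sz_prod]; omega
    · simp only [List.foldl_nil, List.length_nil, zero_mul, add_zero]
      gcongr
  | cons o l ih =>
    refine (ih (fun opts h => hl opts (List.mem_cons_of_mem _ h)) (s := round D Z o s) (b := b + S)
      ((length_round_le _ _ _ _).trans hN) fun e he => ?_).trans (le_of_eq ?_)
    · obtain ⟨hz, e', he', o', ho', h3, -⟩ := mem_round he
      refine ⟨hA _ hz, ?_⟩
      rw [← h3]
      have := sz_extend_le D e' o'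
      have := hl o List.mem_cons_self o' ho'
      have := (h2 e' he').2
      omega
    · simp only [List.length_cons]; ring

section Time

variable {δ : Type} [Enc δ]

@[fun_prop]
theorem polyTime_states {D M : δ → ℕ} {ranks : δ → List ℕ} {Z : δ → List (List ℕ)}
    {opts : δ → List (List Choice)} (h₁ : PolyTime D) (h₂ : PolyTime M) (h₃ : PolyTime ranks)
    (h₄ : PolyTime Z) (h₅ : PolyTime opts) :
    PolyTime fun x => states (D x) (M x) (ranks x) (Z x) (opts x) := by
  have h₆ : PolyTime fun x => start (M x) (ranks x) := by unfold start; fun_prop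
  obtain ⟨q, hq⟩ := TimeIn.sz_le (h₄.prodMk (h₅.prodMk h₆))
  refine TimeIn.foldl (c := fun x => (D x, Z x)) (l := fun x => (opts x).reverse)
    (s := fun x => [start (M x) (ranks x)]) (step := fun c s o => round c.1 c.2 o s)
    (by fun_prop) (h₁.prodMk h₄) (PolyTime.reverse h₅)
    (PolyTime.cons h₆ (PolyTime.const [])) (q * (2 * q + q * q + 2) + 1) fun x l₁ hl₁ => ?_
  have h := hq x
  simp only [sz_pair] at h
  have h0 := length_lt_sz (Z x)
  have h1 := length_lt_sz (opts x)
  have h2 := hl₁.length_le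
  rw [List.length_reverse] at h2
  have h3 : sz (start (M x) (ranks x)) = _ := sz_prod _
  refine (sz_foldl_round_le (S := q.eval (sz x)) (A := q.eval (sz x)) (N := q.eval (sz x))
    (b := q.eval (sz x)) ?_ ?_ ?_ ?_ ?_).trans ?_
  · intro o ho c hc
    have := sz_mem hc
    have := sz_mem (List.mem_reverse.1 (hl₁.subset ho))
    omega
  · intro z hz
    have := sz_mem hz
    dsimp only at hz this ⊢
    omega
  · dsimp only; omega
  · have := sz_pos (start (M x) (ranks x))
    simp only [List.length_singleton]
    omega
  · intro e he
    rw [List.mem_singleton] at he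
    subst he
    omega
  · have h4 : l₁.length * q.eval (sz x) ≤ q.eval (sz x) * q.eval (sz x) :=
      Nat.mul_le_mul (by omega) le_rfl
    simp only [Polynomial.eval_add, Polynomial.eval_mul, Polynomial.eval_ofNat,
      Polynomial.eval_one]
    exact Nat.add_le_add_right (Nat.mul_le_mul le_rfl (by omega)) 1

@[fun_prop]
theorem polyTime_denom {I : δ → Raw} (h : PolyTime I) : PolyTime fun x => denom (I x) := by
  unfold denom; fun_prop

@[fun_prop]
theorem polyTime_accuracy {e : δ → ℕ × ℕ} (h : PolyTime e) :
    PolyTime fun x => accuracy (e x) := by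
  unfold accuracy; fun_prop

@[fun_prop]
theorem polyTime_numRanks {r : δ → ℕ} (h : PolyTime r) : PolyTime fun x => numRanks (r x) := by
  unfold numRanks; fun_prop

@[fun_prop]
theorem polyTime_resolution {r n : δ → ℕ} (h₁ : PolyTime r) (h₂ : PolyTime n) :
    PolyTime fun x => resolution (r x) (n x) := by
  unfold resolution; fun_prop

@[fun_prop]
theorem polyTime_prices {r E D M : δ → ℕ} {levels ranks : δ → List ℕ} {Z : δ → List (List ℕ)}
    {inst : δ → List (List (ℕ × ℕ))} (h₁ : PolyTime r) (h₂ : PolyTime E) (h₃ : PolyTime D)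
    (h₄ : PolyTime M) (h₅ : PolyTime levels) (h₆ : PolyTime ranks) (h₇ : PolyTime Z)
    (h₈ : PolyTime inst) : PolyTime fun x =>
      prices (r x) (E x) (D x) (M x) (levels x) (ranks x) (Z x) (inst x) := by
  unfold prices; fun_prop

end Time

/-! ### Enumeration of the rounded distributions and the total running time. -/

theorem vectors_append (R l : List ℕ) (a : ℕ) : vectors R (l ++ [a]) =
    (vectors R l).flatMap fun v => R.map fun s => s :: v := by
  simp [vectors]

theorem length_vectors (R l : List ℕ) : (vectors R l).length = R.length ^ l.length := by
  induction l using List.reverseRecOn with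
  | nil => simp [vectors]
  | append_singleton l a ih => simp [vectors_append, List.length_flatMap, ih, pow_succ]

theorem mem_vectors {R l v : List ℕ} :
    v ∈ vectors R l ↔ v.length = l.length ∧ ∀ s ∈ v, s ∈ R := by
  induction l using List.reverseRecOn generalizing v with
  | nil =>
    simp only [vectors, List.foldl_nil, List.mem_singleton, List.length_nil,
      List.length_eq_zero_iff]
    constructor
    · rintro rfl; simp
    · exact And.left
  | append_singleton l a ih =>
    simp only [vectors_append, List.mem_flatMap, List.mem_map, ih, List.length_append,
      List.length_singleton]
    constructor
    · rintro ⟨w, ⟨h1, h2⟩, s, hs, rfl⟩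
      simp [h1, hs]
      exact h2
    · rintro ⟨h1, h2⟩
      rcases v with _ | ⟨s, w⟩
      · simp at h1
      · simp only [List.mem_cons, forall_eq_or_imp, List.length_cons] at h1 h2
        exact ⟨w, ⟨by omega, h2.2⟩, s, h2.1, rfl⟩

/-- The whole algorithm. -/
def solve (x : (ℕ × ℕ) × Raw) : List (ℕ × ℕ) :=
  prices (accuracy x.1) (scale (denom x.2) (integral x.2)) (denom x.2)
    (resolution (accuracy x.1) x.2.length) (List.range (accuracy x.1 ^ 4 + 1))
    (List.range (numRanks (accuracy x.1)))
    (vectors (List.range (resolution (accuracy x.1) x.2.length + 1))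
      (List.range (numRanks (accuracy x.1)))) (integral x.2)

/-- The measure in which the algorithm takes polynomial time. -/
def cost (x : (ℕ × ℕ) × Raw) : ℕ :=
  sz x + (resolution (accuracy x.1) x.2.length + 2) ^ (numRanks (accuracy x.1) + 2)

theorem numRanks_le_cost (x : (ℕ × ℕ) × Raw) : numRanks (accuracy x.1) + 2 ≤ cost x := by
  have h1 : numRanks (accuracy x.1) + 2 < 2 ^ (numRanks (accuracy x.1) + 2) :=
    Nat.lt_two_pow_self
  have h2 : 2 ^ (numRanks (accuracy x.1) + 2) ≤
      (resolution (accuracy x.1) x.2.length + 2) ^ (numRanks (accuracy x.1) + 2) :=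
    Nat.pow_le_pow_left (by omega) _
  rw [cost]; omega

theorem resolution_le_cost (x : (ℕ × ℕ) × Raw) :
    resolution (accuracy x.1) x.2.length + 2 ≤ cost x := by
  have := Nat.le_self_pow (n := numRanks (accuracy x.1) + 2) (by omega)
    (resolution (accuracy x.1) x.2.length + 2)
  rw [cost]; omega

/-- Only the ranges and the list of all vectors may fail to be polynomial in the bit size of the
input. Their lengths, at most `(M + 1) ^ m` for the vectors, are bounded by `cost`; the rest is
polynomial in the input and in these lists. -/
theorem timeIn_solve : TimeIn cost solve := by
  have hle : ∀ x, sz x ≤ cost x := fun x => Nat.le_add_right _ _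
  have poly : ∀ {β : Type} [Enc β] {f : (ℕ × ℕ) × Raw → β}, PolyTime f → TimeIn cost f :=
    fun h => TimeIn.mono h hle
  have h1 : TimeIn cost fun x => List.range (accuracy x.1 ^ 4 + 1) :=
    TimeIn.range (poly (by fun_prop)) Polynomial.X fun x => by
      have h1 := numRanks_le_cost x
      have h2 : accuracy x.1 ^ 4 + 1 ≤ numRanks (accuracy x.1) :=
        Nat.le_mul_of_pos_left _ (by omega)
      simp only [Polynomial.eval_X]; omega
  have h2 : TimeIn cost fun x => List.range (numRanks (accuracy x.1)) :=
    TimeIn.range (poly (by fun_prop)) Polynomial.X fun x => by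
      have h1 := numRanks_le_cost x
      simp only [Polynomial.eval_X]; omega
  have h3 : TimeIn cost fun x => List.range (resolution (accuracy x.1) x.2.length + 1) :=
    TimeIn.range (poly (by fun_prop)) Polynomial.X
      fun x => by
        have h1 := resolution_le_cost x
        simp only [Polynomial.eval_X]; omega
  have h4 : TimeIn cost fun x => vectors (List.range (resolution (accuracy x.1) x.2.length + 1))
      (List.range (numRanks (accuracy x.1))) := by
    unfold vectors
    refine TimeIn.foldl (step := fun (R : List ℕ) (Z : List (List ℕ)) (_ : ℕ) =>
        Z.flatMap fun v => R.map fun s => s :: v) (s := fun _ => [[]])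
      (by fun_prop) h3 h2 (poly (PolyTime.const [[]]))
      (Polynomial.X * (Polynomial.X * (Polynomial.X + 2) + 2) + 1) fun x l₁ hl₁ => ?_
    change sz (vectors _ l₁) ≤ _
    have h5 := hl₁.length_le
    rw [List.length_range] at h5
    have h6 := numRanks_le_cost x
    have h7 := resolution_le_cost x
    have h8 : (vectors (List.range (resolution (accuracy x.1) x.2.length + 1)) l₁).length ≤
        cost x := by
      rw [length_vectors, List.length_range, cost]
      refine le_trans ?_ (Nat.le_add_left _ _)
      exact (Nat.pow_le_pow_left (by omega) _).trans (Nat.pow_le_pow_right (by omega) (by omega))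
    refine (sz_list_le (B := cost x * (cost x + 2) + 1) fun v hv => ?_).trans ?_
    · rw [mem_vectors] at hv
      refine (sz_list_le (B := cost x + 1) fun s hs => ?_).trans ?_
      · have h9 := List.mem_range.1 (hv.2 s hs)
        have h10 := sz_le_self s
        omega
      · rw [hv.1]; gcongr; omega
    · simp only [Polynomial.eval_add, Polynomial.eval_mul, Polynomial.eval_ofNat,
        Polynomial.eval_one, Polynomial.eval_X]
      generalize cost x = c at h8 ⊢
      exact Nat.add_le_add_right (Nat.mul_le_mul h8 le_rfl) 1
  have h5 : TimeIn cost fun x : (ℕ × ℕ) × Raw => x := poly PolyTime.id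
  have h6 : PolyTime fun y : ((ℕ × ℕ) × Raw) × (List ℕ × (List ℕ × List (List ℕ))) =>
      prices (accuracy y.1.1) (scale (denom y.1.2) (integral y.1.2)) (denom y.1.2)
        (resolution (accuracy y.1.1) y.1.2.length) y.2.1 y.2.2.1 y.2.2.2 (integral y.1.2) := by
    fun_prop
  have h7 := TimeIn.comp h6 (h5.prodMk (h1.prodMk (h2.prodMk h4)))
  dsimp only at h7
  unfold solve
  exact h7

/-- For a fixed accuracy the running time is polynomial in the size of the instance. -/
theorem exists_polynomial_cost_le (e : ℕ × ℕ) :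
    ∃ q : Polynomial ℕ, ∀ I : Raw, cost (e, I) ≤ q.eval (sz I) := by
  generalize hr : accuracy e = r
  generalize hm : numRanks r = m
  refine ⟨Polynomial.X + Polynomial.C (sz e + 1) +
    (Polynomial.C (2 * m * r ^ 3) * (Polynomial.X + 1) + 2) ^ (m + 2), fun I => ?_⟩
  have := length_lt_sz I
  simp only [cost, sz_pair, resolution, hr, hm, Polynomial.eval_C, Polynomial.eval_add, Polynomial.eval_mul,
    Polynomial.eval_X, Polynomial.eval_pow, Polynomial.eval_ofNat,
    Polynomial.eval_one]
  refine Nat.add_le_add (by omega) (Nat.pow_le_pow_left ?_ _)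
  gcongr

end Scheme

end UnitDemand

namespace UnitDemand

/-! ### Expectations over the value profiles -/

namespace Instance

variable (I : Instance)

/-- The expectation over the independent choices of a mass point for each item. -/
noncomputable def ex (f : ((i : Fin I.n) → Fin (I.K i)) → ℝ) : ℝ :=
  ∑ s, (∏ i, (I.prob i (s i) : ℝ)) * f s

theorem revenue_eq_ex (p : Fin I.n → ℝ) :
    I.revenue p = I.ex fun s => payment (fun i => (I.value i (s i) : ℝ)) p := rfl

variable {I}
variable {f g : ((i : Fin I.n) → Fin (I.K i)) → ℝ}

theorem prob_sum_real (i : Fin I.n) : ∑ k, (I.prob i k : ℝ) = 1 := by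
  have := I.prob_sum i
  exact_mod_cast this

theorem ex_mono (h : ∀ s, f s ≤ g s) : I.ex f ≤ I.ex g :=
  Finset.sum_le_sum fun s _ => mul_le_mul_of_nonneg_left (h s)
    (Finset.prod_nonneg fun _ _ => NNRat.cast_nonneg _)

theorem ex_nonneg (h : ∀ s, 0 ≤ f s) : 0 ≤ I.ex f :=
  Finset.sum_nonneg fun s _ => mul_nonneg (Finset.prod_nonneg fun _ _ => NNRat.cast_nonneg _) (h s)

theorem ex_add (f g : ((i : Fin I.n) → Fin (I.K i)) → ℝ) :
    (I.ex fun s => f s + g s) = I.ex f + I.ex g := by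
  simp only [ex, mul_add, Finset.sum_add_distrib]

theorem ex_sub (f g : ((i : Fin I.n) → Fin (I.K i)) → ℝ) :
    (I.ex fun s => f s - g s) = I.ex f - I.ex g := by
  simp only [ex, mul_sub, Finset.sum_sub_distrib]

theorem ex_mul_left (c : ℝ) (f : ((i : Fin I.n) → Fin (I.K i)) → ℝ) :
    (I.ex fun s => c * f s) = c * I.ex f := by
  simp only [ex, Finset.mul_sum]
  exact Finset.sum_congr rfl fun s _ => by ring

theorem ex_sum {ι : Type*} (t : Finset ι) (F : ι → ((i : Fin I.n) → Fin (I.K i)) → ℝ) :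
    (I.ex fun s => ∑ j ∈ t, F j s) = ∑ j ∈ t, I.ex (F j) := by
  simp only [ex, Finset.mul_sum]
  exact Finset.sum_comm

theorem ex_prod (φ : (i : Fin I.n) → Fin (I.K i) → ℝ) :
    (I.ex fun s => ∏ i, φ i (s i)) = ∏ i, ∑ k, (I.prob i k : ℝ) * φ i k := by
  rw [Finset.prod_univ_sum, Fintype.piFinset_univ]
  exact Finset.sum_congr rfl fun s _ => Finset.prod_mul_distrib.symm

theorem ex_const (c : ℝ) : (I.ex fun _ => c) = c := by
  have h := ex_prod (I := I) fun _ _ => 1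
  simp only [mul_one, prob_sum_real, Finset.prod_const_one] at h
  have h2 := ex_mul_left (I := I) c fun _ => 1
  simpa [h] using h2

/-- A coordinate is independent of every function of the other coordinates. -/
theorem ex_mul_of_indep (j : Fin I.n) (φ : Fin (I.K j) → ℝ)
    (hf : ∀ s k, f (Function.update s j k) = f s) :
    (I.ex fun s => φ (s j) * f s) = (∑ k, (I.prob j k : ℝ) * φ k) * I.ex f := by
  -- The second factor does not involve `ψ`; the case `ψ = 1` identifies it with `I.ex f`.
  have gen : ∀ ψ : Fin (I.K j) → ℝ, (I.ex fun s => ψ (s j) * f s) =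
      (∑ k, (I.prob j k : ℝ) * ψ k) *
        ∑ t : ((i : {i // i ≠ j}) → Fin (I.K i)), (∏ i : {i // i ≠ j}, (I.prob i (t i) : ℝ)) *
          ∑ k, (I.prob j k : ℝ) * f ((Equiv.piSplitAt j _).symm (k, t)) := by
    intro ψ
    rw [ex, ← Equiv.sum_comp (Equiv.piSplitAt j fun i => Fin (I.K i)).symm, Fintype.sum_prod_type,
      Finset.sum_mul]
    refine Finset.sum_congr rfl fun k _ => ?_
    rw [Finset.mul_sum]
    refine Finset.sum_congr rfl fun t _ => ?_
    have h1 : ∀ k', f ((Equiv.piSplitAt j _).symm (k', t)) =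
        f ((Equiv.piSplitAt j _).symm (k, t)) := by
      intro k'
      rw [← hf ((Equiv.piSplitAt j _).symm (k, t)) k']
      congr 1
      funext i
      by_cases h : i = j
      · subst h; simp [Equiv.piSplitAt]
      · simp [Equiv.piSplitAt, h]
    simp only [h1, ← Finset.sum_mul, prob_sum_real, one_mul]
    rw [Fintype.prod_eq_mul_prod_subtype_ne _ j]
    have h2 : ((Equiv.piSplitAt j fun i => Fin (I.K i)).symm (k, t)) j = k := by
      simp [Equiv.piSplitAt]
    have h3 : ∀ i : {i // i ≠ j}, ((Equiv.piSplitAt j fun i => Fin (I.K i)).symm (k, t)) i = t i := by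
      intro i
      simp [Equiv.piSplitAt, i.2]
    simp only [h2, h3]
    ring
  have h1 := gen fun _ => 1
  simp only [one_mul, mul_one, prob_sum_real] at h1
  rw [gen φ, h1]

/-- The probability that the value of an item is at least `y`. -/
noncomputable def tail (I : Instance) (i : Fin I.n) (y : ℝ) : ℝ :=
  ∑ k, (I.prob i k : ℝ) * if y ≤ I.value i k then 1 else 0

theorem tail_nonneg (i : Fin I.n) (y : ℝ) : 0 ≤ I.tail i y :=
  Finset.sum_nonneg fun k _ => mul_nonneg (NNRat.cast_nonneg _) (by split_ifs <;> norm_num)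

theorem tail_anti (i : Fin I.n) : Antitone (I.tail i) := fun y z h =>
  Finset.sum_le_sum fun k _ => mul_le_mul_of_nonneg_left
    (by split_ifs <;> first | (exfalso; linarith) | norm_num) (NNRat.cast_nonneg _)

theorem ex_tail_mul (j : Fin I.n) (y : ℝ) (hf : ∀ s k, f (Function.update s j k) = f s) :
    (I.ex fun s => (if y ≤ I.value j (s j) then 1 else 0) * f s) = I.tail j y * I.ex f :=
  ex_mul_of_indep j (fun k => if y ≤ I.value j k then 1 else 0) hf

theorem ex_tail (j : Fin I.n) (y : ℝ) :
    (I.ex fun s => if y ≤ I.value j (s j) then 1 else 0) = I.tail j y := by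
  have h := ex_tail_mul (f := fun _ => 1) j y fun _ _ => rfl
  simpa [ex_const] using h

end Instance

/-! ### The payment of the buyer -/

section Payment

variable {n : ℕ} {v p : Fin n → ℝ}

theorem mem_favourites {i : Fin n} :
    i ∈ favourites v p ↔ 0 ≤ v i - p i ∧ ∀ j, v j - p j ≤ v i - p i := by
  simp [favourites]

theorem le_payment {i : Fin n} (h : i ∈ favourites v p) : p i ≤ payment v p := by
  rw [payment, dif_pos ⟨i, h⟩]
  exact Finset.le_sup' p h

theorem payment_eq (v p : Fin n → ℝ) :
    (favourites v p = ∅ ∧ payment v p = 0) ∨ ∃ i ∈ favourites v p, payment v p = p i := by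
  rcases (favourites v p).eq_empty_or_nonempty with h | h
  · exact .inl ⟨h, by simp [payment, h]⟩
  · right
    obtain ⟨i, hi, h2⟩ := Finset.exists_mem_eq_sup' h p
    exact ⟨i, hi, by rw [payment, dif_pos h, h2]⟩

theorem payment_nonneg (hp : ∀ i, 0 ≤ p i) : 0 ≤ payment v p := by
  rcases payment_eq v p with ⟨-, h⟩ | ⟨i, -, h⟩
  · exact h.ge
  · exact h ▸ hp i

theorem favourites_nonempty {j : Fin n} (h : 0 ≤ v j - p j) : (favourites v p).Nonempty := by
  obtain ⟨i, -, hi⟩ := Finset.exists_max_image Finset.univ (fun i => v i - p i) ⟨j, Finset.mem_univ j⟩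
  exact ⟨i, mem_favourites.2 ⟨h.trans (hi j (Finset.mem_univ _)), fun k => hi k (Finset.mem_univ _)⟩⟩

/-- The values of a buyer who is only interested in the items of `T`. -/
def only (T : Finset (Fin n)) (v : Fin n → ℝ) : Fin n → ℝ := fun i => if i ∈ T then v i else -1

/-- An item of value `-1` has negative utility at every nonnegative price and is never chosen. -/
theorem mem_favourites_only {T : Finset (Fin n)} (hp : ∀ i, 0 ≤ p i) {i : Fin n} :
    i ∈ favourites (only T v) p ↔ i ∈ T ∧ 0 ≤ v i - p i ∧ ∀ j ∈ T, v j - p j ≤ v i - p i := by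
  rw [mem_favourites]
  by_cases hi : i ∈ T
  · simp only [only, hi, if_true, true_and]
    refine and_congr_right fun h0 => forall_congr' fun j => ?_
    by_cases hj : j ∈ T
    · simp [hj]
    · simp only [hj, if_false, false_imp_iff, iff_true]
      linarith [hp j]
  · simp only [only, hi, if_false, false_and, iff_false, not_and]
    intro h
    linarith [hp i]

/-- A favourite inside `T` remains a favourite when the other items disappear, and a favourite `j`
outside `T` satisfies `p j ≤ v j`. -/
theorem payment_le_add_only (T : Finset (Fin n)) (hp : ∀ i, 0 ≤ p i) :
    payment v p ≤ ∑ j ∈ Tᶜ, p j * (if p j ≤ v j then 1 else 0) + payment (only T v) p := by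
  have h0 : ∀ j ∈ Tᶜ, 0 ≤ p j * (if p j ≤ v j then 1 else 0 : ℝ) := fun j _ =>
    mul_nonneg (hp j) (by split_ifs <;> norm_num)
  have h1 := Finset.sum_nonneg h0
  have h2 := payment_nonneg (v := only T v) hp
  rcases payment_eq v p with ⟨-, h⟩ | ⟨i, hi, h⟩
  · linarith
  · rw [h]
    rw [mem_favourites] at hi
    by_cases hT : i ∈ T
    · have := le_payment ((mem_favourites_only (v := v) hp).2 ⟨hT, hi.1, fun j _ => hi.2 j⟩)
      linarith
    · have h3 := Finset.single_le_sum h0 (Finset.mem_compl.2 hT)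
      rw [if_pos (by linarith [hi.1]), mul_one] at h3
      linarith

/-- If `y j ≤ v j` and all other values are below `t`, item `j` gives utility at least `t` and wins
against every other item. If no item outside `T` is affordable, those items do not matter. The two
events exclude each other. -/
theorem add_only_le_payment (T : Finset (Fin n)) (hp : ∀ i, 0 ≤ p i) {t : ℝ} {y : Fin n → ℝ}
    (ht : 0 ≤ t) (hy : ∀ j ∈ Tᶜ, t + p j ≤ y j) (hpos : ∀ j ∈ Tᶜ, 0 < p j) :
    ∑ j ∈ Tᶜ, p j * (if y j ≤ v j ∧ ∀ i ≠ j, v i < t then 1 else 0) +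
      payment (only T v) p * (if ∀ j ∈ Tᶜ, v j < p j then 1 else 0) ≤ payment v p := by
  by_cases h : ∃ j ∈ Tᶜ, y j ≤ v j ∧ ∀ i ≠ j, v i < t
  · obtain ⟨j, hj, h1, h2⟩ := h
    have h3 : ¬ ∀ j ∈ Tᶜ, v j < p j := fun h => by linarith [h j hj, hy j hj]
    rw [if_neg h3, mul_zero, add_zero, Finset.sum_eq_single_of_mem j hj, if_pos ⟨h1, h2⟩, mul_one]
    · refine le_payment (mem_favourites.2 ⟨by linarith [hy j hj], fun i => ?_⟩)
      by_cases hij : i = j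
      · rw [hij]
      · linarith [h2 i hij, hy j hj, hp i]
    · intro i hi hij
      rw [if_neg, mul_zero]
      rintro ⟨h4, -⟩
      linarith [h2 i hij, hy i hi, hpos i hi]
  · rw [Finset.sum_eq_zero, zero_add]
    · split_ifs with h1
      · rw [mul_one]
        rcases payment_eq (only T v) p with ⟨-, h2⟩ | ⟨i, hi, h2⟩
        · rw [h2]; exact payment_nonneg hp
        · rw [h2]
          rw [mem_favourites_only hp] at hi
          refine le_payment (mem_favourites.2 ⟨hi.2.1, fun j => ?_⟩)
          by_cases hj : j ∈ T
          · exact hi.2.2 j hj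
          · linarith [h1 j (Finset.mem_compl.2 hj), hi.2.1]
      · rw [mul_zero]; exact payment_nonneg hp
    · intro j hj
      rw [if_neg fun h2 => h ⟨j, hj, h2⟩, mul_zero]

end Payment

end UnitDemand

namespace UnitDemand

/-! ### Scales: bounds on the optimal revenue up to a constant factor -/

namespace Instance

variable {I : Instance}

/-- The tail is a step function: it takes the same value at `y` and at the least mass point above or
at `y`. -/
theorem tail_eq_zero_or (i : Fin I.n) (y : ℝ) :
    I.tail i y = 0 ∨ ∃ k, y ≤ I.value i k ∧ I.tail i y = I.tail i (I.value i k) := by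
  by_cases h : ∃ k, y ≤ I.value i k
  · right
    obtain ⟨k, hk, hmin⟩ := Finset.exists_min_image (Finset.univ.filter fun k => y ≤ I.value i k)
      (fun k => (I.value i k : ℝ)) (by obtain ⟨k, hk⟩ := h; exact ⟨k, by simpa using hk⟩)
    simp only [Finset.mem_filter, Finset.mem_univ, true_and] at hk hmin
    refine ⟨k, hk, Finset.sum_congr rfl fun l _ => ?_⟩
    congr 1
    exact if_congr ⟨hmin l, hk.trans⟩ rfl rfl
  · left
    push Not at h
    exact Finset.sum_eq_zero fun k _ => by rw [if_neg (not_le.2 (h k)), mul_zero]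

/-- `τ` is the best revenue from selling item `i` alone at a price above `H`. -/
def IsTailRevenue (I : Instance) (i : Fin I.n) (H τ : ℝ) : Prop :=
  (∀ k, H < I.value i k → I.value i k * I.tail i (I.value i k) ≤ τ) ∧
    (τ = 0 ∨ ∃ k, H < I.value i k ∧ τ = I.value i k * I.tail i (I.value i k))

theorem IsTailRevenue.nonneg {i : Fin I.n} {H τ : ℝ} (h : I.IsTailRevenue i H τ) : 0 ≤ τ := by
  rcases h.2 with h | ⟨k, -, h⟩
  · exact h.ge
  · exact h ▸ mul_nonneg (NNRat.cast_nonneg _) (tail_nonneg _ _)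

theorem IsTailRevenue.mul_tail_le {i : Fin I.n} {H τ y : ℝ} (h : I.IsTailRevenue i H τ)
    (hy : H < y) : y * I.tail i y ≤ τ := by
  rcases tail_eq_zero_or i y with h0 | ⟨k, hk, h0⟩
  · rw [h0, mul_zero]; exact h.nonneg
  · rw [h0]
    exact (mul_le_mul_of_nonneg_right hk (tail_nonneg _ _)).trans (h.1 k (hy.trans_le hk))

/-- A number between the optimal revenue and four times the optimal revenue. -/
structure IsScale (I : Instance) (E : ℝ) : Prop where
  nonneg : 0 ≤ E
  mul_tail_le : ∀ y, E < y → y * ∑ i, I.tail i y ≤ E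
  revenue_le : ∀ p : Fin I.n → ℝ, (∀ i, 0 ≤ p i) → I.revenue p ≤ E
  le_revenue : ∃ p : Fin I.n → ℝ, (∀ i, 0 ≤ p i) ∧ E ≤ 4 * I.revenue p

theorem revenue_nonneg {p : Fin I.n → ℝ} (hp : ∀ i, 0 ≤ p i) : 0 ≤ I.revenue p :=
  ex_nonneg fun _ => payment_nonneg hp

/-- Every item gets its own best price above `H`. It is certainly sold if its value reaches that
price and all other values are at most `H`; the second event is independent of the first and has
probability at least one half. -/
theorem exists_half_le_revenue {H : ℝ} (hH : 0 ≤ H) {τ : Fin I.n → ℝ}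
    (hτ : ∀ i, I.IsTailRevenue i H (τ i))
    (hQ : (I.ex fun s => if ∃ i, H < I.value i (s i) then 1 else 0) ≤ 1 / 2) :
    ∃ p : Fin I.n → ℝ, (∀ i, 0 ≤ p i) ∧ ∑ i, τ i ≤ 2 * I.revenue p := by
  have h1 : ∀ i, ∃ y, H < y ∧ τ i ≤ y * I.tail i y := by
    intro i
    rcases (hτ i).2 with h | ⟨k, h, h2⟩
    -- If `τ i = 0`, any price above `H` will do.
    · exact ⟨H + 1, by linarith, h.le.trans (mul_nonneg (by linarith) (tail_nonneg _ _))⟩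
    · exact ⟨_, h, h2.le⟩
  choose p hp hτp using h1
  have hp0 : ∀ i, 0 ≤ p i := fun i => hH.trans (hp i).le
  refine ⟨p, hp0, ?_⟩
  classical
  have h2 : ∀ s : (i : Fin I.n) → Fin (I.K i), ∑ j, p j * ((if p j ≤ I.value j (s j) then 1 else 0) *
      (if ∀ i, i ≠ j → (I.value i (s i) : ℝ) ≤ H then 1 else 0)) ≤
        payment (fun i => (I.value i (s i) : ℝ)) p := by
    intro s
    by_cases h : ∃ j, p j ≤ I.value j (s j) ∧ ∀ i, i ≠ j → (I.value i (s i) : ℝ) ≤ H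
    · obtain ⟨j, h3, h4⟩ := h
      rw [Finset.sum_eq_single_of_mem j (Finset.mem_univ _), if_pos h3, if_pos h4, mul_one, mul_one]
      · refine le_payment (mem_favourites.2 ⟨by linarith, fun i => ?_⟩)
        by_cases hij : i = j
        · rw [hij]
        · linarith [h4 i hij, hp i]
      · intro i _ hij
        rw [if_neg, zero_mul, mul_zero]
        linarith [h4 i hij, hp i]
    · refine (Finset.sum_eq_zero fun j _ => ?_).le.trans (payment_nonneg hp0)
      split_ifs with h3 h4
      · exact absurd ⟨j, h3, h4⟩ h
      all_goals simp
  have h3 := ex_mono h2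
  rw [← revenue_eq_ex, ex_sum] at h3
  have h4 : ∀ j, 1 / 2 ≤ I.ex fun s =>
      if ∀ i, i ≠ j → (I.value i (s i) : ℝ) ≤ H then 1 else 0 := by
    intro j
    have h5 : (1 : ℝ) - 1 / 2 ≤ I.ex fun s => 1 - (if ∃ i, H < I.value i (s i) then 1 else 0 : ℝ) := by
      rw [ex_sub, ex_const]; linarith
    refine (by norm_num : (1 : ℝ) / 2 = 1 - 1 / 2).le.trans (h5.trans (ex_mono fun s => ?_))
    by_cases h6 : ∃ i, H < I.value i (s i)
    · rw [if_pos h6, sub_self]; split_ifs <;> norm_num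
    · rw [if_neg h6, sub_zero, if_pos]
      intro i _
      exact not_lt.1 fun h => h6 ⟨i, h⟩
  have h5 : ∀ j, τ j ≤ 2 * I.ex fun s => p j * ((if p j ≤ I.value j (s j) then 1 else 0) *
      (if ∀ i, i ≠ j → (I.value i (s i) : ℝ) ≤ H then 1 else 0)) := by
    intro j
    rw [ex_mul_left, ex_tail_mul (f := fun s =>
      if ∀ i, i ≠ j → (I.value i (s i) : ℝ) ≤ H then 1 else 0)]
    · have h6 := mul_nonneg (hp0 j) (tail_nonneg (I := I) j (p j))
      nlinarith [h4 j, hτp j, mul_le_mul_of_nonneg_left (h4 j) h6]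
    · intro s k
      refine if_congr (forall_congr' fun i => forall_congr' fun hi => ?_) rfl rfl
      rw [Function.update_of_ne hi]
  calc ∑ i, τ i ≤ ∑ j, 2 * _ := Finset.sum_le_sum fun j _ => h5 j
    _ = 2 * ∑ j, _ := (Finset.mul_sum _ _ _).symm
    _ ≤ _ := by linarith

/-- `H` is `0` or one of the mass points. -/
def IsPoint (I : Instance) (H : ℝ) : Prop := H = 0 ∨ ∃ i k, H = I.value i k

theorem IsPoint.nonneg {H : ℝ} (h : I.IsPoint H) : 0 ≤ H := by
  rcases h with rfl | ⟨i, k, rfl⟩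
  · rfl
  · exact NNRat.cast_nonneg _

/-- `H` is the smallest point that the largest value exceeds with probability at most one half. The
uniform price `H` is then accepted with probability more than one half, unless `H = 0`. -/
theorem exists_median (I : Instance) : ∃ H : ℝ, I.IsPoint H ∧
    (I.ex fun s => if ∃ i, H < I.value i (s i) then 1 else 0) ≤ 1 / 2 ∧
    ∃ p : Fin I.n → ℝ, (∀ i, 0 ≤ p i) ∧ H ≤ 2 * I.revenue p := by
  classical
  let S : Finset ℝ := insert 0 (Finset.univ.biUnion fun i => Finset.univ.image fun k =>
    (I.value i k : ℝ))
  have hS : ∀ H, H ∈ S ↔ I.IsPoint H := by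
    intro H
    simp only [IsPoint, S, Finset.mem_insert, Finset.mem_biUnion, Finset.mem_univ, Finset.mem_image,
      true_and, eq_comm (a := H)]
  have h0 : (0 : ℝ) ∈ S := (hS 0).2 (.inl rfl)
  have hnn : ∀ H ∈ S, 0 ≤ H := fun H h => ((hS H).1 h).nonneg
  let Q : ℝ → ℝ := fun H => I.ex fun s => if ∃ i, H < I.value i (s i) then 1 else 0
  obtain ⟨B, hB, hmax⟩ := Finset.exists_max_image S id ⟨0, h0⟩
  have hQB : Q B ≤ 1 / 2 := by
    have : ∀ s : (i : Fin I.n) → Fin (I.K i),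
        (if ∃ i, B < I.value i (s i) then 1 else 0 : ℝ) = 0 := by
      intro s
      rw [if_neg]
      rintro ⟨i, hi⟩
      exact absurd (hmax _ ((hS _).2 (.inr ⟨i, s i, rfl⟩))) (not_le.2 hi)
    simp only [Q, this, ex_const]
    norm_num
  obtain ⟨H, hH, hmin⟩ := Finset.exists_min_image (S.filter fun H => Q H ≤ 1 / 2) id
    ⟨B, Finset.mem_filter.2 ⟨hB, hQB⟩⟩
  rw [Finset.mem_filter] at hH
  refine ⟨H, (hS H).1 hH.1, hH.2, ?_⟩
  rcases (hnn H hH.1).eq_or_lt with hz | hpos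
  · refine ⟨fun _ => 0, fun _ => le_rfl, ?_⟩
    rw [← hz]
    exact mul_nonneg zero_le_two (revenue_nonneg fun _ => le_rfl)
  -- No point lies strictly between `L` and `H`, so exceeding `L` means reaching `H`, and `L` fails
  -- the condition by minimality of `H`.
  · obtain ⟨L, hL, hLmax⟩ := Finset.exists_max_image (S.filter fun L => L < H) id
      ⟨0, Finset.mem_filter.2 ⟨h0, hpos⟩⟩
    rw [Finset.mem_filter] at hL
    have hQL : 1 / 2 < Q L := by
      by_contra h
      have := hmin L (Finset.mem_filter.2 ⟨hL.1, not_lt.1 h⟩)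
      exact absurd hL.2 (not_lt.2 this)
    refine ⟨fun _ => H, fun _ => hpos.le, ?_⟩
    have h1 : H * Q L ≤ I.revenue fun _ => H := by
      rw [← ex_mul_left, revenue_eq_ex]
      refine ex_mono fun s => ?_
      split_ifs with h
      · obtain ⟨i, hi⟩ := h
        have h2 : H ≤ I.value i (s i) := by
          by_contra h
          exact absurd (hLmax _ (Finset.mem_filter.2
            ⟨(hS _).2 (.inr ⟨i, s i, rfl⟩), not_le.1 h⟩)) (not_le.2 hi)
        obtain ⟨j, hj⟩ := favourites_nonempty (v := fun i => (I.value i (s i) : ℝ))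
          (p := fun _ => H) (j := i) (by simpa using h2)
        rw [mul_one]
        exact le_payment hj
      · rw [mul_zero]; exact payment_nonneg fun _ => hpos.le
    nlinarith

/-- The minimizing `H` yields the upper bounds, since any sum of this form dominates the revenue.
The lower bound compares the minimum with the median, whose two terms are each at most twice an
achievable revenue. -/
theorem isScale {τ : Fin I.n → ℝ → ℝ}
    (hτ : ∀ i, ∀ H, I.IsPoint H → I.IsTailRevenue i H (τ i H)) {E : ℝ}
    (hE : ∃ H, I.IsPoint H ∧ E = H + ∑ i, τ i H)
    (hmin : ∀ H, I.IsPoint H → E ≤ H + ∑ i, τ i H) : I.IsScale E := by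
  obtain ⟨H, hH, hE⟩ := hE
  have hH0 := hH.nonneg
  have hsum : 0 ≤ ∑ i, τ i H := Finset.sum_nonneg fun i _ => (hτ i H hH).nonneg
  refine ⟨by linarith, fun y hy => ?_, fun p hp => ?_, ?_⟩
  · rw [Finset.mul_sum]
    have : ∑ i, y * I.tail i y ≤ ∑ i, τ i H :=
      Finset.sum_le_sum fun i _ => (hτ i H hH).mul_tail_le (by linarith)
    linarith
  · classical
    -- A purchase in `T` pays at most `H`; an item outside `T` earns at most its tail revenue.
    let T : Finset (Fin I.n) := Finset.univ.filter fun i => p i ≤ H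
    have h1 : I.revenue p ≤ I.ex fun s =>
        ∑ j ∈ Tᶜ, p j * (if p j ≤ I.value j (s j) then 1 else 0) + H := by
      rw [revenue_eq_ex]
      refine ex_mono fun s => (payment_le_add_only T hp).trans (add_le_add_right ?_ _)
      rcases payment_eq (only T fun i => (I.value i (s i) : ℝ)) p with ⟨-, h⟩ | ⟨i, hi, h⟩
      · rw [h]; exact hH0
      · rw [h]
        have := ((mem_favourites_only hp).1 hi).1
        simpa [T] using this
    refine h1.trans ?_
    rw [ex_add, ex_const, ex_sum, hE, add_comm]
    refine add_le_add_right ?_ _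
    calc _ ≤ ∑ j ∈ Tᶜ, τ j H := Finset.sum_le_sum fun j hj => ?_
      _ ≤ _ := Finset.sum_le_sum_of_subset_of_nonneg (Finset.subset_univ _)
        fun i _ _ => (hτ i H hH).nonneg
    rw [ex_mul_left, ex_tail]
    exact (hτ j H hH).mul_tail_le (by simpa [T] using hj)
  · obtain ⟨M, hM, hQ, p, hp, h1⟩ := exists_median I
    obtain ⟨p', hp', h2⟩ := exists_half_le_revenue hM.nonneg (fun i => hτ i M hM) hQ
    have h3 := hmin M hM
    rcases le_total (I.revenue p) (I.revenue p') with h | h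
    · exact ⟨p', hp', by linarith⟩
    · exact ⟨p, hp, by linarith⟩

end Instance

/-! ### Rounding of values and prices -/

/-- The rank, in the order of the buyer's preferences, of an item with value level `a` and price
level `c`. -/
def levelRank (C a c : ℕ) : ℕ := if c ≤ a then (a - c) * (C + 1) + c else 0

/-- The rank is a two-digit number in base `C + 1`: rounded utility first, price level second.
Larger rank thus means larger rounded utility, with ties going to the dearer item. -/
theorem levelRank_mod {C a c : ℕ} (hc : c ≤ C) (h : c ≤ a) : levelRank C a c % (C + 1) = c := by
  rw [levelRank, if_pos h, Nat.mul_add_mod_self_right, Nat.mod_eq_of_lt (by omega)]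

theorem levelRank_div {C a c : ℕ} (hc : c ≤ C) (h : c ≤ a) : levelRank C a c / (C + 1) = a - c := by
  rw [levelRank, if_pos h, mul_comm, Nat.mul_add_div (by omega), Nat.div_eq_of_lt (by omega),
    add_zero]

theorem levelRank_lt {C V a c : ℕ} (hc : c ≤ C) (ha : a ≤ V) :
    levelRank C a c < (V + 1) * (C + 1) := by
  rw [levelRank]
  split_ifs with h
  · have : (a - c) * (C + 1) ≤ V * (C + 1) := Nat.mul_le_mul (by omega) le_rfl
    rw [Nat.add_mul]; omega
  · positivity

theorem le_of_levelRank_pos {C a c : ℕ} (h : 0 < levelRank C a c) : c ≤ a := by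
  by_contra h2
  simp [levelRank, h2] at h

section Rounding

variable {n : ℕ} {v p : Fin n → ℝ} {T : Finset (Fin n)} {a c : Fin n → ℕ} {g r : ℝ} {C : ℕ}

/-- Passage from real prices to levels of the discounted prices. If the rounded market chooses `j`
instead of the favourite `i`, comparing the utilities bounds `(p i - p j) / r` by the two rounding
errors, so at most `2 g r` is lost by the switch; rounding the price of `j` costs another `g`. -/
theorem payment_only_le_levelRank (hg : 0 < g) (hr : 1 ≤ r) (hp : ∀ i, 0 ≤ p i)
    (ha : ∀ i ∈ T, g * a i ≤ v i ∧ v i < g * (a i + 1))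
    (hc : ∀ i ∈ T, g * c i ≤ (1 - 1 / r) * p i ∧ (1 - 1 / r) * p i < g * (c i + 1))
    (hC : ∀ i ∈ T, c i ≤ C) :
    (1 - 1 / r) * payment (only T v) p ≤
      g * ((T.sup fun i => levelRank C (a i) (c i)) % (C + 1) : ℕ) + 3 * g * r := by
  have hr0 : 0 < r := by linarith
  have hd : 0 ≤ 1 - 1 / r := by
    rw [sub_nonneg, div_le_one hr0]; exact hr
  have h0 : 0 ≤ g * ((T.sup fun i => levelRank C (a i) (c i)) % (C + 1) : ℕ) := by positivity
  have hgr : g ≤ g * r := le_mul_of_one_le_right hg.le hr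
  rcases payment_eq (only T v) p with ⟨-, h⟩ | ⟨i, hi, h⟩
  · rw [h, mul_zero]; positivity
  rw [h]
  obtain ⟨hiT, hu, hmax⟩ := (mem_favourites_only hp).1 hi
  obtain ⟨hi1, hi2⟩ := hc i hiT
  obtain ⟨hi3, hi4⟩ := ha i hiT
  have hci : c i ≤ a i := by
    have h1 : (1 - 1 / r) * p i ≤ p i :=
      mul_le_of_le_one_left (hp i) (by rw [sub_le_self_iff]; positivity)
    have h2 : g * c i < g * (a i + 1) := by linarith
    have h3 := lt_of_mul_lt_mul_left h2 hg.le
    exact Nat.lt_succ_iff.1 (by exact_mod_cast h3)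
  obtain ⟨j, hj, hsup⟩ := Finset.exists_mem_eq_sup T ⟨i, hiT⟩ fun i => levelRank C (a i) (c i)
  have hle : levelRank C (a i) (c i) ≤ levelRank C (a j) (c j) := by
    rw [← hsup]; exact Finset.le_sup (f := fun i => levelRank C (a i) (c i)) hiT
  rcases Nat.eq_zero_or_pos (levelRank C (a j) (c j)) with hz | hpos
  · have h1 : c i = 0 := by
      rw [← levelRank_mod (hC i hiT) hci, Nat.le_zero.1 (hle.trans hz.le), Nat.zero_mod]
    rw [h1] at hi2
    push_cast at hi2
    linarith
  · have hcj := le_of_levelRank_pos hpos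
    rw [hsup, levelRank_mod (hC j hj) hcj]
    have h1 := Nat.div_le_div_right (c := C + 1) hle
    rw [levelRank_div (hC i hiT) hci, levelRank_div (hC j hj) hcj] at h1
    have h2 : (a i : ℝ) - c i ≤ a j - c j := by
      rw [← Nat.cast_sub hci, ← Nat.cast_sub hcj]; exact_mod_cast h1
    have h3 := mul_le_mul_of_nonneg_left h2 hg.le
    obtain ⟨hj1, hj2⟩ := hc j hj
    obtain ⟨hj3, hj4⟩ := ha j hj
    have h4 := hmax j hj
    -- The discount changes the utility gap by `(p i - p j) / r`, while value and price rounding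
    -- shift it by less than `g` each.
    have h5 : (1 / r) * (p i - p j) < 2 * g := by
      nlinarith
    have h6 : p i - p j < 2 * g * r := by
      rw [one_div, inv_mul_eq_div, div_lt_iff₀ hr0] at h5
      exact h5
    have h7 : (1 - 1 / r) * (p i - p j) ≤ 2 * g * r := by
      rcases le_total (p i) (p j) with h | h
      · have := mul_nonneg hd (sub_nonneg.2 h)
        nlinarith
      · refine (mul_le_of_le_one_left (sub_nonneg.2 h) ?_).trans h6.le
        rw [sub_le_self_iff]; positivity
    nlinarith

/-- The reverse passage, with a second discount. Posted prices are exact multiples of the discounted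
grid, so only the values are rounded and the loss is `g r`. -/
theorem levelRank_le_payment_only (hg : 0 < g) (hr : 1 ≤ r) (hp : ∀ i, 0 ≤ p i)
    (ha : ∀ i ∈ T, g * a i ≤ v i ∧ v i < g * (a i + 1))
    (hc : ∀ i ∈ T, p i = (1 - 1 / r) * (g * c i)) (hC : ∀ i ∈ T, c i ≤ C) :
    (1 - 1 / r) * (g * ((T.sup fun i => levelRank C (a i) (c i)) % (C + 1) : ℕ)) ≤
      payment (only T v) p + g * r := by
  have hr0 : 0 < r := by linarith
  have hd : 0 ≤ 1 - 1 / r := by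
    rw [sub_nonneg, div_le_one hr0]; exact hr
  have hd1 : 1 - 1 / r ≤ 1 := by rw [sub_le_self_iff]; positivity
  have h0 := payment_nonneg (v := only T v) hp
  have triv : T.sup (fun i => levelRank C (a i) (c i)) = 0 →
      (1 - 1 / r) * (g * ((T.sup fun i => levelRank C (a i) (c i)) % (C + 1) : ℕ)) ≤
      payment (only T v) p + g * r := by
    intro h
    rw [h, Nat.zero_mod, Nat.cast_zero, mul_zero, mul_zero]
    positivity
  rcases T.eq_empty_or_nonempty with hT | hT
  · exact triv (by rw [hT]; rfl)
  obtain ⟨j, hj, hsup⟩ := Finset.exists_mem_eq_sup T hT fun i => levelRank C (a i) (c i)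
  rcases Nat.eq_zero_or_pos (levelRank C (a j) (c j)) with hz | hpos
  · exact triv (hsup.trans hz)
  have hcj := le_of_levelRank_pos hpos
  rw [hsup, levelRank_mod (hC j hj) hcj]
  have hcj' : (c j : ℝ) ≤ a j := by exact_mod_cast hcj
  have hpj : p j ≤ g * c j := by
    rw [hc j hj]; exact mul_le_of_le_one_left (by positivity) hd1
  have hfav : (favourites (only T v) p).Nonempty := by
    refine favourites_nonempty (j := j) ?_
    rw [only, if_pos hj]
    have := mul_le_mul_of_nonneg_left hcj' hg.le
    linarith [(ha j hj).1]
  rcases payment_eq (only T v) p with ⟨h, -⟩ | ⟨i, hi, h⟩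
  · exact absurd h hfav.ne_empty
  rw [h]
  obtain ⟨hiT, hu, hmax⟩ := (mem_favourites_only hp).1 hi
  have hle : levelRank C (a i) (c i) ≤ levelRank C (a j) (c j) := by
    rw [← hsup]; exact Finset.le_sup (f := fun i => levelRank C (a i) (c i)) hiT
  have h1 : (a i : ℝ) - c i ≤ a j - c j := by
    by_cases hci : c i ≤ a i
    · have h1 := Nat.div_le_div_right (c := C + 1) hle
      rw [levelRank_div (hC i hiT) hci, levelRank_div (hC j hj) hcj] at h1
      rw [← Nat.cast_sub hci, ← Nat.cast_sub hcj]; exact_mod_cast h1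
    -- The rounded utility of `i` is negative here, while that of `j` is not.
    · have : (a i : ℝ) < c i := by exact_mod_cast not_le.1 hci
      linarith
  have h2 := mul_le_mul_of_nonneg_left h1 hg.le
  have h3 := hmax j hj
  have hi2 := (ha i hiT).2
  have hj1 := (ha j hj).1
  have h4 : 1 / r * (g * c j - g * c i) < g := by
    rw [hc i hiT, hc j hj] at h3
    nlinarith
  have h5 : g * c j - g * c i < g * r := by
    rwa [one_div, inv_mul_eq_div, div_lt_iff₀ hr0] at h4
  rw [hc i hiT]
  have h6 : (1 - 1 / r) * (g * c j - g * c i) ≤ g * r := by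
    rcases le_total (g * c j) (g * c i) with h | h
    · have := mul_nonneg hd (sub_nonneg.2 h)
      have : 0 < g * r := by positivity
      nlinarith
    · exact (mul_le_of_le_one_left (sub_nonneg.2 h) hd1).trans h5.le
  nlinarith

end Rounding

end UnitDemand

/-! ### Revenue compared with the rounded market. -/

namespace UnitDemand

namespace Instance

variable {I : Instance} {E : ℝ} {r : ℕ} {a : (i : Fin I.n) → Fin (I.K i) → ℕ}

theorem IsScale.sum_tail_le (hE : I.IsScale E) (h0 : 0 < E) {x : ℝ} (hx : 1 < x) :
    ∑ i, I.tail i (x * E) ≤ 1 / x := by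
  have h1 := hE.mul_tail_le (x * E) (by nlinarith)
  rw [le_div_iff₀ (by linarith)]
  nlinarith

/-- The mean price level that the buyer pays in the rounded market of the items of `T`. -/
noncomputable def meanLevel (I : Instance) (r : ℕ) (a : (i : Fin I.n) → Fin (I.K i) → ℕ)
    (T : Finset (Fin I.n)) (c : Fin I.n → ℕ) : ℝ :=
  I.ex fun s => ((T.sup fun i => levelRank (r ^ 4) (a i (s i)) (c i)) % (r ^ 4 + 1) : ℕ)

/-- `a` gives the value levels of all values that are not exceptional. -/
def IsLevel (I : Instance) (E : ℝ) (r : ℕ) (a : (i : Fin I.n) → Fin (I.K i) → ℕ) : Prop :=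
  ∀ i k, (I.value i k : ℝ) < (r : ℝ) ^ 3 * E →
    E / (r : ℝ) ^ 2 * a i k ≤ I.value i k ∧ (I.value i k : ℝ) < E / (r : ℝ) ^ 2 * (a i k + 1)

theorem one_le_sum_indicator {n : ℕ} {v : Fin n → ℝ} {y : ℝ} (h : ∃ i, y ≤ v i) :
    (1 : ℝ) ≤ ∑ i, if y ≤ v i then 1 else 0 := by
  obtain ⟨i, hi⟩ := h
  have h1 := Finset.single_le_sum (f := fun i => if y ≤ v i then (1 : ℝ) else 0)
    (fun i _ => by split_ifs <;> norm_num) (Finset.mem_univ i)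
  simpa [hi] using h1

/-- Exceptional values occur with probability at most `1 / r³`, and low-priced items never pay more
than `r² E`. -/
theorem ex_exceptional (hE : I.IsScale E) (h0 : 0 < E) (hr : 2 ≤ r) :
    (I.ex fun s => (r : ℝ) ^ 2 * E *
      ∑ i, if (r : ℝ) ^ 3 * E ≤ I.value i (s i) then 1 else 0) ≤ E / r := by
  have hr' : (2 : ℝ) ≤ r := by exact_mod_cast hr
  have h1 : (1 : ℝ) < (r : ℝ) ^ 3 := one_lt_pow₀ (by linarith) (by norm_num)
  rw [ex_mul_left, ex_sum]
  simp only [ex_tail]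
  refine (mul_le_mul_of_nonneg_left (hE.sum_tail_le h0 h1) (by positivity)).trans (le_of_eq ?_)
  field_simp

/-- Outside exceptional profiles the payment for `T` is bounded by the rounded market with error `3
E / r`. Exceptional profiles add the fourth `E / r`. -/
theorem revenue_le_estimate (hE : I.IsScale E) (h0 : 0 < E) (hr : 2 ≤ r) (ha : I.IsLevel E r a)
    {p : Fin I.n → ℝ} (hp : ∀ i, 0 ≤ p i) {T : Finset (Fin I.n)} {c : Fin I.n → ℕ}
    (hT : ∀ i ∈ T, p i < (r : ℝ) ^ 2 * E)
    (hc : ∀ i ∈ T, E / (r : ℝ) ^ 2 * c i ≤ (1 - 1 / r) * p i ∧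
      (1 - 1 / r) * p i < E / (r : ℝ) ^ 2 * (c i + 1)) (hC : ∀ i ∈ T, c i ≤ r ^ 4) :
    (1 - 1 / r) * I.revenue p ≤ ∑ j ∈ Tᶜ, p j * I.tail j (p j) +
      E / (r : ℝ) ^ 2 * I.meanLevel r a T c + 4 * E / r := by
  have hr' : (2 : ℝ) ≤ r := by exact_mod_cast hr
  have hd : (0 : ℝ) ≤ 1 - 1 / r := by
    rw [sub_nonneg, div_le_one (by linarith)]; linarith
  have hd1 : (1 : ℝ) - 1 / r ≤ 1 := by rw [sub_le_self_iff]; positivity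
  have hg : 0 < E / (r : ℝ) ^ 2 := by positivity
  have h1 : ∀ s : (i : Fin I.n) → Fin (I.K i),
      (1 - 1 / r) * payment (fun i => (I.value i (s i) : ℝ)) p ≤
      ∑ j ∈ Tᶜ, p j * (if p j ≤ I.value j (s j) then 1 else 0) +
      (E / (r : ℝ) ^ 2 *
        ((T.sup fun i => levelRank (r ^ 4) (a i (s i)) (c i)) % (r ^ 4 + 1) : ℕ) +
      (3 * (E / (r : ℝ) ^ 2) * r + (r : ℝ) ^ 2 * E *
        ∑ i, if (r : ℝ) ^ 3 * E ≤ I.value i (s i) then 1 else 0)) := by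
    intro s
    have h2 := payment_le_add_only (v := fun i => (I.value i (s i) : ℝ)) T hp
    have h3 : 0 ≤ ∑ j ∈ Tᶜ, p j * (if p j ≤ I.value j (s j) then 1 else 0) :=
      Finset.sum_nonneg fun j _ => mul_nonneg (hp j) (by split_ifs <;> norm_num)
    have h4 : (1 - 1 / r) * payment (only T fun i => (I.value i (s i) : ℝ)) p ≤
        E / (r : ℝ) ^ 2 *
          ((T.sup fun i => levelRank (r ^ 4) (a i (s i)) (c i)) % (r ^ 4 + 1) : ℕ) +
        (3 * (E / (r : ℝ) ^ 2) * r + (r : ℝ) ^ 2 * E *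
        ∑ i, if (r : ℝ) ^ 3 * E ≤ I.value i (s i) then 1 else 0) := by
      by_cases h : ∃ i, (r : ℝ) ^ 3 * E ≤ I.value i (s i)
      · have h5 := one_le_sum_indicator h
        have h6 : payment (only T fun i => (I.value i (s i) : ℝ)) p ≤ (r : ℝ) ^ 2 * E := by
          rcases payment_eq (only T fun i => (I.value i (s i) : ℝ)) p with ⟨-, h⟩ | ⟨i, hi, h⟩
          · rw [h]; positivity
          · rw [h]; exact (hT i ((mem_favourites_only hp).1 hi).1).le
        have h7 := le_mul_of_one_le_right (by positivity : 0 ≤ (r : ℝ) ^ 2 * E) h5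
        have h8 := mul_le_of_le_one_left
          (payment_nonneg (v := only T fun i => (I.value i (s i) : ℝ)) hp) hd1
        have h9 : 0 ≤ E / (r : ℝ) ^ 2 *
          ((T.sup fun i => levelRank (r ^ 4) (a i (s i)) (c i)) % (r ^ 4 + 1) : ℕ) := by positivity
        have h10 : 0 ≤ 3 * (E / (r : ℝ) ^ 2) * r := by positivity
        linarith
      · push Not at h
        have h5 := payment_only_le_levelRank (v := fun i => (I.value i (s i) : ℝ)) (T := T)
          (a := fun i => a i (s i)) (c := c) hg (by linarith : (1 : ℝ) ≤ r) hp
          (fun i _ => ha i (s i) (h i)) hc hC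
        have h6 : 0 ≤ (r : ℝ) ^ 2 * E *
            ∑ i, if (r : ℝ) ^ 3 * E ≤ I.value i (s i) then (1 : ℝ) else 0 :=
          mul_nonneg (by positivity) (Finset.sum_nonneg fun i _ => by split_ifs <;> norm_num)
        linarith
    have h5 := mul_le_mul_of_nonneg_left h2 hd
    have h6 := mul_le_of_le_one_left h3 hd1
    linarith
  have h2 := ex_mono h1
  rw [ex_mul_left, ← revenue_eq_ex, ex_add, ex_add, ex_add, ex_mul_left, ex_const, ex_sum] at h2
  simp only [ex_mul_left (p _), ex_tail] at h2
  have h3 := ex_exceptional hE h0 hr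
  have h4 : 3 * (E / (r : ℝ) ^ 2) * r + E / r = 4 * E / r := by
    field_simp; ring
  rw [meanLevel]
  linarith

/-- High items lose one factor `1 - 1/r` to the discount and one to the chance that another value
reaches `r E`. The rounded low market loses one factor to its discount and one to the chance that a
high item is affordable. -/
theorem estimate_le_revenue (hE : I.IsScale E) (h0 : 0 < E) (hr : 2 ≤ r) (ha : I.IsLevel E r a)
    {p y : Fin I.n → ℝ} {T : Finset (Fin I.n)} {c : Fin I.n → ℕ}
    (hC : ∀ i ∈ T, c i ≤ r ^ 4) (hc : ∀ i ∈ T, p i = (1 - 1 / r) * (E / (r : ℝ) ^ 2 * c i))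
    (hy : ∀ i ∈ Tᶜ, (r : ℝ) ^ 2 * E ≤ y i) (hpy : ∀ i ∈ Tᶜ, p i = (1 - 1 / r) * y i) :
    (1 - 1 / r) ^ 2 * (∑ j ∈ Tᶜ, y j * I.tail j (y j) +
      E / (r : ℝ) ^ 2 * I.meanLevel r a T c) ≤ I.revenue p + 2 * E / r := by
  have hr' : (2 : ℝ) ≤ r := by exact_mod_cast hr
  have hd : (0 : ℝ) < 1 - 1 / r := by
    rw [sub_pos, div_lt_one (by linarith)]; linarith
  have hd1 : (1 : ℝ) - 1 / r ≤ 1 := by rw [sub_le_self_iff]; positivity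
  have hg : 0 < E / (r : ℝ) ^ 2 := by positivity
  have hypos : ∀ i ∈ Tᶜ, 0 < y i := fun i hi => lt_of_lt_of_le (by positivity) (hy i hi)
  have hppos : ∀ i ∈ Tᶜ, 0 < p i := fun i hi => by
    rw [hpy i hi]; exact mul_pos hd (hypos i hi)
  have hp : ∀ i, 0 ≤ p i := by
    intro i
    by_cases hi : i ∈ T
    · rw [hc i hi]; positivity
    · exact (hppos i (Finset.mem_compl.2 hi)).le
  -- The discount on a price of at least `r² E` leaves the buyer utility at least `r E`.
  have htp : ∀ j ∈ Tᶜ, r * E + p j ≤ y j := by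
    intro j hj
    rw [hpy j hj]
    have h1 : r * E ≤ 1 / r * y j := by
      rw [one_div, inv_mul_eq_div, le_div_iff₀ (by linarith)]
      nlinarith [hy j hj]
    linarith
  -- This uses `(1 - 1/r) r² E = (r - 1) r E` and `r ≥ 2`.
  have hEp : ∀ j ∈ Tᶜ, r * E ≤ p j := by
    intro j hj
    have h1 := mul_le_mul_of_nonneg_left (hy j hj) hd.le
    rw [hpy j hj]
    refine le_trans ?_ h1
    have h2 : (1 - 1 / (r : ℝ)) * ((r : ℝ) ^ 2 * E) = (r - 1) * (r * E) := by
      field_simp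
    rw [h2]
    exact le_mul_of_one_le_left (by positivity) (by linarith)
  have hσ := hE.sum_tail_le h0 (by linarith : (1 : ℝ) < r)
  have h1 : ∀ s : (i : Fin I.n) → Fin (I.K i),
      ∑ j ∈ Tᶜ, p j * ((if y j ≤ I.value j (s j) then 1 else 0) -
        ∑ i ∈ Finset.univ.erase j, (if y j ≤ I.value j (s j) then 1 else 0) *
          (if r * E ≤ I.value i (s i) then 1 else 0)) +
      (payment (only T fun i => (I.value i (s i) : ℝ)) p -
        ∑ j ∈ Tᶜ, (if p j ≤ I.value j (s j) then 1 else 0) *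
          payment (only T fun i => (I.value i (s i) : ℝ)) p) ≤
      payment (fun i => (I.value i (s i) : ℝ)) p := by
    intro s
    refine le_trans ?_ (add_only_le_payment (v := fun i => (I.value i (s i) : ℝ)) T hp
      (by positivity : 0 ≤ r * E) htp hppos)
    refine add_le_add (Finset.sum_le_sum fun j hj => mul_le_mul_of_nonneg_left ?_ (hp j)) ?_
    · by_cases hyj : y j ≤ I.value j (s j)
      · simp only [hyj, if_true, true_and, one_mul]
        split_ifs with h
        · rw [sub_le_self_iff]
          exact Finset.sum_nonneg fun i _ => by split_ifs <;> norm_num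
        · push Not at h
          obtain ⟨i, hi, h⟩ := h
          have h2 := Finset.single_le_sum
            (f := fun i => if r * E ≤ I.value i (s i) then (1 : ℝ) else 0)
            (fun i _ => by split_ifs <;> norm_num)
            (Finset.mem_erase.2 ⟨hi, Finset.mem_univ i⟩)
          simp only [h, if_true] at h2
          linarith
      · simp [hyj]
    · have hpay := payment_nonneg (v := only T fun i => (I.value i (s i) : ℝ)) hp
      split_ifs with h
      · rw [mul_one, sub_le_self_iff]
        exact Finset.sum_nonneg fun j _ => mul_nonneg (by split_ifs <;> norm_num) hpay
      · push Not at h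
        obtain ⟨j, hj, h⟩ := h
        have h2 := Finset.single_le_sum (f := fun j => (if p j ≤ I.value j (s j) then 1 else 0) *
          payment (only T fun i => (I.value i (s i) : ℝ)) p)
          (fun j _ => mul_nonneg (by split_ifs <;> norm_num) hpay) hj
        simp only [h, if_true, one_mul] at h2
        linarith
  have h2 := ex_mono h1
  rw [← revenue_eq_ex, ex_add, ex_sub, ex_sum, ex_sum] at h2
  set R := I.ex fun s => payment (only T fun i => (I.value i (s i) : ℝ)) p with hR
  have hR0 : 0 ≤ R := ex_nonneg fun s => payment_nonneg hp
  -- The payment in the market of `T` ignores the value of `j`, so independence splits the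
  -- expectation.
  have h3 : ∀ j ∈ Tᶜ, (I.ex fun s => (if p j ≤ I.value j (s j) then 1 else 0) *
      payment (only T fun i => (I.value i (s i) : ℝ)) p) ≤ I.tail j (r * E) * R := by
    intro j hj
    rw [ex_tail_mul (f := fun s => payment (only T fun i => (I.value i (s i) : ℝ)) p)]
    · exact mul_le_mul_of_nonneg_right (tail_anti j (hEp j hj)) hR0
    · intro s k
      congr 1
      funext i
      by_cases hi : i ∈ T
      · have hij : i ≠ j := by
          rintro rfl; exact Finset.mem_compl.1 hj hi
        simp only [only, Function.update_of_ne hij]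
      · simp only [only, hi, if_false]
  have hsub : ∀ t : Finset (Fin I.n), ∑ i ∈ t, I.tail i (r * E) ≤ 1 / r := fun t =>
    (Finset.sum_le_sum_of_subset_of_nonneg (Finset.subset_univ _)
      fun i _ _ => tail_nonneg i _).trans hσ
  have h4 : ∑ j ∈ Tᶜ, (I.ex fun s => (if p j ≤ I.value j (s j) then 1 else 0) *
      payment (only T fun i => (I.value i (s i) : ℝ)) p) ≤ 1 / r * R := by
    refine (Finset.sum_le_sum h3).trans ?_
    rw [← Finset.sum_mul]
    exact mul_le_mul_of_nonneg_right (hsub _) hR0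
  have h5 : ∀ j ∈ Tᶜ, (1 - 1 / r) ^ 2 * (y j * I.tail j (y j)) ≤ I.ex fun s =>
      p j * ((if y j ≤ I.value j (s j) then 1 else 0) -
        ∑ i ∈ Finset.univ.erase j, (if y j ≤ I.value j (s j) then 1 else 0) *
          (if r * E ≤ I.value i (s i) then 1 else 0)) := by
    intro j hj
    rw [ex_mul_left, ex_sub, ex_sum, ex_tail]
    have h6 : ∀ i ∈ Finset.univ.erase j, (I.ex fun s =>
        (if y j ≤ I.value j (s j) then 1 else 0) *
          (if r * E ≤ I.value i (s i) then 1 else 0)) = I.tail j (y j) * I.tail i (r * E) := by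
      intro i hi
      rw [ex_tail_mul (f := fun s => if r * E ≤ I.value i (s i) then 1 else 0), ex_tail]
      intro s k
      rw [Function.update_of_ne (Finset.ne_of_mem_erase hi)]
    rw [Finset.sum_congr rfl h6, ← Finset.mul_sum, hpy j hj]
    have h7 := hsub (Finset.univ.erase j)
    have h8 : 0 ≤ (1 - 1 / r) * (y j * I.tail j (y j)) :=
      mul_nonneg hd.le (mul_nonneg (hypos j hj).le (tail_nonneg _ _))
    nlinarith
  have h6 := Finset.sum_le_sum h5
  rw [← Finset.mul_sum] at h6
  have h7 : (1 - 1 / r) * (E / (r : ℝ) ^ 2 * I.meanLevel r a T c) ≤ R + 2 * E / r := by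
    have h8 : ∀ s : (i : Fin I.n) → Fin (I.K i),
        (1 - 1 / r) * (E / (r : ℝ) ^ 2 *
          ((T.sup fun i => levelRank (r ^ 4) (a i (s i)) (c i)) % (r ^ 4 + 1) : ℕ)) ≤
        payment (only T fun i => (I.value i (s i) : ℝ)) p + (E / (r : ℝ) ^ 2 * r +
          (r : ℝ) ^ 2 * E * ∑ i, if (r : ℝ) ^ 3 * E ≤ I.value i (s i) then 1 else 0) := by
      intro s
      by_cases h : ∃ i, (r : ℝ) ^ 3 * E ≤ I.value i (s i)
      · have h5 := one_le_sum_indicator h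
        have h7 := le_mul_of_one_le_right (by positivity : 0 ≤ (r : ℝ) ^ 2 * E) h5
        have h8 := payment_nonneg (v := only T fun i => (I.value i (s i) : ℝ)) hp
        have h9 : ((T.sup fun i => levelRank (r ^ 4) (a i (s i)) (c i)) % (r ^ 4 + 1) : ℕ) ≤
          r ^ 4 := Nat.lt_succ_iff.1 (Nat.mod_lt _ (by omega))
        have h10 : (((T.sup fun i => levelRank (r ^ 4) (a i (s i)) (c i)) % (r ^ 4 + 1) : ℕ) : ℝ) ≤
          (r : ℝ) ^ 4 := by exact_mod_cast h9
        have h11 := mul_le_mul_of_nonneg_left h10 hg.le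
        have h12 : E / (r : ℝ) ^ 2 * (r : ℝ) ^ 4 = (r : ℝ) ^ 2 * E := by field_simp
        have h13 : 0 ≤ E / (r : ℝ) ^ 2 * r := by positivity
        refine (mul_le_of_le_one_left (by positivity) hd1).trans ?_
        linarith
      · push Not at h
        have h5 := levelRank_le_payment_only (v := fun i => (I.value i (s i) : ℝ)) (T := T)
          (a := fun i => a i (s i)) (c := c) hg (by linarith : (1 : ℝ) ≤ r) hp
          (fun i _ => ha i (s i) (h i)) hc hC
        have h6 : 0 ≤ (r : ℝ) ^ 2 * E *
            ∑ i, if (r : ℝ) ^ 3 * E ≤ I.value i (s i) then (1 : ℝ) else 0 :=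
          mul_nonneg (by positivity) (Finset.sum_nonneg fun i _ => by split_ifs <;> norm_num)
        linarith
    have h9 := ex_mono h8
    rw [ex_mul_left, ex_mul_left, ex_add, ex_add, ex_const] at h9
    have h10 := ex_exceptional hE h0 hr
    have h11 : E / (r : ℝ) ^ 2 * r + E / r = 2 * E / r := by
      field_simp; ring
    rw [meanLevel]
    linarith
  have h8 := mul_le_mul_of_nonneg_left h7 hd.le
  have h9 : (1 - 1 / r) * (2 * E / r) ≤ 2 * E / r :=
    mul_le_of_le_one_left (by positivity) hd1
  nlinarith

end Instance

end UnitDemand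

/-! ### The distribution of the largest rank. -/

namespace UnitDemand

namespace Instance

variable {I : Instance} {r : ℕ} {a : (i : Fin I.n) → Fin (I.K i) → ℕ} {T : Finset (Fin I.n)}
  {c : Fin I.n → ℕ}

/-- The probability that an item of `T` has rank at most `k`. -/
noncomputable def rankCdf (I : Instance) (r : ℕ) (a : (i : Fin I.n) → Fin (I.K i) → ℕ)
    (T : Finset (Fin I.n)) (c : Fin I.n → ℕ) (i : Fin I.n) (k : ℕ) : ℝ :=
  ∑ l, (I.prob i l : ℝ) * if i ∈ T → levelRank (r ^ 4) (a i l) (c i) ≤ k then 1 else 0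

theorem rankCdf_le_one (i : Fin I.n) (k : ℕ) : I.rankCdf r a T c i k ≤ 1 := by
  rw [← prob_sum_real (I := I) i]
  exact Finset.sum_le_sum fun l _ => mul_le_of_le_one_right (NNRat.cast_nonneg _)
    (by split_ifs <;> norm_num)

/-- The largest rank is at most `k` when every item of `T` has rank at most `k`; items outside `T`
contribute the factor `1`. -/
theorem prod_rankCdf (k : ℕ) : ∏ i, I.rankCdf r a T c i k = I.ex fun s =>
    if T.sup (fun i => levelRank (r ^ 4) (a i (s i)) (c i)) ≤ k then 1 else 0 := by
  simp only [rankCdf]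
  rw [← ex_prod fun i l => if i ∈ T → levelRank (r ^ 4) (a i l) (c i) ≤ k then (1 : ℝ) else 0]
  congr 1
  funext s
  simp [Finset.prod_boole, Finset.sup_le_iff]

theorem prod_rankCdf_mono : Monotone fun k => ∏ i, I.rankCdf r a T c i k := by
  intro k l h
  simp only [prod_rankCdf]
  refine ex_mono fun s => ?_
  split_ifs with h1 h2
  · rfl
  · exact absurd (h1.trans h) h2
  all_goals norm_num

/-- The mean is summed against the jumps of the distribution function. At `k = 0` the truncated `k -
1` makes the jump vanish, harmlessly because rank `0` pays `0`. -/
theorem meanLevel_eq (hC : ∀ i ∈ T, c i ≤ r ^ 4) (ha : ∀ i k, a i k ≤ r ^ 5) :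
    I.meanLevel r a T c = ∑ k ∈ Finset.range ((r ^ 5 + 1) * (r ^ 4 + 1)),
      ((k % (r ^ 4 + 1) : ℕ) : ℝ) *
        (∏ i, I.rankCdf r a T c i k - ∏ i, I.rankCdf r a T c i (k - 1)) := by
  simp only [prod_rankCdf, ← ex_sub, ← ex_mul_left, ← ex_sum]
  rw [meanLevel]
  congr 1
  funext s
  set N := T.sup fun i => levelRank (r ^ 4) (a i (s i)) (c i) with hN
  have hlt : N < (r ^ 5 + 1) * (r ^ 4 + 1) :=
    (Finset.sup_lt_iff (by positivity)).2 fun i hi => levelRank_lt (hC i hi) (ha i _)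
  rw [Finset.sum_eq_single_of_mem N (Finset.mem_range.2 hlt)]
  · rcases Nat.eq_zero_or_pos N with h | h
    · simp [h]
    · rw [if_pos le_rfl, if_neg (by omega), sub_zero, mul_one]
  · intro k _ hk
    rcases Nat.eq_zero_or_pos k with rfl | h0
    · simp
    · rcases lt_or_gt_of_ne hk with h | h
      · rw [if_neg (by omega), if_neg (by omega), sub_self, mul_zero]
      · rw [if_pos (by omega), if_pos (by omega), sub_self, mul_zero]

/-- All rounding errors lie in `[0, N]`, so each jump is off by at most `N` and is weighted by at
most `r ^ 4`. -/
theorem abs_sum_sub_meanLevel_le (hC : ∀ i ∈ T, c i ≤ r ^ 4) (ha : ∀ i k, a i k ≤ r ^ 5)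
    {s : ℕ → ℕ} {M N : ℝ} (hM : 0 ≤ M)
    (h₁ : ∀ k, s k ≤ M * ∏ i, I.rankCdf r a T c i k)
    (h₂ : ∀ k, M * ∏ i, I.rankCdf r a T c i k ≤ s k + N) :
    |((∑ k ∈ Finset.range ((r ^ 5 + 1) * (r ^ 4 + 1)),
      k % (r ^ 4 + 1) * (s k - if k = 0 then 0 else s (k - 1)) : ℕ) : ℝ) - M * I.meanLevel r a T c| ≤
      (((r ^ 5 + 1) * (r ^ 4 + 1) : ℕ) : ℝ) * ((r : ℝ) ^ 4 * N) := by
  have hN : 0 ≤ N := by linarith [h₁ 0, h₂ 0]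
  rw [meanLevel_eq hC ha, Finset.mul_sum, Nat.cast_sum, ← Finset.sum_sub_distrib]
  refine (Finset.abs_sum_le_sum_abs _ _).trans ?_
  refine (Finset.sum_le_card_nsmul _ _ ((r : ℝ) ^ 4 * N) fun k _ => ?_).trans ?_
  · rcases Nat.eq_zero_or_pos k with rfl | hk
    · simp; positivity
    · rw [if_neg hk.ne', Nat.cast_mul, mul_left_comm, ← mul_sub, abs_mul]
      have h3 : |((k % (r ^ 4 + 1) : ℕ) : ℝ)| ≤ (r : ℝ) ^ 4 := by
        rw [abs_of_nonneg (Nat.cast_nonneg _)]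
        have : k % (r ^ 4 + 1) ≤ r ^ 4 := Nat.lt_succ_iff.1 (Nat.mod_lt _ (by omega))
        exact_mod_cast this
      refine mul_le_mul h3 ?_ (abs_nonneg _) (by positivity)
      have h4 := mul_le_mul_of_nonneg_left (prod_rankCdf_mono (I := I) (r := r) (a := a) (T := T)
        (c := c) (Nat.sub_le k 1)) hM
      beta_reduce at h4
      rw [mul_sub, abs_le]
      -- In the second case the computed jump is truncated to `0`; the exact jump is nonnegative and
      -- at most `N`.
      rcases le_total (s (k - 1)) (s k) with h | h
      · rw [Nat.cast_sub h]
        constructor <;> linarith [h₁ k, h₂ k, h₁ (k - 1), h₂ (k - 1)]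
      · rw [Nat.sub_eq_zero_of_le h, Nat.cast_zero]
        have h5 : (s k : ℝ) ≤ s (k - 1) := by exact_mod_cast h
        constructor <;> linarith [h₁ k, h₂ k, h₁ (k - 1), h₂ (k - 1)]
  · simp

end Instance

/-! ### Products rounded down after every factor -/

/-- The product of `M` and the fractions `F / D`, rounded down after every factor. -/
def roundedProd (D M : ℕ) (l : List ℕ) : ℕ := l.foldr (fun F s => s * F / D) M

/-- Each division loses less than one unit, and later factors, being at most `1`, do not enlarge
earlier losses. -/
theorem roundedProd_bounds {D M : ℕ} (hD : 0 < D) {n : ℕ} {F : Fin n → ℕ} (hF : ∀ i, F i ≤ D) :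
    (roundedProd D M (List.ofFn F) : ℝ) ≤ M * ∏ i, ((F i : ℝ) / D) ∧
      M * ∏ i, ((F i : ℝ) / D) ≤ roundedProd D M (List.ofFn F) + n := by
  have hD' : (0 : ℝ) < D := by exact_mod_cast hD
  induction n with
  | zero => simp [roundedProd]
  | succ n ih =>
    obtain ⟨h1, h2⟩ := ih fun i => hF i.succ
    rw [List.ofFn_succ, Fin.prod_univ_succ]
    change ((roundedProd D M (List.ofFn fun i => F i.succ) * F 0 / D : ℕ) : ℝ) ≤ _ ∧
      _ ≤ ((roundedProd D M (List.ofFn fun i => F i.succ) * F 0 / D : ℕ) : ℝ) + _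
    set s := roundedProd D M (List.ofFn fun i => F i.succ)
    set P : ℝ := M * ∏ i : Fin n, ((F i.succ : ℝ) / D)
    have h3 : (M : ℝ) * ((F 0 : ℝ) / D * ∏ i : Fin n, ((F i.succ : ℝ) / D)) = F 0 / D * P := by
      simp only [P]; ring
    have h0 : (0 : ℝ) ≤ F 0 / D := by positivity
    have h0' : (F 0 : ℝ) / D ≤ 1 := by
      rw [div_le_one hD']; exact_mod_cast hF 0
    have h4 : ((s * F 0 / D : ℕ) : ℝ) ≤ F 0 / D * s := by
      refine Nat.cast_div_le.trans (le_of_eq ?_)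
      push_cast; ring
    have h5 : (F 0 : ℝ) / D * s < ((s * F 0 / D : ℕ) : ℝ) + 1 := by
      have h6 : s * F 0 < D * (s * F 0 / D + 1) := Nat.lt_mul_div_succ _ hD
      have h7 : (s : ℝ) * F 0 < D * (((s * F 0 / D : ℕ) : ℝ) + 1) := by exact_mod_cast h6
      rw [div_mul_eq_mul_div, div_lt_iff₀ hD']
      linarith
    rw [h3]
    constructor
    · exact h4.trans (mul_le_mul_of_nonneg_left h1 h0)
    · have h6 := mul_le_mul_of_nonneg_left h2 h0
      have h7 : (F 0 : ℝ) / D * n ≤ n := mul_le_of_le_one_left (Nat.cast_nonneg _) h0'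
      push_cast
      linarith

end UnitDemand

namespace UnitDemand

open BitCost

namespace Scheme

/-! ### Correctness of the dynamic program -/

theorem distance_eq_zero {v w : List ℕ} (h : v.length = w.length) : distance v w = 0 ↔ v = w := by
  induction v generalizing w with
  | nil => cases w <;> simp_all [distance]
  | cons a v ih =>
    cases w with
    | nil => simp at h
    | cons b w =>
      have h1 := ih (w := w) (by simpa using h)
      simp only [distance, List.zip_cons_cons, List.map_cons, List.sum_cons, List.cons.injEq] at h1 ⊢
      rw [← h1]
      omega

/-- The state that is reached by a sequence of choices without any pruning. -/
def path (D M : ℕ) (ranks : List ℕ) (xs : List Choice) : State :=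
  xs.foldr (fun o e => extend D e o) (start M ranks)

section

variable {D M : ℕ} {ranks : List ℕ}

theorem path_bonus (xs : List Choice) :
    (path D M ranks xs).2.1 = (xs.map fun o => o.2.1).sum := by
  induction xs with
  | nil => rfl
  | cons o xs ih =>
    change (path D M ranks xs).2.1 + o.2.1 = _
    rw [ih, List.map_cons, List.sum_cons, add_comm]

theorem path_prices (xs : List Choice) :
    (path D M ranks xs).2.2 = xs.map fun o => o.2.2 := by
  induction xs with
  | nil => rfl
  | cons o xs ih =>
    change o.2.2 :: (path D M ranks xs).2.2 = _
    rw [ih, List.map_cons]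

theorem path_ofFn {n : ℕ} {o : Fin n → Choice} {F : Fin n → ℕ → ℕ}
    (h : ∀ i, (o i).1 = ranks.map (F i)) : (path D M ranks (List.ofFn o)).1 =
      ranks.map fun k => roundedProd D M (List.ofFn fun i => F i k) := by
  induction n with
  | zero => simp [path, start, roundedProd]
  | succ n ih =>
    have h1 := ih fun i => h i.succ
    rw [List.ofFn_succ]
    change (((path D M ranks (List.ofFn fun i => o i.succ)).1.zip (o 0).1).map
      fun y => y.1 * y.2 / D) = _
    rw [h1, h 0, List.zip_map', List.map_map]
    simp only [List.ofFn_succ]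
    rfl

/-- The list of choices of each item has the format that the dynamic program expects. -/
def Proper (D : ℕ) (ranks : List ℕ) (opts : List Choice) : Prop :=
  ∀ o ∈ opts, o.1.length = ranks.length ∧ ∀ F ∈ o.1, F ≤ D

theorem path_proper {xs : List Choice} {L : List (List Choice)}
    (hL : ∀ opts ∈ L, Proper D ranks opts) (h : List.Forall₂ (· ∈ ·) xs L) :
    (path D M ranks xs).1.length = ranks.length ∧ ∀ s ∈ (path D M ranks xs).1, s ≤ M := by
  induction h with
  | nil => simp [path, start]
  | @cons o opts xs L ho _ ih =>
    obtain ⟨h1, h2⟩ := ih fun opts h => hL opts (List.mem_cons_of_mem _ h)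
    obtain ⟨h3, h4⟩ := hL opts List.mem_cons_self o ho
    change (((path D M ranks xs).1.zip o.1).map fun y => y.1 * y.2 / D).length = _ ∧
      ∀ s ∈ ((path D M ranks xs).1.zip o.1).map fun y => y.1 * y.2 / D, s ≤ M
    refine ⟨by simp [h1, h3], fun s hs => ?_⟩
    obtain ⟨⟨x, F⟩, hy, rfl⟩ := List.mem_map.1 hs
    have h5 := h2 _ (List.of_mem_zip hy).1
    have h6 := h4 _ (List.of_mem_zip hy).2
    refine (Nat.div_le_div_right (Nat.mul_le_mul h5 h6)).trans ?_
    rcases Nat.eq_zero_or_pos D with rfl | hD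
    · simp
    · rw [Nat.mul_div_cancel _ hD]

theorem states_cons (Z : List (List ℕ)) (opts : List Choice) (L : List (List Choice)) :
    states D M ranks Z (opts :: L) = round D Z opts (states D M ranks Z L) := by
  simp [states]

/-- Pruning only discards states: whatever survives is reached by actual choices, so its prices
belong to its merit. -/
theorem exists_path_of_mem_states {Z : List (List ℕ)} {L : List (List Choice)}
    (hZ : ∀ z ∈ Z, z.length = ranks.length) (hL : ∀ opts ∈ L, Proper D ranks opts) {e : State}
    (he : e ∈ states D M ranks Z L) :
    ∃ xs, List.Forall₂ (· ∈ ·) xs L ∧ path D M ranks xs = e := by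
  induction L generalizing e with
  | nil =>
    refine ⟨[], .nil, ?_⟩
    simpa [states, eq_comm, path] using he
  | cons opts L ih =>
    have hL' : ∀ opts ∈ L, Proper D ranks opts := fun o h => hL o (List.mem_cons_of_mem _ h)
    rw [states_cons] at he
    obtain ⟨hz, e', he', o, ho, h1, h2⟩ := mem_round he
    obtain ⟨xs, hxs, rfl⟩ := ih hL' he'
    have h3 : List.Forall₂ (· ∈ ·) (o :: xs) (opts :: L) := .cons ho hxs
    refine ⟨o :: xs, h3, ?_⟩
    have h4 := (path_proper (M := M) hL h3).1
    change extend D (path D M ranks xs) o = e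
    exact Prod.ext ((distance_eq_zero (h4.trans (hZ _ hz).symm)).1 h2) h1

/-- Pruning is lossless: the next vector depends only on the present one and separate revenue is
additive, so replacing a state by one with the same vector and more separate revenue never hurts
later. -/
theorem exists_mem_states {Z : List (List ℕ)} {L : List (List Choice)}
    (hZ : ∀ z : List ℕ, z.length = ranks.length → (∀ s ∈ z, s ≤ M) → z ∈ Z)
    (hL : ∀ opts ∈ L, Proper D ranks opts) {xs : List Choice}
    (h : List.Forall₂ (· ∈ ·) xs L) :
    ∃ e ∈ states D M ranks Z L, e.1 = (path D M ranks xs).1 ∧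
      (path D M ranks xs).2.1 ≤ e.2.1 := by
  induction h with
  | nil => exact ⟨start M ranks, by simp [states], rfl, le_rfl⟩
  | @cons o opts xs L ho h ih =>
    obtain ⟨e, he, h1, h2⟩ := ih fun o h => hL o (List.mem_cons_of_mem _ h)
    have h3 : List.Forall₂ (· ∈ ·) (o :: xs) (opts :: L) := .cons ho h
    obtain ⟨h4, h5⟩ := path_proper (M := M) hL h3
    have h6 := hZ _ h4 h5
    have h7 : (extend D e o).1 = (path D M ranks (o :: xs)).1 := by
      change _ = (extend D (path D M ranks xs) o).1
      simp only [extend, h1]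
    have h8 : ((path D M ranks (o :: xs)).1, (extend D e o).2) ∈
        ((states D M ranks Z L).flatMap fun e => opts.map fun o => extend D e o).flatMap fun e =>
          selLE (distance e.1 (path D M ranks (o :: xs)).1) 0
            [((path D M ranks (o :: xs)).1, e.2)] [] := by
      refine List.mem_flatMap.2 ⟨extend D e o, List.mem_flatMap.2 ⟨e, he,
        List.mem_map.2 ⟨o, ho, rfl⟩⟩, ?_⟩
      rw [selLE, if_pos]
      · exact List.mem_singleton.2 rfl
      · exact ((distance_eq_zero (by rw [h7])).2 h7).le
    obtain ⟨b, hb, h9, h10⟩ := best_spec (fun e : State => e.2.1) h8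
    refine ⟨b, ?_, ?_, ?_⟩
    · rw [states_cons]
      exact List.mem_flatMap.2 ⟨_, h6, by rw [h9]; exact List.mem_singleton.2 rfl⟩
    · obtain ⟨e', -, h11⟩ := List.mem_flatMap.1 hb
      rw [selLE] at h11
      split_ifs at h11
      · rw [List.mem_singleton.1 h11]
      · simp at h11
    · refine le_trans ?_ h10
      exact Nat.add_le_add_right h2 _

theorem forall₂_ofFn {n : ℕ} {O : Fin n → List Choice} {xs : List Choice} :
    List.Forall₂ (· ∈ ·) xs (List.ofFn O) ↔ ∃ o : Fin n → Choice, xs = List.ofFn o ∧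
      ∀ i, o i ∈ O i := by
  induction n generalizing xs with
  | zero => simp
  | succ n ih =>
    rw [List.ofFn_succ]
    constructor
    · intro h
      rcases xs with _ | ⟨x, xs⟩
      · cases h
      · rw [List.forall₂_cons] at h
        obtain ⟨o, rfl, ho⟩ := ih.1 h.2
        exact ⟨Fin.cons x o, by simp [List.ofFn_succ], Fin.cases h.1 ho⟩
    · rintro ⟨o, rfl, ho⟩
      rw [List.ofFn_succ]
      exact .cons (ho 0) (ih.2 ⟨_, rfl, fun i => ho i.succ⟩)

/-- The algorithm outputs the prices of a sequence of choices of largest merit. -/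
theorem prices_spec {r E : ℕ} {levels : List ℕ} {Z : List (List ℕ)} {n : ℕ}
    {item : Fin n → List (ℕ × ℕ)}
    (hZ : ∀ z : List ℕ, z ∈ Z ↔ z.length = ranks.length ∧ ∀ s ∈ z, s ≤ M)
    (hL : ∀ i, Proper D ranks (choices r E D levels ranks (item i)))
    (hne : ∀ i, choices r E D levels ranks (item i) ≠ []) :
    ∃ o : Fin n → Choice, (∀ i, o i ∈ choices r E D levels ranks (item i)) ∧
      prices r E D M levels ranks Z (List.ofFn item) = List.ofFn (fun i => (o i).2.2) ∧
      ∀ o' : Fin n → Choice, (∀ i, o' i ∈ choices r E D levels ranks (item i)) →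
        merit r E D M ranks (path D M ranks (List.ofFn o')) ≤
          merit r E D M ranks (path D M ranks (List.ofFn o)) := by
  have hmap : (List.ofFn item).map (fun item => choices r E D levels ranks item) =
      List.ofFn fun i => choices r E D levels ranks (item i) := List.map_ofFn ..
  have hL' : ∀ opts ∈ List.ofFn fun i => choices r E D levels ranks (item i),
      Proper D ranks opts := by
    intro opts h
    obtain ⟨i, rfl⟩ := (List.mem_ofFn' _ _).1 h
    exact hL i
  have key : ∀ o' : Fin n → Choice, (∀ i, o' i ∈ choices r E D levels ranks (item i)) →
      ∃ e ∈ states D M ranks Z (List.ofFn fun i => choices r E D levels ranks (item i)),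
        merit r E D M ranks (path D M ranks (List.ofFn o')) ≤ merit r E D M ranks e := by
    intro o' ho'
    obtain ⟨e, he, h1, h2⟩ := exists_mem_states (fun z h h' => (hZ z).2 ⟨h, h'⟩) hL'
      (forall₂_ofFn.2 ⟨o', rfl, ho'⟩)
    refine ⟨e, he, ?_⟩
    rw [merit, merit, h1]
    gcongr
  choose o₀ ho₀ using fun i => List.exists_mem_of_ne_nil _ (hne i)
  obtain ⟨e, he, -⟩ := key o₀ ho₀
  obtain ⟨b, hb, h1, -⟩ := best_spec (merit r E D M ranks) he
  obtain ⟨xs, hxs, h2⟩ := exists_path_of_mem_states (fun z hz => ((hZ z).1 hz).1) hL' hb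
  obtain ⟨o, rfl, ho⟩ := forall₂_ofFn.1 hxs
  refine ⟨o, ho, ?_, fun o' ho' => ?_⟩
  · rw [prices, hmap, h1, ← h2]
    simp only [listCases]
    rw [path_prices, List.map_ofFn]
    rfl
  · obtain ⟨e', he', h3⟩ := key o' ho'
    obtain ⟨b', hb', h4, h5⟩ := best_spec (merit r E D M ranks) he'
    rw [h1] at h4
    cases h4
    rw [h2]
    exact h3.trans h5

theorem meanLevel_map_range (r m : ℕ) (s : ℕ → ℕ) :
    meanLevel r (List.range m) ((List.range m).map s) =
      ∑ k ∈ Finset.range m, k % (r ^ 4 + 1) * (s k - if k = 0 then 0 else s (k - 1)) := by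
  have h : (List.range m).zip (((List.range m).map s).zip (0 :: (List.range m).map s)) =
      (List.range m).map fun k => (k, (s k, if k = 0 then 0 else s (k - 1))) := by
    refine List.ext_getElem (by simp) fun i h1 h2 => ?_
    rcases i with _ | i <;> simp
  rw [meanLevel, h, List.map_map]
  rfl

end

end Scheme

end UnitDemand

namespace UnitDemand

open BitCost

namespace Instance

/-! ### The integral form of an instance -/

/-- The mass points of the items, with numerators and denominators. -/
def raw (I : Instance) : Scheme.Raw :=
  List.ofFn fun i => List.ofFn fun k => (((I.value i k).num, (I.value i k).den),
    ((I.prob i k).num, (I.prob i k).den))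

theorem encode_eq (I : Instance) : I.encode = Enc.enc I.raw := by
  simp only [encode, raw, Enc.enc, List.map_ofFn, Function.comp_def]
  rfl

variable (I : Instance)

theorem denom_dvd (i : Fin I.n) (k : Fin (I.K i)) :
    (I.value i k).den ∣ Scheme.denom I.raw ∧ (I.prob i k).den ∣ Scheme.denom I.raw := by
  have h : (I.value i k).den * (I.prob i k).den ∣ Scheme.denom I.raw := by
    refine List.dvd_prod (List.mem_map.2 ⟨(((I.value i k).num, (I.value i k).den),
      ((I.prob i k).num, (I.prob i k).den)), ?_, rfl⟩)
    refine List.mem_flatten.2 ⟨_, (List.mem_ofFn' _ _).2 ⟨i, rfl⟩, (List.mem_ofFn' _ _).2 ⟨k, rfl⟩⟩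
  exact ⟨(dvd_mul_right _ _).trans h, (dvd_mul_left _ _).trans h⟩

theorem denom_pos : 0 < Scheme.denom I.raw := by
  refine Nat.pos_of_ne_zero (List.prod_ne_zero fun h => ?_)
  obtain ⟨x, hx, h0⟩ := List.mem_map.1 h
  obtain ⟨l, hl, hx⟩ := List.mem_flatten.1 hx
  obtain ⟨i, rfl⟩ := (List.mem_ofFn' _ _).1 hl
  obtain ⟨k, rfl⟩ := (List.mem_ofFn' _ _).1 hx
  exact (Nat.mul_pos (I.value i k).den_pos (I.prob i k).den_pos).ne' h0

/-- The integral value of a mass point. -/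
def point (i : Fin I.n) (k : Fin (I.K i)) : ℕ :=
  Scheme.denom I.raw ^ 2 * (I.value i k).num / (I.value i k).den

/-- The integral weight of a mass point. -/
def weight (i : Fin I.n) (k : Fin (I.K i)) : ℕ :=
  Scheme.denom I.raw * (I.prob i k).num / (I.prob i k).den

/-- The integral form of an item. -/
def item (i : Fin I.n) : List (ℕ × ℕ) := List.ofFn fun k => (I.point i k, I.weight i k)

theorem integral_raw : Scheme.integral I.raw = List.ofFn I.item := by
  rw [Scheme.integral]
  generalize hD : Scheme.denom I.raw = D
  simp only [raw, List.map_ofFn]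
  congr 1
  funext i
  simp only [Function.comp, item, point, weight, hD, List.map_ofFn]
  rfl

variable {I}

theorem denom_pos_real : (0 : ℝ) < Scheme.denom I.raw := by exact_mod_cast denom_pos I

theorem cast_point (i : Fin I.n) (k : Fin (I.K i)) :
    (I.point i k : ℝ) = Scheme.denom I.raw ^ 2 * I.value i k := by
  have h := (denom_dvd I i k).1
  have h0 : ((I.value i k).den : ℝ) ≠ 0 := by exact_mod_cast (I.value i k).den_ne_zero
  rw [point, Nat.cast_div ((dvd_pow h two_ne_zero).mul_right _) h0, NNRat.cast_def]
  push_cast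
  ring

theorem cast_weight (i : Fin I.n) (k : Fin (I.K i)) :
    (I.weight i k : ℝ) = Scheme.denom I.raw * I.prob i k := by
  have h := (denom_dvd I i k).2
  have h0 : ((I.prob i k).den : ℝ) ≠ 0 := by exact_mod_cast (I.prob i k).den_ne_zero
  rw [weight, Nat.cast_div (h.mul_right _) h0, NNRat.cast_def]
  push_cast
  ring

/-- This is the reason for scaling the values by the square of the denominator: the division by it
in `tailRevenue` is exact. -/
theorem denom_dvd_point (i : Fin I.n) (k : Fin (I.K i)) : Scheme.denom I.raw ∣ I.point i k := by
  obtain ⟨d, hd⟩ := (denom_dvd I i k).1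
  refine ⟨d * (I.value i k).num, ?_⟩
  rw [point]
  refine Nat.div_eq_of_eq_mul_left (I.value i k).den_pos ?_
  generalize Scheme.denom I.raw = D at hd ⊢
  subst hd
  ring

theorem cast_sum_item (i : Fin I.n) (φ : ℕ → Prop) [DecidablePred φ] :
    (((I.item i).map fun x => if φ x.1 then x.2 else 0).sum : ℕ) =
      (Scheme.denom I.raw : ℝ) * ∑ k, (I.prob i k : ℝ) * if φ (I.point i k) then 1 else 0 := by
  rw [item, List.map_ofFn, List.sum_ofFn, Nat.cast_sum, Finset.mul_sum]
  refine Finset.sum_congr rfl fun k _ => ?_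
  simp only [Function.comp]
  split_ifs
  · rw [cast_weight, mul_one]
  · simp

theorem le_point_iff {y : ℕ} (i : Fin I.n) (k : Fin (I.K i)) :
    y ≤ I.point i k ↔ (y : ℝ) / Scheme.denom I.raw ^ 2 ≤ I.value i k := by
  have h := denom_pos_real (I := I)
  rw [div_le_iff₀ (by positivity), mul_comm, ← cast_point, Nat.cast_le]

theorem point_div (i : Fin I.n) (k : Fin (I.K i)) :
    (I.point i k : ℝ) / Scheme.denom I.raw ^ 2 = I.value i k := by
  have h := denom_pos_real (I := I)
  rw [cast_point]
  field_simp

theorem cast_tailWeight (i : Fin I.n) (y : ℕ) : (Scheme.tailWeight (I.item i) y : ℝ) =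
    Scheme.denom I.raw * I.tail i (y / Scheme.denom I.raw ^ 2) := by
  have h := cast_sum_item i fun x => y ≤ x
  simp only [le_point_iff] at h
  exact h

theorem cast_point_mul_tailWeight (i : Fin I.n) (k : Fin (I.K i)) :
    ((I.point i k * Scheme.tailWeight (I.item i) (I.point i k) / Scheme.denom I.raw : ℕ) : ℝ) =
      Scheme.denom I.raw ^ 2 * (I.value i k * I.tail i (I.value i k)) := by
  have h := denom_pos_real (I := I)
  rw [Nat.cast_div ((denom_dvd_point i k).mul_right _) h.ne', Nat.cast_mul, cast_tailWeight,
    point_div, cast_point]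
  field_simp

theorem isTailRevenue (i : Fin I.n) (H : ℕ) : I.IsTailRevenue i (H / Scheme.denom I.raw ^ 2)
    (Scheme.tailRevenue (Scheme.denom I.raw) H (I.item i) / Scheme.denom I.raw ^ 2) := by
  have h := denom_pos_real (I := I)
  have hlt : ∀ k, (H : ℝ) / Scheme.denom I.raw ^ 2 < I.value i k ↔ ¬ I.point i k ≤ H := by
    intro k
    rw [div_lt_iff₀ (by positivity), mul_comm, ← cast_point, Nat.cast_lt, not_le]
  constructor
  · intro k hk
    rw [hlt] at hk
    rw [le_div_iff₀ (by positivity), mul_comm, ← cast_point_mul_tailWeight, Nat.cast_le]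
    refine le_maximum (List.mem_map.2 ⟨_, (List.mem_ofFn' _ _).2 ⟨k, rfl⟩, ?_⟩)
    simp only [selLE, if_neg hk]
  · rcases maximum_mem ((I.item i).map fun x => selLE x.1 H 0
      (x.1 * Scheme.tailWeight (I.item i) x.1 / Scheme.denom I.raw)) with h0 | h0
    · left
      rw [Scheme.tailRevenue, h0]
      simp
    · obtain ⟨x, hx, h1⟩ := List.mem_map.1 h0
      obtain ⟨k, rfl⟩ := (List.mem_ofFn' _ _).1 hx
      simp only [selLE] at h1
      rw [Scheme.tailRevenue]
      simp only [selLE]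
      rw [← h1]
      split_ifs with h2
      · left; simp
      · refine .inr ⟨k, (hlt k).2 h2, ?_⟩
        rw [cast_point_mul_tailWeight]
        field_simp

theorem isScale_scale (I : Instance) :
    I.IsScale (Scheme.scale (Scheme.denom I.raw) (List.ofFn I.item) / Scheme.denom I.raw ^ 2) := by
  have h := denom_pos_real (I := I)
  set D := Scheme.denom I.raw with hD
  have hpt : ∀ H, I.IsPoint H → ∃ N : ℕ, (N = 0 ∨ ∃ i k, N = I.point i k) ∧
      H = N / (D : ℝ) ^ 2 := by
    rintro H (rfl | ⟨i, k, rfl⟩)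
    · exact ⟨0, .inl rfl, by simp⟩
    · exact ⟨_, .inr ⟨i, k, rfl⟩, (point_div i k).symm⟩
  -- `isScale` wants tail revenues as functions of a real threshold; the floor recovers the integer
  -- threshold.
  have hfl : ∀ N : ℕ, ⌊(N : ℝ) / (D : ℝ) ^ 2 * (D : ℝ) ^ 2⌋₊ = N := by
    intro N
    rw [div_mul_cancel₀ _ (by positivity), Nat.floor_natCast]
  have hsum : ∀ N : ℕ, (((N + ((List.ofFn I.item).map (Scheme.tailRevenue D N)).sum : ℕ) : ℝ)) /
      (D : ℝ) ^ 2 = N / (D : ℝ) ^ 2 + ∑ i, (Scheme.tailRevenue D N (I.item i) : ℝ) / (D : ℝ) ^ 2 := by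
    intro N
    rw [List.map_ofFn, List.sum_ofFn]
    push_cast
    rw [add_div, Finset.sum_div]
    rfl
  have hle : ∀ N : ℕ, (N = 0 ∨ ∃ i k, N = I.point i k) → Scheme.scale D (List.ofFn I.item) ≤
      N + ((List.ofFn I.item).map (Scheme.tailRevenue D N)).sum := by
    rintro N (rfl | ⟨i, k, rfl⟩)
    · exact minimum_le_left _ _
    · refine minimum_le (List.mem_map.2 ⟨(I.point i k, I.weight i k), ?_, rfl⟩)
      exact List.mem_flatten.2 ⟨_, (List.mem_ofFn' _ _).2 ⟨i, rfl⟩, (List.mem_ofFn' _ _).2 ⟨k, rfl⟩⟩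
  refine isScale (τ := fun i H =>
    (Scheme.tailRevenue D ⌊H * (D : ℝ) ^ 2⌋₊ (I.item i) : ℝ) / (D : ℝ) ^ 2) ?_ ?_ ?_
  · intro i H hH
    obtain ⟨N, -, rfl⟩ := hpt H hH
    simp only [hfl]
    exact isTailRevenue i N
  · have : ∃ N : ℕ, I.IsPoint (N / (D : ℝ) ^ 2) ∧ Scheme.scale D (List.ofFn I.item) =
        N + ((List.ofFn I.item).map (Scheme.tailRevenue D N)).sum := by
      rcases minimum_mem (0 + ((List.ofFn I.item).map (Scheme.tailRevenue D 0)).sum)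
        ((List.ofFn I.item).flatten.map fun x =>
          x.1 + ((List.ofFn I.item).map (Scheme.tailRevenue D x.1)).sum) with h1 | h1
      · exact ⟨0, .inl (by simp), h1⟩
      · obtain ⟨x, hx, h1⟩ := List.mem_map.1 h1
        obtain ⟨l, hl, hx⟩ := List.mem_flatten.1 hx
        obtain ⟨i, rfl⟩ := (List.mem_ofFn' _ _).1 hl
        obtain ⟨k, rfl⟩ := (List.mem_ofFn' _ _).1 hx
        exact ⟨I.point i k, .inr ⟨i, k, point_div i k⟩, h1.symm⟩
    obtain ⟨N, hN, h1⟩ := this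
    refine ⟨_, hN, ?_⟩
    simp only [hfl]
    rw [h1, hsum]
  · intro H hH
    obtain ⟨N, hN, rfl⟩ := hpt H hH
    simp only [hfl]
    rw [← hsum]
    exact div_le_div_of_nonneg_right (by exact_mod_cast hle N hN) (by positivity)

/-- The value levels of the algorithm. -/
def levels (I : Instance) (r E : ℕ) (i : Fin I.n) (k : Fin (I.K i)) : ℕ :=
  Scheme.level r E (I.point i k)

/-- Below `r³ E` the cap `r ^ 5` on the levels is not active, so the level is the plain integer
quotient. -/
theorem isLevel_levels {r E : ℕ} (hr : 0 < r) (hE : 0 < E) :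
    I.IsLevel (E / (Scheme.denom I.raw : ℝ) ^ 2) r (I.levels r E) := by
  have h := denom_pos_real (I := I)
  intro i k hk
  have hr' : (0 : ℝ) < r := by exact_mod_cast hr
  have hE' : (0 : ℝ) < E := by exact_mod_cast hE
  have h1 : I.point i k * r ^ 2 / E < r ^ 5 := by
    rw [Nat.div_lt_iff_lt_mul hE]
    have h2 : (I.point i k : ℝ) * (r : ℝ) ^ 2 < (r : ℝ) ^ 5 * E := by
      rw [← point_div, div_lt_iff₀ (by positivity)] at hk
      have : (r : ℝ) ^ 3 * (E / (Scheme.denom I.raw : ℝ) ^ 2) * (Scheme.denom I.raw : ℝ) ^ 2 =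
        (r : ℝ) ^ 3 * E := by field_simp
      rw [this] at hk
      calc _ < (r : ℝ) ^ 3 * E * (r : ℝ) ^ 2 := mul_lt_mul_of_pos_right hk (by positivity)
        _ = _ := by ring
    exact_mod_cast h2
  rw [levels, Scheme.level, min_eq_left h1.le]
  set q := I.point i k * r ^ 2 / E with hq
  have h2 : (q : ℝ) * E ≤ I.point i k * (r : ℝ) ^ 2 := by
    exact_mod_cast Nat.div_mul_le_self (I.point i k * r ^ 2) E
  have h3 : I.point i k * (r : ℝ) ^ 2 < E * ((q : ℝ) + 1) := by
    exact_mod_cast Nat.lt_mul_div_succ (I.point i k * r ^ 2) hE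
  rw [cast_point] at h2 h3
  constructor
  · rw [div_div, div_mul_eq_mul_div, div_le_iff₀ (by positivity)]
    linarith
  · rw [div_div, div_mul_eq_mul_div, lt_div_iff₀ (by positivity)]
    linarith

theorem cast_rankWeight (r E : ℕ) (i : Fin I.n) (c k : ℕ) :
    (Scheme.rankWeight r E (I.item i) c k : ℝ) = Scheme.denom I.raw *
      ∑ l, (I.prob i l : ℝ) * if levelRank (r ^ 4) (I.levels r E i l) c ≤ k then 1 else 0 :=
  cast_sum_item i fun x => Scheme.rank r E x c ≤ k

end Instance

end UnitDemand

namespace UnitDemand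

open BitCost

namespace Instance

/-! ### The merit of a plan -/

variable {I : Instance} {r E : ℕ} {T : Finset (Fin I.n)} {c : Fin I.n → ℕ} {x : Fin I.n → ℕ}

/-- The choices of the algorithm that put the items of `T` at the price levels `c` and the other
items at the high prices `x`. -/
def plan (I : Instance) (r E : ℕ) (T : Finset (Fin I.n)) (c x : Fin I.n → ℕ) (i : Fin I.n) :
    Scheme.Choice :=
  if i ∈ T then Scheme.lowChoice r E (Scheme.denom I.raw) (List.range (Scheme.numRanks r))
    (I.item i) (c i)
  else Scheme.highChoice r E (Scheme.denom I.raw) (List.range (Scheme.numRanks r)) (I.item i) (x i)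

/-- The high prices of a plan. -/
noncomputable def highPrice (I : Instance) (r E : ℕ) (x : Fin I.n → ℕ) (i : Fin I.n) : ℝ :=
  ((max (x i) (r ^ 2 * E) : ℕ) : ℝ) / (Scheme.denom I.raw : ℝ) ^ 2

/-- The estimate of the revenue of a plan. -/
noncomputable def estimate (I : Instance) (r E : ℕ) (T : Finset (Fin I.n)) (c x : Fin I.n → ℕ) : ℝ :=
  ∑ j ∈ Tᶜ, I.highPrice r E x j * I.tail j (I.highPrice r E x j) +
    E / (Scheme.denom I.raw : ℝ) ^ 2 / (r : ℝ) ^ 2 * I.meanLevel r (I.levels r E) T c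

/-- The choices of the algorithm for an item. -/
abbrev options (I : Instance) (r E : ℕ) (i : Fin I.n) : List Scheme.Choice :=
  Scheme.choices r E (Scheme.denom I.raw) (List.range (r ^ 4 + 1))
    (List.range (Scheme.numRanks r)) (I.item i)

theorem plan_mem (hc : ∀ i ∈ T, c i ≤ r ^ 4) (hx : ∀ i ∉ T, ∃ k, x i = I.point i k)
    (i : Fin I.n) : I.plan r E T c x i ∈ I.options r E i := by
  rw [options, Scheme.choices, List.mem_append, plan]
  split_ifs with h
  · exact .inl (List.mem_map.2 ⟨c i, List.mem_range.2 (Nat.lt_succ_of_le (hc i h)), rfl⟩)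
  · obtain ⟨k, hk⟩ := hx i h
    exact .inr (List.mem_map.2 ⟨_, (List.mem_ofFn' _ _).2 ⟨k, rfl⟩, by rw [hk]⟩)

/-- The high prices need not be recorded as mass points here: the lower bound for the revenue of a
plan needs only that they are at least `r² E`, which `highChoice` enforces by its maximum. -/
theorem exists_plan {o : Fin I.n → Scheme.Choice} (ho : ∀ i, o i ∈ I.options r E i) :
    ∃ (T : Finset (Fin I.n)) (c x : Fin I.n → ℕ), (∀ i ∈ T, c i ≤ r ^ 4) ∧
      o = I.plan r E T c x := by
  have h : ∀ i, ∃ y, (y ≤ r ^ 4 ∧ o i = Scheme.lowChoice r E (Scheme.denom I.raw)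
      (List.range (Scheme.numRanks r)) (I.item i) y) ∨
      o i = Scheme.highChoice r E (Scheme.denom I.raw)
        (List.range (Scheme.numRanks r)) (I.item i) y := by
    intro i
    rcases List.mem_append.1 (ho i) with h | h
    · obtain ⟨y, hy, h⟩ := List.mem_map.1 h
      exact ⟨y, .inl ⟨Nat.lt_succ_iff.1 (List.mem_range.1 hy), h.symm⟩⟩
    · obtain ⟨y, -, h⟩ := List.mem_map.1 h
      exact ⟨_, .inr h.symm⟩
  choose y hy using h
  classical
  refine ⟨Finset.univ.filter fun i => y i ≤ r ^ 4 ∧ o i = Scheme.lowChoice r E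
    (Scheme.denom I.raw) (List.range (Scheme.numRanks r)) (I.item i) (y i), y, y,
    fun i hi => (Finset.mem_filter.1 hi).2.1, funext fun i => ?_⟩
  rw [plan]
  split_ifs with h
  · exact (Finset.mem_filter.1 h).2.2
  · rcases hy i with h1 | h1
    · exact (h (Finset.mem_filter.2 ⟨Finset.mem_univ i, h1⟩)).elim
    · exact h1

/-- The integral rank distributions of a plan. -/
def planWeight (I : Instance) (r E : ℕ) (T : Finset (Fin I.n)) (c : Fin I.n → ℕ) (i : Fin I.n)
    (k : ℕ) : ℕ :=
  if i ∈ T then Scheme.rankWeight r E (I.item i) (c i) k else Scheme.denom I.raw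

theorem plan_fst (i : Fin I.n) : (I.plan r E T c x i).1 =
    (List.range (Scheme.numRanks r)).map (I.planWeight r E T c i) := by
  by_cases h : i ∈ T
  · have h1 : I.planWeight r E T c i = Scheme.rankWeight r E (I.item i) (c i) := by
      funext k; rw [planWeight, if_pos h]
    rw [plan, if_pos h, h1]
    rfl
  · have h1 : I.planWeight r E T c i = fun _ => Scheme.denom I.raw := by
      funext k; rw [planWeight, if_neg h]
    rw [plan, if_neg h, h1]
    rfl

theorem cast_planWeight (i : Fin I.n) (k : ℕ) : (I.planWeight r E T c i k : ℝ) =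
    Scheme.denom I.raw * I.rankCdf r (I.levels r E) T c i k := by
  rw [planWeight, rankCdf]
  by_cases h : i ∈ T
  · simp only [h, if_true, true_imp_iff, cast_rankWeight]
  · simp only [h, if_false, false_imp_iff, if_true, mul_one, prob_sum_real]

theorem planWeight_le (i : Fin I.n) (k : ℕ) : I.planWeight r E T c i k ≤ Scheme.denom I.raw := by
  have h : (I.planWeight r E T c i k : ℝ) ≤ Scheme.denom I.raw := by
    rw [cast_planWeight]
    exact mul_le_of_le_one_right (Nat.cast_nonneg _) (rankCdf_le_one _ _)
  exact_mod_cast h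

theorem proper_options (i : Fin I.n) :
    Scheme.Proper (Scheme.denom I.raw) (List.range (Scheme.numRanks r)) (I.options r E i) := by
  intro o ho
  have h : ∃ f : ℕ → ℕ, o.1 = (List.range (Scheme.numRanks r)).map f ∧
      ∀ k, f k ≤ Scheme.denom I.raw := by
    rcases List.mem_append.1 ho with h | h
    · obtain ⟨y, hy, rfl⟩ := List.mem_map.1 h
      refine ⟨Scheme.rankWeight r E (I.item i) y, rfl, fun k => ?_⟩
      have := planWeight_le (I := I) (r := r) (E := E) (T := Finset.univ) (c := fun _ => y) i k
      simpa [planWeight] using this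
    · obtain ⟨y, -, rfl⟩ := List.mem_map.1 h
      exact ⟨fun _ => Scheme.denom I.raw, rfl, fun _ => le_rfl⟩
  obtain ⟨f, h1, h2⟩ := h
  rw [h1]
  refine ⟨by simp, fun F hF => ?_⟩
  obtain ⟨k, -, rfl⟩ := List.mem_map.1 hF
  exact h2 k

/-- The merit of a plan, in the units of the instance. -/
noncomputable def planValue (I : Instance) (r E : ℕ) (o : Fin I.n → Scheme.Choice) : ℝ :=
  (Scheme.merit r E (Scheme.denom I.raw) (Scheme.resolution r I.n)
    (List.range (Scheme.numRanks r)) (Scheme.path (Scheme.denom I.raw) (Scheme.resolution r I.n)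
      (List.range (Scheme.numRanks r)) (List.ofFn o)) : ℝ) /
    ((Scheme.denom I.raw : ℝ) ^ 3 * (r : ℝ) ^ 2 * Scheme.resolution r I.n)

theorem resolution_pos (hr : 0 < r) (n : ℕ) : 0 < Scheme.resolution r n := by
  unfold Scheme.resolution Scheme.numRanks
  positivity

theorem cast_bonus_plan : (((List.ofFn (I.plan r E T c x)).map fun o => o.2.1).sum : ℕ) =
    (Scheme.denom I.raw : ℝ) ^ 3 *
      ∑ j ∈ Tᶜ, I.highPrice r E x j * I.tail j (I.highPrice r E x j) := by
  have hD := denom_pos_real (I := I)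
  rw [List.map_ofFn, List.sum_ofFn, Nat.cast_sum, Finset.mul_sum]
  refine (Finset.sum_subset (Finset.subset_univ Tᶜ) fun i _ hi => ?_).symm.trans
    (Finset.sum_congr rfl fun i hi => ?_)
  · rw [Finset.mem_compl, not_not] at hi
    simp only [Function.comp, plan, if_pos hi, Scheme.lowChoice, Nat.cast_zero]
  · rw [Finset.mem_compl] at hi
    simp only [Function.comp, plan, if_neg hi, Scheme.highChoice]
    rw [Nat.cast_mul, cast_tailWeight]
    change _ * (_ * I.tail i (I.highPrice r E x i)) = _
    rw [highPrice]
    field_simp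

/-- The separate revenue is computed exactly; only the mean level suffers from the rounding, and
`resolution` is chosen to make this error small. -/
theorem abs_planValue_sub_estimate_le (hr : 0 < r) (hc : ∀ i ∈ T, c i ≤ r ^ 4) :
    |I.planValue r E (I.plan r E T c x) - I.estimate r E T c x| ≤
      E / (Scheme.denom I.raw : ℝ) ^ 2 / r := by
  have hM : (0 : ℝ) < Scheme.resolution r I.n := by exact_mod_cast resolution_pos hr I.n
  have hD := denom_pos_real (I := I)
  have hr' : (0 : ℝ) < r := by exact_mod_cast hr
  have hMdef : (Scheme.resolution r I.n : ℝ) =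
      2 * (Scheme.numRanks r : ℝ) * (r : ℝ) ^ 3 * (I.n + 1) := by
    simp only [Scheme.resolution]; push_cast; ring
  have hprod : ∀ k, ∏ i, ((I.planWeight r E T c i k : ℝ) / Scheme.denom I.raw) =
      ∏ i, I.rankCdf r (I.levels r E) T c i k := by
    intro k
    refine Finset.prod_congr rfl fun i _ => ?_
    rw [cast_planWeight, mul_div_cancel_left₀ _ hD.ne']
  have hmean := abs_sum_sub_meanLevel_le (I := I) (a := I.levels r E) (M := Scheme.resolution r I.n)
    (N := I.n) (s := fun k => roundedProd (Scheme.denom I.raw) (Scheme.resolution r I.n)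
      (List.ofFn fun i => I.planWeight r E T c i k)) hc (fun i k => min_le_right _ _) hM.le
    (fun k => by
      rw [← hprod]
      exact (roundedProd_bounds (denom_pos I) fun i => planWeight_le i k).1)
    (fun k => by
      rw [← hprod]
      exact (roundedProd_bounds (denom_pos I) fun i => planWeight_le i k).2)
  rw [← Scheme.meanLevel_map_range, show (r ^ 5 + 1) * (r ^ 4 + 1) = Scheme.numRanks r from rfl]
    at hmean
  rw [planValue, Scheme.merit, Scheme.path_ofFn plan_fst, Scheme.path_bonus, Nat.cast_add,
    Nat.cast_mul, Nat.cast_mul, cast_bonus_plan, estimate, Nat.cast_mul, Nat.cast_mul, Nat.cast_pow]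
  generalize (Scheme.meanLevel r (List.range (Scheme.numRanks r)) _ : ℝ) = L at hmean ⊢
  generalize ∑ j ∈ Tᶜ, I.highPrice r E x j * I.tail j (I.highPrice r E x j) = B
  generalize I.meanLevel r (I.levels r E) T c = N at hmean ⊢
  generalize (Scheme.resolution r I.n : ℝ) = M at hM hMdef hmean ⊢
  generalize (Scheme.denom I.raw : ℝ) = D at hD ⊢
  have h1 : (D ^ 3 * B * (r : ℝ) ^ 2 * M + E * D * L) / (D ^ 3 * (r : ℝ) ^ 2 * M) -
      (B + E / D ^ 2 / (r : ℝ) ^ 2 * N) = E / D ^ 2 / (r : ℝ) ^ 2 / M * (L - M * N) := by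
    field_simp
    ring
  have h0 : 0 ≤ E / D ^ 2 / (r : ℝ) ^ 2 / M := by positivity
  rw [h1, abs_mul, abs_of_nonneg h0]
  refine (mul_le_mul_of_nonneg_left hmean h0).trans ?_
  have h2 : (Scheme.numRanks r : ℝ) * ((r : ℝ) ^ 4 * I.n) ≤ r * M := by
    rw [hMdef]
    have h3 : (0 : ℝ) ≤ Scheme.numRanks r * (r : ℝ) ^ 4 := by positivity
    have h4 : (0 : ℝ) ≤ I.n := Nat.cast_nonneg _
    nlinarith [mul_nonneg h3 h4]
  refine (mul_le_mul_of_nonneg_left h2 h0).trans (le_of_eq ?_)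
  field_simp

/-- The price vector of a sequence of choices. -/
noncomputable def choicePrice (o : Fin I.n → Scheme.Choice) (i : Fin I.n) : ℝ :=
  ((o i).2.2.1 : ℝ) / ((o i).2.2.2 : ℝ)

theorem choicePrice_plan_of_mem (hr : 0 < r) {i : Fin I.n} (hi : i ∈ T) :
    choicePrice (I.plan r E T c x) i =
      (1 - 1 / r) * (E / (Scheme.denom I.raw : ℝ) ^ 2 / (r : ℝ) ^ 2 * c i) := by
  have hD := denom_pos_real (I := I)
  have hr' : (0 : ℝ) < r := by exact_mod_cast hr
  rw [choicePrice, plan, if_pos hi]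
  simp only [Scheme.lowChoice]
  push_cast [Nat.cast_sub (show 1 ≤ r from hr)]
  field_simp

theorem choicePrice_plan_of_notMem (hr : 0 < r) {i : Fin I.n} (hi : i ∉ T) :
    choicePrice (I.plan r E T c x) i = (1 - 1 / r) * I.highPrice r E x i := by
  have hD := denom_pos_real (I := I)
  have hr' : (0 : ℝ) < r := by exact_mod_cast hr
  rw [choicePrice, plan, if_neg hi, highPrice]
  simp only [Scheme.highChoice]
  push_cast [Nat.cast_sub (show 1 ≤ r from hr)]
  field_simp

theorem le_highPrice (i : Fin I.n) :
    (r : ℝ) ^ 2 * (E / (Scheme.denom I.raw : ℝ) ^ 2) ≤ I.highPrice r E x i := by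
  have hD := denom_pos_real (I := I)
  rw [highPrice, ← mul_div_assoc]
  refine div_le_div_of_nonneg_right ?_ (by positivity)
  exact_mod_cast le_max_right (x i) (r ^ 2 * E)

/-- Some plan is estimated at almost the revenue of given prices. -/
theorem exists_plan_estimate (hr : 2 ≤ r) (hE0 : 0 < E)
    (hE : I.IsScale (E / (Scheme.denom I.raw : ℝ) ^ 2)) {p : Fin I.n → ℝ} (hp : ∀ i, 0 ≤ p i) :
    ∃ (T : Finset (Fin I.n)) (c x : Fin I.n → ℕ), (∀ i ∈ T, c i ≤ r ^ 4) ∧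
      (∀ i ∉ T, ∃ k, x i = I.point i k) ∧
      (1 - 1 / r) * I.revenue p ≤
        I.estimate r E T c x + 4 * (E / (Scheme.denom I.raw : ℝ) ^ 2) / r := by
  have hD := denom_pos_real (I := I)
  have hr' : (2 : ℝ) ≤ r := by exact_mod_cast hr
  have hEr : (0 : ℝ) < E := by exact_mod_cast hE0
  have hd : (0 : ℝ) ≤ 1 - 1 / r := by
    rw [sub_nonneg, div_le_one (by linarith)]; linarith
  have hd1 : (1 : ℝ) - 1 / r ≤ 1 := by rw [sub_le_self_iff]; positivity
  set S : ℝ := E / (Scheme.denom I.raw : ℝ) ^ 2 with hS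
  have hS0 : 0 < S := by positivity
  have hg : 0 < S / (r : ℝ) ^ 2 := by positivity
  classical
  let T : Finset (Fin I.n) := Finset.univ.filter fun i => p i < (r : ℝ) ^ 2 * S
  let c : Fin I.n → ℕ := fun i => ⌊(1 - 1 / r) * p i / (S / (r : ℝ) ^ 2)⌋₊
  -- A high price is raised to the next mass point, which keeps the probability of sale. If the
  -- price is never accepted, any mass point serves.
  have hx : ∀ i, ∃ y, i ∉ T → (∃ k, y = I.point i k) ∧ p i * I.tail i (p i) ≤
      ((max y (r ^ 2 * E) : ℕ) : ℝ) / (Scheme.denom I.raw : ℝ) ^ 2 *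
        I.tail i (((max y (r ^ 2 * E) : ℕ) : ℝ) / (Scheme.denom I.raw : ℝ) ^ 2) := by
    intro i
    rcases tail_eq_zero_or i (p i) with h | ⟨k, hk, h⟩
    · have hK : ∃ k : Fin (I.K i), True := by
        by_contra h
        push Not at h
        have h1 := prob_sum_real (I := I) i
        rw [Finset.sum_eq_zero fun k _ => (h k).elim] at h1
        exact zero_ne_one h1
      obtain ⟨k, -⟩ := hK
      refine ⟨I.point i k, fun _ => ⟨⟨k, rfl⟩, ?_⟩⟩
      rw [h, mul_zero]
      exact mul_nonneg (by positivity) (tail_nonneg _ _)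
    · refine ⟨I.point i k, fun hi => ⟨⟨k, rfl⟩, ?_⟩⟩
      have h1 : (r : ℝ) ^ 2 * S ≤ I.value i k := by
        refine le_trans ?_ hk
        simpa [T] using hi
      have h2 : r ^ 2 * E ≤ I.point i k := by
        rw [le_point_iff]
        push_cast
        rwa [mul_div_assoc]
      rw [max_eq_left h2, point_div, h]
      exact mul_le_mul_of_nonneg_right hk (tail_nonneg _ _)
  choose x hx using hx
  have hC : ∀ i ∈ T, c i ≤ r ^ 4 := by
    intro i hi
    have h1 : p i < (r : ℝ) ^ 2 * S := (Finset.mem_filter.1 hi).2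
    refine Nat.floor_le_of_le ?_
    rw [div_le_iff₀ hg]
    refine (mul_le_of_le_one_left (hp i) hd1).trans (h1.le.trans (le_of_eq ?_))
    push_cast
    field_simp
  refine ⟨T, c, x, hC, fun i hi => (hx i hi).1, ?_⟩
  have h := revenue_le_estimate hE hS0 hr (isLevel_levels (I := I) (r := r) (by omega) hE0) hp
    (T := T) (c := c) (fun i hi => (Finset.mem_filter.1 hi).2) (fun i _ => ?_) hC
  · have h1 : ∑ j ∈ Tᶜ, p j * I.tail j (p j) ≤
        ∑ j ∈ Tᶜ, I.highPrice r E x j * I.tail j (I.highPrice r E x j) :=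
      Finset.sum_le_sum fun j hj => (hx j (Finset.mem_compl.1 hj)).2
    rw [estimate]
    linarith
  · have h1 := Nat.floor_le (a := (1 - 1 / r) * p i / (S / (r : ℝ) ^ 2))
      (div_nonneg (mul_nonneg hd (hp i)) hg.le)
    have h2 := Nat.lt_floor_add_one ((1 - 1 / r) * p i / (S / (r : ℝ) ^ 2))
    rw [le_div_iff₀ hg] at h1
    rw [div_lt_iff₀ hg] at h2
    change (c i : ℝ) * _ ≤ _ at h1
    change _ < ((c i : ℝ) + 1) * _ at h2
    constructor <;> linarith

/-- The prices of the choices of largest merit are almost optimal. -/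
theorem revenue_le_of_best (hr : 2 ≤ r) (hE0 : 0 < E)
    (hE : I.IsScale (E / (Scheme.denom I.raw : ℝ) ^ 2)) {o : Fin I.n → Scheme.Choice}
    (ho : ∀ i, o i ∈ I.options r E i)
    (hbest : ∀ o' : Fin I.n → Scheme.Choice, (∀ i, o' i ∈ I.options r E i) →
      I.planValue r E o' ≤ I.planValue r E o) {p : Fin I.n → ℝ} (hp : ∀ i, 0 ≤ p i) :
    (1 - 3 / r) * I.revenue p ≤
      I.revenue (choicePrice o) + 8 * (E / (Scheme.denom I.raw : ℝ) ^ 2) / r := by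
  have hD := denom_pos_real (I := I)
  have hr' : (2 : ℝ) ≤ r := by exact_mod_cast hr
  have hEr : (0 : ℝ) < E := by exact_mod_cast hE0
  obtain ⟨T', c', x', hc', hx', h1⟩ := exists_plan_estimate hr hE0 hE hp
  obtain ⟨T, c, x, hc, rfl⟩ := exists_plan ho
  have h2 := hbest _ (plan_mem hc' hx')
  have h3 := abs_le.1 (abs_planValue_sub_estimate_le (E := E) (x := x') (by omega) hc')
  have h4 := abs_le.1 (abs_planValue_sub_estimate_le (E := E) (x := x) (by omega) hc)
  have h5 := estimate_le_revenue hE (by positivity) hr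
    (isLevel_levels (I := I) (r := r) (by omega) hE0) (p := choicePrice (I.plan r E T c x))
    (y := I.highPrice r E x) hc (fun i hi => choicePrice_plan_of_mem (by omega) hi)
    (fun i _ => le_highPrice i)
    (fun i hi => choicePrice_plan_of_notMem (by omega) (Finset.mem_compl.1 hi))
  change _ * I.estimate r E T c x ≤ _ at h5
  have hR := revenue_nonneg hp
  set S : ℝ := E / (Scheme.denom I.raw : ℝ) ^ 2 with hS
  have hS0 : 0 < S := by positivity
  set d : ℝ := 1 / r with hdr
  have hd0 : 0 < d := by positivity
  have hd1 : d ≤ 1 / 2 := by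
    rw [hdr]; exact one_div_le_one_div_of_le (by norm_num) hr'
  have e1 : S / r = S * d := by rw [hdr]; ring
  have e2 : 4 * S / r = 4 * (S * d) := by rw [hdr]; ring
  have e3 : 2 * S / r = 2 * (S * d) := by rw [hdr]; ring
  have e4 : 8 * S / r = 8 * (S * d) := by rw [hdr]; ring
  have e5 : 3 / (r : ℝ) = 3 * d := by rw [hdr]; ring
  rw [e1] at h3 h4
  rw [e2] at h1
  rw [e3] at h5
  rw [e4, e5]
  have hSd : 0 ≤ S * d := by positivity
  -- The constant is `4` from the upper estimate and `1` for each of the two rounded merits.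
  have h6 : (1 - d) * I.revenue p - 6 * (S * d) ≤ I.estimate r E T c x := by linarith [h3.1, h4.2]
  have h7 := mul_le_mul_of_nonneg_left h6 (sq_nonneg (1 - d))
  have h8 : (1 - d) ^ 2 * (6 * (S * d)) ≤ 6 * (S * d) :=
    mul_le_of_le_one_left (by positivity) (by nlinarith)
  -- This is `(1 - d)³ ≥ 1 - 3d`.
  have h9 : (1 - 3 * d) * I.revenue p ≤ (1 - d) ^ 2 * ((1 - d) * I.revenue p) := by
    rw [← mul_assoc]
    refine mul_le_mul_of_nonneg_right ?_ hR
    nlinarith [mul_nonneg hd0.le hd0.le, mul_nonneg (mul_nonneg hd0.le hd0.le) (by linarith : 0 ≤ 3 - d)]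
  linarith

end Instance

end UnitDemand

namespace UnitDemand

open BitCost

namespace Instance

/-! ### The approximation guarantee of the algorithm. -/

variable {I : Instance}

/-- The additive loss `8 E / r` becomes relative through `E ≤ 4 · revenue`: `3 / r + 32 / r = 35 / r
≤ ε`. -/
theorem solve_spec (I : Instance) (e : ℕ × ℕ) (he : 0 < e.1) (he' : 0 < e.2) :
    ∃ o : Fin I.n → Scheme.Choice, Scheme.solve (e, I.raw) = List.ofFn (fun i => (o i).2.2) ∧
      (∀ i, 0 < (o i).2.2.2) ∧ ∀ p : Fin I.n → ℝ, (∀ i, 0 ≤ p i) →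
        (1 - (e.1 : ℝ) / e.2) * I.revenue p ≤ I.revenue (choicePrice o) := by
  have hlen : I.raw.length = I.n := by simp [raw]
  have hacc : 100 ≤ Scheme.accuracy e := Nat.le_mul_of_pos_right 100 (Nat.succ_pos _)
  set r := Scheme.accuracy e with hr
  have hr2 : 2 ≤ r := le_trans (by norm_num) hacc
  have hr' : (2 : ℝ) ≤ r := by exact_mod_cast hr2
  set E := Scheme.scale (Scheme.denom I.raw) (List.ofFn I.item) with hE
  have hscale : I.IsScale (E / (Scheme.denom I.raw : ℝ) ^ 2) := isScale_scale I
  have hD := denom_pos_real (I := I)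
  obtain ⟨o, ho, h1, h2⟩ := Scheme.prices_spec (D := Scheme.denom I.raw)
    (M := Scheme.resolution r I.n) (ranks := List.range (Scheme.numRanks r)) (r := r) (E := E)
    (levels := List.range (r ^ 4 + 1))
    (Z := Scheme.vectors (List.range (Scheme.resolution r I.n + 1))
      (List.range (Scheme.numRanks r))) (item := I.item)
    (fun z => by simp only [Scheme.mem_vectors, List.mem_range, Nat.lt_succ_iff])
    (fun i => proper_options i)
    (fun i => by simp [Scheme.choices])
  refine ⟨o, ?_, ?_, fun p hp => ?_⟩
  · rw [Scheme.solve]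
    simp only [hlen, integral_raw]
    exact h1
  · obtain ⟨T, c, x, -, rfl⟩ := exists_plan ho
    intro i
    have := denom_pos I
    rw [plan]
    split_ifs
    · simp only [Scheme.lowChoice]; positivity
    · simp only [Scheme.highChoice]; positivity
  · have hnonneg : ∀ i, 0 ≤ choicePrice o i := fun i =>
      div_nonneg (Nat.cast_nonneg _) (Nat.cast_nonneg _)
    -- If the scale is `0`, no prices earn anything and every output is optimal.
    rcases Nat.eq_zero_or_pos E with h0 | h0
    · have h3 := hscale.revenue_le p hp
      rw [h0, Nat.cast_zero, zero_div] at h3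
      have h4 : I.revenue p = 0 := le_antisymm h3 (revenue_nonneg hp)
      rw [h4, mul_zero]
      exact revenue_nonneg hnonneg
    · have key := fun p hp => revenue_le_of_best (I := I) (p := p) hr2 h0 hscale ho
        (fun o' ho' => div_le_div_of_nonneg_right (by exact_mod_cast h2 o' ho')
          (by positivity)) hp
      obtain ⟨p₀, hp₀, h3⟩ := hscale.le_revenue
      -- The scale is comparable to the revenue of `p₀`, not of `p`; the better of the two dominates
      -- both.
      have h4 : ∃ p₁ : Fin I.n → ℝ, (∀ i, 0 ≤ p₁ i) ∧ I.revenue p ≤ I.revenue p₁ ∧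
          I.revenue p₀ ≤ I.revenue p₁ := by
        rcases le_total (I.revenue p) (I.revenue p₀) with h | h
        · exact ⟨p₀, hp₀, h, le_rfl⟩
        · exact ⟨p, hp, le_rfl, h⟩
      obtain ⟨p₁, hp₁, h5, h6⟩ := h4
      have h7 := key p₁ hp₁
      have hr0 : (0 : ℝ) < r := by linarith
      have h8 : 8 * (E / (Scheme.denom I.raw : ℝ) ^ 2) / r ≤ 32 / r * I.revenue p₁ := by
        rw [div_mul_eq_mul_div]
        exact div_le_div_of_nonneg_right (by linarith) hr0.le
      have h9 : 35 / (r : ℝ) ≤ e.1 / e.2 := by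
        have h10 : e.2 < e.1 * (e.2 / e.1 + 1) := Nat.lt_mul_div_succ _ he
        have h11 : 35 * e.2 ≤ e.1 * r := by
          rw [hr, Scheme.accuracy]; nlinarith
        rw [div_le_div_iff₀ hr0 (by exact_mod_cast he')]
        exact_mod_cast h11
      have h10 := revenue_nonneg hp
      have h11 : (1 - (e.1 : ℝ) / e.2) * I.revenue p ≤ (1 - 35 / r) * I.revenue p :=
        mul_le_mul_of_nonneg_right (by linarith) h10
      have h12 : (0 : ℝ) ≤ 1 - 35 / r := by
        have h14 : (100 : ℝ) ≤ r := by exact_mod_cast hacc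
        rw [sub_nonneg, div_le_one hr0]; linarith
      have h13 := mul_le_mul_of_nonneg_left h5 h12
      have h14 : (1 - 35 / (r : ℝ)) * I.revenue p₁ =
          (1 - 3 / r) * I.revenue p₁ - 32 / r * I.revenue p₁ := by ring
      linarith

end Instance

end UnitDemand

theorem mainTheorem7 :
    ∃ A : BitCost.Prog, ∀ ε : NNRat, 0 < ε → ε < 1 →
      ∃ q : Polynomial ℕ, ∀ I : UnitDemand.Instance,
        ∃ (a b : Fin I.n → ℕ) (t : ℕ),
          (∀ i, 0 < b i) ∧
          BitCost.Runs A (.pair (.rat ε) I.encode) (UnitDemand.encodePrices a b) t ∧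
          t ≤ q.eval I.encode.size ∧
          ∀ p : Fin I.n → ℝ, (∀ i, 0 ≤ p i) →
            (1 - (ε : ℝ)) * I.revenue p ≤ I.revenue (fun i => (a i : ℝ) / (b i : ℝ)) := by
  obtain ⟨A, q, hA⟩ := UnitDemand.Scheme.timeIn_solve
  refine ⟨A, fun ε hε _ => ?_⟩
  -- The program and its polynomial in `cost` are fixed before `ε`; only the polynomial bound on
  -- `cost` depends on it.
  obtain ⟨q', hq'⟩ := UnitDemand.Scheme.exists_polynomial_cost_le (ε.num, ε.den)
  refine ⟨q.comp q', fun I => ?_⟩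
  obtain ⟨o, h1, h2, h3⟩ := I.solve_spec (ε.num, ε.den) (NNRat.num_pos.2 hε) ε.den_pos
  obtain ⟨t, h4, h5⟩ := hA ((ε.num, ε.den), I.raw)
  refine ⟨fun i => (o i).2.2.1, fun i => (o i).2.2.2, t, h2, ?_, ?_, fun p hp => ?_⟩
  · rw [I.encode_eq]
    rw [h1] at h4
    have h6 : UnitDemand.encodePrices (fun i => (o i).2.2.1) (fun i => (o i).2.2.2) =
        BitCost.Enc.enc (List.ofFn fun i => (o i).2.2) := by
      simp only [UnitDemand.encodePrices, BitCost.Enc.enc, List.map_ofFn, Function.comp_def]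
      rfl
    rw [h6]
    exact h4
  · rw [Polynomial.eval_comp, I.encode_eq]
    exact h5.trans (BitCost.Polynomial.monotone_eval_nat q (hq' I.raw))
  · have h6 := h3 p hp
    rwa [← NNRat.cast_def] at h6
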